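/- All logarithms are to base $2$. Let $\mathcal X$ be a finite set, $\mathcal Y$ a measurable space, and $\boldsymbol W=(W_x)_{x\in\mathcal X}$ a channel (a family of probability measures on $\mathcal Y$). For a distribution $P$ on $\mathcal X$ put $W_P=\sum_x P(x)W_x$. Assume the non-redundancy condition $$\text{(W2)}\qquad \min_{x\in\mathcal X}\ \min_{P\in\mathcal P(\mathcal X\setminus\{x\})} D(W_P\,\|\,W_x)>0,$$ where $D$ is the Kullback–Leibler divergence (a minimum over the empty set is $+\infty$). **Information quantities.** For $\alpha>1$ let $D_\alpha(P\|Q)=\frac1{\alpha-1}\log\mathbb E_P[(p(Y)/q(Y))^{\alpha-1}]$ (equal to $\infty$ if $P\not\ll Q$). For $P\in\mathcal P(\mathcal X)$ let $I(X;Y)_P=\sum_xP(x)D(W_x\|W_P)$ and $$I_\alpha(X;Y)_P=\min_{Q\in\mathcal P(\mathcal Y)}\frac1{\alpha-1}\log\sum_xP(x)2^{(\alpha-1)D_\alpha(W_x\|Q)}.$$ For a finite set $\mathcal U$ and $P\in\mathcal P(\mathcal U\times\mathcal X)$ with marginal $P_U$ let $H(X|U)_P$ be the conditional entropy, $I(X;Y|U)_P=\sum_uP_U(u)I(X;Y)_{P_{X|U=u}}$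 and $I_\alpha(X;Y|U)_P=\sum_uP_U(u)I_\alpha(X;Y)_{P_{X|U=u}}$. **Regions.** $\mathcal C$ is the set of $(R_1,R_2,R_3)\in\mathbb R^3$ with $R_1,R_2,R_3>0$ for which there are a finite set $\mathcal U$ and $P\in\mathcal P(\mathcal U\times\mathcal X)$ with $0<R_1-R_2<I(X;Y|U)_P$, $R_3\le R_1-I(X;Y|U)_P$ and $R_1<H(X|U)_P$. $\mathcal C_\alpha$ is defined in the same way, with $R_3<R_1-I_\alpha(X;Y|U)_P$ in place of $R_3\le R_1-I(X;Y|U)_P$. **Codes.** A deterministic code for $n$ uses of the channel consists of integers $1\le\mathsf L<\mathsf M$, an encoder $\phi:\{1,\dots,\mathsf M\}\to\mathcal X^n$ and a measurable decoder $\Psi$ that assigns to each $y\in\mathcal Y^n$ a set $\Psi(y)\subset\{1,\dots,\mathsf M\}$ with at most $\mathsf L$ elements. With the memoryless extension $W^n_{x}=W_{x_1}\times\dots\times W_{x_n}$ put $$\epsilon_A=\max_m W^n_{\phi(m)}\{y:m\notin\Psi(y)\},\qquad \delta_C=\max_{m\ne m'}W^n_{\phi(m)}\{y:m'\in\Psi(y)\},$$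 and let $\delta_D$ be the maximum over $x\in\mathcal X^n$ of the second largest member (with multiplicity) of the family $(W^n_x\{y:m\in\Psi(y)\})_{m}$. The equivocations are $$E(\phi)=\log\mathsf M-\min_{Q}\sum_m\tfrac1{\mathsf M}D(W^n_{\phi(m)}\|Q),\qquad E_\alpha(\phi)=\log\mathsf M-\min_{Q}\tfrac1{\alpha-1}\log\sum_m\tfrac1{\mathsf M}2^{(\alpha-1)D_\alpha(W^n_{\phi(m)}\|Q)},$$ with $Q$ over the probability measures on $\mathcal Y^n$. **Achievability.** A triple $(R_1,R_2,R_3)$ of positive reals is strongly (weakly) deterministically achievable if there are deterministic codes $(\phi_n,\Psi_n)$ with sizes $\mathsf M_n,\mathsf L_n$ such that $\epsilon_A\to0$, $\delta_D\to0$ (respectively $\delta_C\to0$), $\frac1n\log\mathsf M_n\to R_1$, $\frac1n\log\mathsf L_n\to R_2$ and $\liminf_{n}\frac1nE(\phi_n)\ge R_3$. These triples form $\mathcal R^L_{(s,d)}$ (respectively $\mathcal R^L_{(w,d)}$); $\mathcal R^{L,\alpha}_{(s,d)}$ and $\mathcal R^{L,\alpha}_{(w,d)}$ are defined in the same way with $E_\alpha$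 in place of $E$. **Statement.** Under (W2), for each $G\in\{(s,d),(w,d)\}$, $$\overline{\mathcal R^L_G}=\overline{\mathcal C},\qquad\text{and}\qquad \mathcal C_\alpha\subset\mathcal R^{L,\alpha}_G\quad\text{for every }\alpha>1 .$$ -/

import Mathlib

open MeasureTheory Filter Topology
open scoped ENNReal

namespace SecureListDecoding

noncomputable section

/-! ### Logarithm, exponential and divergences to base 2 -/

/-- The base-2 logarithm on `[0, ∞]`, with `log₂ 0 = -∞` and `log₂ ∞ = ∞`. -/
def log2 (a : ℝ≥0∞) : EReal := ENNReal.log a / ((Real.log 2 : ℝ) : EReal)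

/-- The base-2 exponential on `[-∞, ∞]`, the inverse of `log2`. -/
def exp2 (a : EReal) : ℝ≥0∞ := EReal.exp (a * ((Real.log 2 : ℝ) : EReal))

/-- The Kullback-Leibler divergence `D(P‖Q)` in bits. -/
def klBits {B : Type*} [MeasurableSpace B] (P Q : Measure B) : ℝ≥0∞ :=
  InformationTheory.klDiv P Q / ENNReal.ofReal (Real.log 2)

open Classical in
/-- `E_P[(p(Y)/q(Y))^(α-1)]` for `α > 1`; it is infinite when `P` is not absolutely continuous
with respect to `Q`, because then `p/q = ∞` on a set of positive `P`-probability. -/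
def renyiMoment {B : Type*} [MeasurableSpace B] (α : ℝ) (P Q : Measure B) : ℝ≥0∞ :=
  if P ≪ Q then ∫⁻ y, (P.rnDeriv Q y) ^ (α - 1) ∂P else ∞

/-- The Rényi divergence `D_α(P‖Q) = (α-1)⁻¹ log₂ E_P[(p(Y)/q(Y))^(α-1)]` of order `α > 1`. -/
def renyiDiv {B : Type*} [MeasurableSpace B] (α : ℝ) (P Q : Measure B) : EReal :=
  log2 (renyiMoment α P Q) / ((α - 1 : ℝ) : EReal)

/-! ### Channels and information quantities

A channel with input alphabet `A` and output space `B` is a family of probability measures on `B`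
indexed by `A`. A distribution on a finite set is a point of its standard simplex. -/

section Information

variable {X Y : Type*} [Fintype X] [MeasurableSpace Y]

/-- The output distribution `W_P = ∑ x, P(x) W_x`. -/
def mixture (W : X → ProbabilityMeasure Y) (P : X → ℝ) : Measure Y :=
  ∑ x, ENNReal.ofReal (P x) • (W x : Measure Y)

/-- The non-redundancy condition: `min_x min_P D(∑_{x' ≠ x} P(x') W_{x'} ‖ W_x) > 0`, where `P` runs
over the distributions on `X ∖ {x}`, i.e. the distributions on `X` with `P(x) = 0`. -/
def NonRedundant (W : X → ProbabilityMeasure Y) : Prop :=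
  0 < ⨅ (x : X) (P : X → ℝ) (_ : P ∈ stdSimplex ℝ X ∧ P x = 0),
    klBits (mixture W P) (W x : Measure Y)

/-- `I(X;Y)_P = ∑ x, P(x) D(W_x‖W_P)`. -/
def mutualInfo (W : X → ProbabilityMeasure Y) (P : X → ℝ) : ℝ :=
  ∑ x, P x * (klBits (W x : Measure Y) (mixture W P)).toReal

/-- `I_α(X;Y)_P = min_Q D_α(W × P ‖ Q × P)`, where
`D_α(W × P ‖ Q × P) = (α-1)⁻¹ log₂ ∑ x, P(x) 2^((α-1) D_α(W_x‖Q))`, for `α > 1`. -/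
def renyiInfo (α : ℝ) (W : X → ProbabilityMeasure Y) (P : X → ℝ) : ℝ :=
  (⨅ Q : ProbabilityMeasure Y,
    log2 (∑ x, ENNReal.ofReal (P x) *
      exp2 (((α - 1 : ℝ) : EReal) * renyiDiv α (W x : Measure Y) (Q : Measure Y)))
      / ((α - 1 : ℝ) : EReal)).toReal

variable {U : Type*} [Fintype U]

/-- The marginal `P_U(u)`. -/
def marginalU (P : U × X → ℝ) (u : U) : ℝ := ∑ x, P (u, x)

/-- The conditional distribution `P_{X|U=u}`; it only occurs multiplied by `P_U(u)`. -/
def condX (P : U × X → ℝ) (u : U) (x : X) : ℝ := P (u, x) / marginalU P u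

/-- `H(X|U)_P`. -/
def condEntropy (P : U × X → ℝ) : ℝ :=
  -∑ u, ∑ x, P (u, x) * Real.logb 2 (P (u, x) / marginalU P u)

/-- `I(X;Y|U)_P = ∑ u, P_U(u) I(X;Y)_{P_{X|U=u}}`. -/
def condMutualInfo (W : X → ProbabilityMeasure Y) (P : U × X → ℝ) : ℝ :=
  ∑ u, marginalU P u * mutualInfo W (condX P u)

/-- `I_α(X;Y|U)_P = ∑ u, P_U(u) I_α(X;Y)_{P_{X|U=u}}`. -/
def condRenyiInfo (α : ℝ) (W : X → ProbabilityMeasure Y) (P : U × X → ℝ) : ℝ :=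
  ∑ u, marginalU P u * renyiInfo α W (condX P u)

end Information

/-! ### The single-letter regions (no bound on the cardinality of the finite set `U`) -/

section Regions

variable {X Y : Type*} [Fintype X] [MeasurableSpace Y]

/-- The region `𝒞` of triples `(R₁, R₂, R₃)`. -/
def regionC (W : X → ProbabilityMeasure Y) : Set (ℝ × ℝ × ℝ) :=
  {R | ∃ (k : ℕ) (P : Fin k × X → ℝ), P ∈ stdSimplex ℝ (Fin k × X) ∧
    (0 < R.1 - R.2.1 ∧ R.1 - R.2.1 < condMutualInfo W P) ∧
    R.2.2 ≤ R.1 - condMutualInfo W P ∧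
    R.1 < condEntropy P ∧
    (0 < R.1 ∧ 0 < R.2.1 ∧ 0 < R.2.2)}

/-- The region `𝒞_α` of triples `(R₁, R₂, R₃)`. -/
def regionCα (α : ℝ) (W : X → ProbabilityMeasure Y) : Set (ℝ × ℝ × ℝ) :=
  {R | ∃ (k : ℕ) (P : Fin k × X → ℝ), P ∈ stdSimplex ℝ (Fin k × X) ∧
    (0 < R.1 - R.2.1 ∧ R.1 - R.2.1 < condMutualInfo W P) ∧
    R.2.2 < R.1 - condRenyiInfo α W P ∧
    R.1 < condEntropy P ∧
    (0 < R.1 ∧ 0 < R.2.1 ∧ 0 < R.2.2)}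

end Regions

/-! ### Codes for secure list decoding -/

/-- A deterministic list code for a channel with inputs in `A` and outputs in `B`: `M` messages,
list size `L` with `1 ≤ L < M`, an encoder `φ`, and a measurable decoder `Ψ` that lists at most
`L` messages. -/
structure ListCode (A B : Type*) [MeasurableSpace B] where
  M : ℕ
  L : ℕ
  one_le_L : 1 ≤ L
  L_lt_M : L < M
  φ : Fin M → A
  Ψ : B → Finset (Fin M)
  card_le : ∀ y, (Ψ y).card ≤ L
  measurableSet_mem : ∀ m, MeasurableSet {y | m ∈ Ψ y}

section Codes

variable {A B : Type*} [MeasurableSpace B]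

/-- `ε_A(φ, Ψ) = max_m Pr[m ∉ Ψ(Y) | X = φ(m)]`. -/
def errA (V : A → ProbabilityMeasure B) (c : ListCode A B) : ℝ≥0∞ :=
  ⨆ m, (V (c.φ m) : Measure B) {y | m ∉ c.Ψ y}

/-- Binding parameter for honest Alice: `δ_C(φ, Ψ) = max_{m' ≠ m} Pr[m' ∈ Ψ(Y) | X = φ(m)]`. -/
def deltaC (V : A → ProbabilityMeasure B) (c : ListCode A B) : ℝ≥0∞ :=
  ⨆ (m) (m') (_ : m' ≠ m), (V (c.φ m) : Measure B) {y | m' ∈ c.Ψ y}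

/-- Binding parameter for dishonest Alice: `δ_D(Ψ) = max_x` of the second largest member (counted
with multiplicity) of the family `(Pr[m ∈ Ψ(Y) | X = x])_m`. The second largest member of a family
is the maximum of `min (p_m) (p_m')` over the pairs of distinct indices. -/
def deltaD (V : A → ProbabilityMeasure B) (c : ListCode A B) : ℝ≥0∞ :=
  ⨆ (x : A) (m) (m') (_ : m' ≠ m),
    min ((V x : Measure B) {y | m ∈ c.Ψ y}) ((V x : Measure B) {y | m' ∈ c.Ψ y})

/-- The equivocation `E(φ) = log₂ M - min_Q ∑ m, M⁻¹ D(V_{φ(m)}‖Q)`; it equals `H(M|Y)` for the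
uniformly distributed message. -/
def equivocation (V : A → ProbabilityMeasure B) (c : ListCode A B) : ℝ :=
  Real.logb 2 c.M -
    (⨅ Q : ProbabilityMeasure B,
      ∑ m, (c.M : ℝ≥0∞)⁻¹ * klBits (V (c.φ m) : Measure B) (Q : Measure B)).toReal

/-- The Rényi equivocation
`E_α(φ) = log₂ M - min_Q (α-1)⁻¹ log₂ ∑ m, M⁻¹ 2^((α-1) D_α(V_{φ(m)}‖Q))` of order `α > 1`. -/
def renyiEquivocation (α : ℝ) (V : A → ProbabilityMeasure B) (c : ListCode A B) : ℝ :=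
  Real.logb 2 c.M -
    (⨅ Q : ProbabilityMeasure B,
      log2 (∑ m, (c.M : ℝ≥0∞)⁻¹ *
        exp2 (((α - 1 : ℝ) : EReal) * renyiDiv α (V (c.φ m) : Measure B) (Q : Measure B)))
        / ((α - 1 : ℝ) : EReal)).toReal

end Codes

/-! ### Achievable rate regions for the memoryless extension -/

/-- The type of binding: against a dishonest Alice (strong) or for an honest Alice (weak). -/
inductive Binding
  | strong
  | weak

section Achievable

variable {X Y : Type*} [MeasurableSpace Y]

/-- The `n`-fold memoryless extension `Wⁿ` of the channel `W`. -/
def channelPow (W : X → ProbabilityMeasure Y) (n : ℕ) (x : Fin n → X) :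
    ProbabilityMeasure (Fin n → Y) :=
  ⟨Measure.pi fun i => (W (x i) : Measure Y), inferInstance⟩

/-- The binding parameter: `δ_D` for strong and `δ_C` for weak binding. -/
def bindingParam {A B : Type*} [MeasurableSpace B] (G : Binding) (V : A → ProbabilityMeasure B)
    (c : ListCode A B) : ℝ≥0∞ :=
  match G with
  | .strong => deltaD V c
  | .weak => deltaC V c

/-- The sequence of codes is (strongly or weakly) secure. -/
def Secure (G : Binding) (W : X → ProbabilityMeasure Y)
    (c : ∀ n : ℕ, ListCode (Fin n → X) (Fin n → Y)) : Prop :=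
  Tendsto (fun n => errA (channelPow W n) (c n)) atTop (𝓝 0) ∧
  Tendsto (fun n => bindingParam G (channelPow W n) (c n)) atTop (𝓝 0)

/-- The message rates converge to `R₁` and the list rates to `R₂`. -/
def HasRates (c : ∀ n : ℕ, ListCode (Fin n → X) (Fin n → Y)) (R₁ R₂ : ℝ) : Prop :=
  Tendsto (fun n => Real.logb 2 (c n).M / n) atTop (𝓝 R₁) ∧
  Tendsto (fun n => Real.logb 2 (c n).L / n) atTop (𝓝 R₂)

/-- The set of triples of positive rates that are achievable by deterministic codes. -/
def achievable (G : Binding) (W : X → ProbabilityMeasure Y) : Set (ℝ × ℝ × ℝ) :=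
  {R | (0 < R.1 ∧ 0 < R.2.1 ∧ 0 < R.2.2) ∧
    ∃ c : ∀ n : ℕ, ListCode (Fin n → X) (Fin n → Y),
      Secure G W c ∧ HasRates c R.1 R.2.1 ∧
      (R.2.2 : EReal) ≤
        liminf (fun n : ℕ => ((equivocation (channelPow W n) (c n) / n : ℝ) : EReal)) atTop}

/-- The set of triples of positive rates that are `α`-achievable by deterministic codes. -/
def achievableα (α : ℝ) (G : Binding) (W : X → ProbabilityMeasure Y) : Set (ℝ × ℝ × ℝ) :=
  {R | (0 < R.1 ∧ 0 < R.2.1 ∧ 0 < R.2.2) ∧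
    ∃ c : ∀ n : ℕ, ListCode (Fin n → X) (Fin n → Y),
      Secure G W c ∧ HasRates c R.1 R.2.1 ∧
      (R.2.2 : EReal) ≤
        liminf (fun n : ℕ => ((renyiEquivocation α (channelPow W n) (c n) / n : ℝ) : EReal))
          atTop}

end Achievable

end

end SecureListDecoding

/-! Strong security implies weak security along the same sequence of codes (`Secure.weak`), so one
converse for weak binding and one construction with strong binding settle both cases.

Converse. Reliability together with binding forces the encoder to be injective
(`injective_of_small`), so log M is the entropy of the uniform law on the codewords. Fano's
inequality for lists (`le_codeRadius`) bounds the information radius of the code from below by about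
log (M/L), and the equivocation is log M minus this radius. Hence the radius is constrained from
both sides, and it has to be single-letterised with equality while the entropy is only bounded from
above. With the later letters as auxiliary variable, the chain rule yields a single-letter
information that is at most the radius per letter; with the letter position alone as auxiliary
variable, it is at least the radius per letter. In both cases the entropy bound holds. The set of
pairs (information, entropy) under time sharing is convex, so a point between the two matches the
radius exactly (`exists_infoSet_eq_infoRadius`). A single large n then places the triple near 𝒞; the
strict positivity of the information required there follows from (W2).

Direct part. A deterministic sequence `u` with the right frequencies replaces the time-sharing
variable, and codewords are chosen among typical words by averaging and expurgation
(`exists_words_cost`). A message is listed if its codeword passes two tests. The likelihood-ratio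
test keeps the number of false messages below the list size, which needs R₁ - R₂ < I. The distance
test gives binding: by (W2) and Hahn–Banach each letter has a bounded function whose mean is zero
under its own output law and at least η under all others (`NonRedundant.exists_test`). Since R₁ < H,
the codewords can be kept at pairwise distance of order n, so no input word is close to two of them
and one of the two tests rejects.

The equivocation is bounded from below by inserting a product reference law in the minimum.
Typicality makes the sum of the letter divergences, or of the letter exponents in the Rényi case,
close to its mean, for every codeword; hence it suffices to carry one extra function `g` through the
code construction (`exists_secure_codes`). -/

namespace SecureListDecoding

open ProbabilityTheory InformationTheory

/-! ### Densities, divergences and Chebyshev's inequality for product measures -/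

section Product

variable {ι : Type*} [Fintype ι] {B : ι → Type*} [∀ i, MeasurableSpace (B i)]

lemma lintegral_pi_prod (ν : ∀ i, Measure (B i)) [∀ i, IsProbabilityMeasure (ν i)]
    {f : ∀ i, B i → ℝ≥0∞} (hf : ∀ i, Measurable (f i)) :
    ∫⁻ y, ∏ i, f i (y i) ∂Measure.pi ν = ∏ i, ∫⁻ y, f i y ∂ν i := by
  refine (lintegral_prod_eq_prod_lintegral_of_indepFun Finset.univ
    (fun i (y : ∀ i, B i) => f i (y i)) (iIndepFun_pi fun i => (hf i).aemeasurable)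
    fun i => (hf i).comp (measurable_pi_apply i)).trans ?_
  refine Finset.prod_congr rfl fun i _ => ?_
  exact (measurePreserving_eval ν i).lintegral_comp (hf i)

variable (P Q : ∀ i, Measure (B i)) [∀ i, IsProbabilityMeasure (P i)]
  [∀ i, IsProbabilityMeasure (Q i)]

/-- Boxes determine a product measure, and the indicator of a box splits into a product over
coordinates, as the density does. -/
lemma pi_eq_withDensity (h : ∀ i, P i ≪ Q i) :
    Measure.pi P =
      (Measure.pi Q).withDensity fun y => ∏ i, (P i).rnDeriv (Q i) (y i) := by
  refine (Measure.pi_eq fun s hs => ?_)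
  have hm : ∀ i, Measurable ((s i).indicator ((P i).rnDeriv (Q i))) :=
    fun i => (Measure.measurable_rnDeriv _ _).indicator (hs i)
  rw [withDensity_apply _ (MeasurableSet.univ_pi hs),
    ← lintegral_indicator (MeasurableSet.univ_pi hs)]
  have key : (Set.univ.pi s).indicator (fun y => ∏ i, (P i).rnDeriv (Q i) (y i)) =
      fun y => ∏ i, (s i).indicator ((P i).rnDeriv (Q i)) (y i) := by
    funext y
    by_cases hy : y ∈ Set.univ.pi s
    · rw [Set.indicator_of_mem hy]
      exact Finset.prod_congr rfl fun i _ => by rw [Set.indicator_of_mem (hy i trivial)]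
    · rw [Set.indicator_of_notMem hy]
      simp only [Set.mem_univ_pi, not_forall] at hy
      obtain ⟨i, hi⟩ := hy
      exact (Finset.prod_eq_zero (Finset.mem_univ i) (Set.indicator_of_notMem hi _)).symm
  rw [key, lintegral_pi_prod Q hm]
  refine Finset.prod_congr rfl fun i _ => ?_
  rw [lintegral_indicator (hs i), ← withDensity_apply _ (hs i),
    Measure.withDensity_rnDeriv_eq _ _ (h i)]

lemma pi_absolutelyContinuous (h : ∀ i, P i ≪ Q i) : Measure.pi P ≪ Measure.pi Q := by
  rw [pi_eq_withDensity P Q h]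
  exact withDensity_absolutelyContinuous _ _

lemma rnDeriv_pi (h : ∀ i, P i ≪ Q i) :
    (Measure.pi P).rnDeriv (Measure.pi Q) =ᵐ[Measure.pi P]
      fun y => ∏ i, (P i).rnDeriv (Q i) (y i) := by
  refine (pi_absolutelyContinuous P Q h).ae_le ?_
  nth_rewrite 1 [pi_eq_withDensity P Q h]
  refine Measure.rnDeriv_withDensity _ ?_
  exact Finset.measurable_prod _ fun i _ =>
    (Measure.measurable_rnDeriv _ _).comp (measurable_pi_apply i)

lemma ae_pi_eval {p : ∀ i, B i → Prop} (h : ∀ i, ∀ᵐ y ∂P i, p i y) :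
    ∀ᵐ y ∂Measure.pi P, ∀ i, p i (y i) := by
  rw [ae_all_iff]
  intro i
  exact (measurePreserving_eval P i).quasiMeasurePreserving.ae (h i)

lemma integral_pi_eval {i : ι} {f : B i → ℝ} (hf : AEStronglyMeasurable f (P i)) :
    ∫ y, f (y i) ∂Measure.pi P = ∫ y, f y ∂P i := by
  have h := integral_map (μ := Measure.pi P) (φ := fun y => y i) (f := f)
    (measurable_pi_apply i).aemeasurable
    (by rw [(measurePreserving_eval P i).map_eq]; exact hf)
  rw [← h, (measurePreserving_eval P i).map_eq]

lemma llr_pi (h : ∀ i, P i ≪ Q i) :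
    llr (Measure.pi P) (Measure.pi Q) =ᵐ[Measure.pi P]
      fun y => ∑ i, llr (P i) (Q i) (y i) := by
  have h1 := ae_pi_eval P (p := fun i y => 0 < (P i).rnDeriv (Q i) y)
    fun i => Measure.rnDeriv_pos (h i)
  have h2 := ae_pi_eval P (p := fun i y => (P i).rnDeriv (Q i) y < ∞)
    fun i => (h i).ae_le (Measure.rnDeriv_lt_top _ _)
  filter_upwards [rnDeriv_pi P Q h, h1, h2] with y hy h1 h2
  simp only [llr, hy, ENNReal.toReal_prod]
  exact Real.log_prod fun i _ => (ENNReal.toReal_pos (h1 i).ne' (h2 i).ne).ne'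

/-- The log-likelihood ratio of the products is the sum over the coordinates. If a summand is
infinite the bound is trivial, so the inequality avoids a case distinction; it is all that is
needed. -/
lemma klDiv_pi_le : klDiv (Measure.pi P) (Measure.pi Q) ≤ ∑ i, klDiv (P i) (Q i) := by
  by_cases hf : ∀ i, klDiv (P i) (Q i) ≠ ∞
  · have h : ∀ i, P i ≪ Q i := fun i => (klDiv_ne_top_iff.1 (hf i)).1
    have hi : ∀ i, Integrable (llr (P i) (Q i)) (P i) := fun i => (klDiv_ne_top_iff.1 (hf i)).2
    have hi' : ∀ i, Integrable (fun y : ∀ i, B i => llr (P i) (Q i) (y i)) (Measure.pi P) :=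
      fun i => (measurePreserving_eval P i).integrable_comp_of_integrable (hi i)
    have hs : Integrable (llr (Measure.pi P) (Measure.pi Q)) (Measure.pi P) :=
      (integrable_congr (llr_pi P Q h)).2 (integrable_finsetSum _ fun i _ => hi' i)
    rw [← ENNReal.toReal_le_toReal (klDiv_ne_top (pi_absolutelyContinuous P Q h) hs)
      (ENNReal.sum_ne_top.2 fun i _ => hf i), ENNReal.toReal_sum fun i _ => hf i,
      toReal_klDiv_of_measure_eq (pi_absolutelyContinuous P Q h) (by simp),
      integral_congr_ae (llr_pi P Q h), integral_finsetSum _ fun i _ => hi' i]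
    refine Finset.sum_le_sum fun i _ => le_of_eq ?_
    rw [toReal_klDiv_of_measure_eq (h i) (by simp)]
    exact integral_pi_eval P (measurable_llr _ _).aestronglyMeasurable
  · push Not at hf
    obtain ⟨i, hi⟩ := hf
    have : ∑ i, klDiv (P i) (Q i) = ∞ := ENNReal.sum_eq_top.2 ⟨i, Finset.mem_univ i, hi⟩
    simp [this]

lemma klBits_pi_le : klBits (Measure.pi P) (Measure.pi Q) ≤ ∑ i, klBits (P i) (Q i) := by
  simp only [klBits, ENNReal.div_eq_inv_mul, ← Finset.mul_sum]
  gcongr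
  exact klDiv_pi_le P Q

lemma renyiMoment_pi (α : ℝ) (hα : 1 < α) (h : ∀ i, P i ≪ Q i) :
    renyiMoment α (Measure.pi P) (Measure.pi Q) = ∏ i, renyiMoment α (P i) (Q i) := by
  simp only [renyiMoment, if_pos (pi_absolutelyContinuous P Q h), if_pos (h _)]
  rw [← lintegral_pi_prod P fun i => (Measure.measurable_rnDeriv _ _).pow_const _]
  refine lintegral_congr_ae ?_
  filter_upwards [rnDeriv_pi P Q h] with y hy
  rw [hy, ENNReal.prod_rpow_of_nonneg (by linarith)]

variable {P Q}

/-- Chebyshev's inequality with variances added over independent coordinates. It serves as the law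
of large numbers for random words, likelihood ratios and distance tests alike. -/
lemma pi_sum_le_sub_le {h : ∀ i, B i → ℝ} (hh : ∀ i, MemLp (h i) 2 (P i)) {V t : ℝ} (ht : 0 < t)
    (hV : ∑ i, Var[h i; P i] ≤ V) :
    Measure.pi P {y | ∑ i, h i (y i) ≤ ∑ i, ∫ z, h i z ∂P i - t} ≤ ENNReal.ofReal (V / t ^ 2) := by
  have hL : ∀ i, MemLp (fun y : ∀ i, B i => h i (y i)) 2 (Measure.pi P) :=
    fun i => (hh i).comp_measurePreserving (measurePreserving_eval P i)
  have hE : ∫ y, (∑ i, fun y : ∀ i, B i => h i (y i)) y ∂Measure.pi P = ∑ i, ∫ z, h i z ∂P i := by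
    simp only [Finset.sum_apply]
    rw [integral_finsetSum _ fun i _ => (hL i).integrable one_le_two]
    refine Finset.sum_congr rfl fun i _ => ?_
    exact integral_pi_eval P (hh i).aestronglyMeasurable
  have := meas_ge_le_variance_div_sq (μ := Measure.pi P)
    (X := ∑ i, fun y : ∀ i, B i => h i (y i)) (memLp_finsetSum' _ fun i _ => hL i) ht
  rw [hE, variance_sum_pi hh] at this
  refine (measure_mono ?_).trans (this.trans (ENNReal.ofReal_le_ofReal (by gcongr)))
  intro y hy
  simp only [Set.mem_ofPred_eq, Finset.sum_apply] at hy ⊢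
  rw [abs_sub_comm]
  exact le_trans (by linarith) (le_abs_self _)

end Product

/-! ### Divergence under domination, and a variational lower bound -/

section Divergence

variable {B C : Type*} [MeasurableSpace B] [MeasurableSpace C]

/-- Below 1 use √x |log x| < 2, above 1 use log x ≤ x. -/
lemma mul_log_sq_le {x K : ℝ} (hx : 0 ≤ x) (hK : x ≤ K) : x * Real.log x ^ 2 ≤ 4 + K ^ 3 := by
  have hK0 : 0 ≤ K := hx.trans hK
  rcases hx.eq_or_lt with rfl | hx
  · simp; positivity
  rcases le_total x 1 with h1 | h1
  · have h := Real.abs_log_mul_self_rpow_lt x (1 / 2) hx h1 (by norm_num)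
    have h2 : (Real.log x * x ^ (1 / 2 : ℝ)) ^ 2 ≤ 2 ^ 2 := by
      rw [← sq_abs]; gcongr; linarith [h]
    have h3 : (x ^ (1 / 2 : ℝ)) ^ 2 = x := by
      rw [← Real.sqrt_eq_rpow, Real.sq_sqrt hx.le]
    rw [mul_pow, h3] at h2
    nlinarith [pow_nonneg hK0 3]
  · have h := Real.log_le_sub_one_of_pos hx
    have h0 := Real.log_nonneg h1
    have : x * Real.log x ^ 2 ≤ K * K ^ 2 := by gcongr; linarith
    nlinarith

/-- Domination bounds the density x of `P` by 1/c, and the second moment under `P` is the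
`Q`-integral of the then bounded function x log² x. -/
lemma memLp_llr_of_smul_le {P Q : Measure B} [IsFiniteMeasure P] [IsFiniteMeasure Q] {c : ℝ≥0∞}
    (hc : c ≠ 0) (hc' : c ≠ ∞) (h : c • P ≤ Q) : MemLp (llr P Q) 2 P := by
  have hac : P ≪ Q := by
    exact (Measure.absolutelyContinuous_smul hc).trans (Measure.absolutelyContinuous_of_le h)
  have hb : ∀ᵐ y ∂Q, (P.rnDeriv Q y).toReal ≤ c.toReal⁻¹ := by
    filter_upwards [Measure.rnDeriv_le_one_of_le h, Measure.rnDeriv_smul_left_of_ne_top P Q hc']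
      with y h1 h2
    rw [h2] at h1
    simp only [Pi.smul_apply, smul_eq_mul, Pi.one_apply] at h1
    rw [← ENNReal.toReal_inv]
    refine ENNReal.toReal_mono (ENNReal.inv_ne_top.2 hc) ?_
    rw [← one_div]
    exact (ENNReal.le_div_iff_mul_le (.inl hc) (.inl hc')).2 (by rwa [mul_comm])
  rw [memLp_two_iff_integrable_sq (measurable_llr _ _).aestronglyMeasurable]
  rw [← integrable_rnDeriv_smul_iff hac]
  refine Integrable.of_bound (C := 4 + c.toReal⁻¹ ^ 3) ?_ ?_
  · exact Measurable.aestronglyMeasurable (by fun_prop)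
  · filter_upwards [hb] with y hy
    have := mul_log_sq_le ENNReal.toReal_nonneg hy
    rw [smul_eq_mul, Real.norm_of_nonneg (by positivity)]
    exact this

lemma klDiv_ne_top_of_smul_le {P Q : Measure B} [IsFiniteMeasure P] [IsFiniteMeasure Q]
    {c : ℝ≥0∞} (hc : c ≠ 0) (hc' : c ≠ ∞) (h : c • P ≤ Q) : klDiv P Q ≠ ∞ := by
  refine klDiv_ne_top ?_ ((memLp_llr_of_smul_le hc hc' h).integrable one_le_two)
  exact (Measure.absolutelyContinuous_smul hc).trans (Measure.absolutelyContinuous_of_le h)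

lemma log_two_ofReal_ne_zero : ENNReal.ofReal (Real.log 2) ≠ 0 := by
  simp [Real.log_pos one_lt_two]

lemma klBits_ne_top_iff {P Q : Measure B} : klBits P Q ≠ ∞ ↔ klDiv P Q ≠ ∞ := by
  simp only [klBits, ne_eq, ENNReal.div_eq_top, log_two_ofReal_ne_zero, ENNReal.ofReal_ne_top,
    and_false, not_false_eq_true, and_true, false_or]

lemma toReal_klBits (P Q : Measure B) :
    (klBits P Q).toReal = (klDiv P Q).toReal / Real.log 2 := by
  rw [klBits, ENNReal.toReal_div, ENNReal.toReal_ofReal (Real.log_nonneg one_le_two)]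

lemma klBits_map_le (P Q : Measure B) [IsFiniteMeasure P] [IsFiniteMeasure Q] {g : B → C}
    (hg : Measurable g) : klBits (P.map g) (Q.map g) ≤ klBits P Q :=
  ENNReal.div_le_div_right (klDiv_map_le P Q hg) _

/-- The Donsker–Varadhan bound for the test function t·1_s: the divergence from the tilted measure
is nonnegative, and log (1 + a) ≤ a removes the logarithm of the normalising constant. -/
lemma le_klDiv_toReal (P Q : Measure B) [IsProbabilityMeasure P] [IsProbabilityMeasure Q]
    (hf : klDiv P Q ≠ ∞) {s : Set B} (hs : MeasurableSet s) {t : ℝ} (ht : 0 ≤ t) :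
    t * P.real s - Real.exp t * Q.real s ≤ (klDiv P Q).toReal := by
  obtain ⟨hac, hint⟩ := klDiv_ne_top_iff.1 hf
  set f : B → ℝ := s.indicator fun _ => t with hfdef
  have hfm : Measurable f := measurable_const.indicator hs
  have hfb : ∀ y, 0 ≤ f y ∧ f y ≤ t := fun y => by
    by_cases hy : y ∈ s <;> simp [f, hy, ht]
  have hfP : Integrable f P := (integrable_const t).indicator hs
  have hexp : (fun y => Real.exp (f y)) = fun y => 1 + s.indicator (fun _ => Real.exp t - 1) y := by
    funext y
    by_cases hy : y ∈ s <;> simp [f, hy]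
  have hint2 : Integrable (s.indicator fun _ : B => Real.exp t - 1) Q :=
    (integrable_const _).indicator hs
  have hfQ : Integrable (fun y => Real.exp (f y)) Q := by
    rw [hexp]; exact (integrable_const _).add hint2
  have hEQ : ∫ y, Real.exp (f y) ∂Q = 1 + Q.real s * (Real.exp t - 1) := by
    rw [hexp, integral_add (integrable_const _) hint2, integral_indicator_const _ hs]
    simp
  have : IsProbabilityMeasure (Q.tilted f) := isProbabilityMeasure_tilted hfQ
  have h1 := integral_llr_tilted_right hac hfP hfQ hint
  have hac' : P ≪ Q.tilted f := hac.trans (absolutelyContinuous_tilted hfQ)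
  rw [← toReal_klDiv_of_measure_eq hac' (by simp), ← toReal_klDiv_of_measure_eq hac (by simp),
    hEQ, integral_indicator_const _ hs, smul_eq_mul] at h1
  have h0 : 0 ≤ (klDiv P (Q.tilted f)).toReal := ENNReal.toReal_nonneg
  have hq : 0 ≤ Q.real s := measureReal_nonneg
  have he : 1 ≤ Real.exp t := Real.one_le_exp ht
  have hl := Real.log_le_sub_one_of_pos (x := 1 + Q.real s * (Real.exp t - 1)) (by nlinarith)
  nlinarith

end Divergence

/-! ### Output mixtures and the compensation identity -/

section Mixture

variable {A B : Type*} [Fintype A] [MeasurableSpace B] (V : A → ProbabilityMeasure B) {P : A → ℝ}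

lemma mixture_apply (P : A → ℝ) (s : Set B) :
    mixture V P s = ∑ a, ENNReal.ofReal (P a) * (V a : Measure B) s := by
  simp [mixture]

lemma isProbabilityMeasure_mixture (hP : P ∈ stdSimplex ℝ A) :
    IsProbabilityMeasure (mixture V P) := by
  constructor
  rw [mixture_apply]
  simp only [measure_univ, mul_one]
  rw [← ENNReal.ofReal_sum_of_nonneg fun a _ => hP.1 a, hP.2, ENNReal.ofReal_one]

lemma smul_le_mixture (P : A → ℝ) (a : A) :
    ENNReal.ofReal (P a) • (V a : Measure B) ≤ mixture V P := by
  refine Measure.le_iff.2 fun s _ => ?_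
  rw [mixture_apply]
  exact Finset.single_le_sum (f := fun a => ENNReal.ofReal (P a) * (V a : Measure B) s)
    (fun _ _ => zero_le) (Finset.mem_univ a)

lemma absolutelyContinuous_mixture {a : A} (ha : 0 < P a) :
    (V a : Measure B) ≪ mixture V P :=
  (Measure.absolutelyContinuous_smul (by simpa using ha)).trans
    (Measure.absolutelyContinuous_of_le (smul_le_mixture V P a))

lemma klDiv_mixture_ne_top (hP : P ∈ stdSimplex ℝ A) {a : A} (ha : 0 < P a) :
    klDiv (V a : Measure B) (mixture V P) ≠ ∞ := by
  have := isProbabilityMeasure_mixture V hP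
  exact klDiv_ne_top_of_smul_le (by simpa using ha) ENNReal.ofReal_ne_top (smul_le_mixture V P a)

lemma memLp_llr_mixture (hP : P ∈ stdSimplex ℝ A) {a : A} (ha : 0 < P a) :
    MemLp (llr (V a : Measure B) (mixture V P)) 2 (V a : Measure B) := by
  have := isProbabilityMeasure_mixture V hP
  exact memLp_llr_of_smul_le (by simpa using ha) ENNReal.ofReal_ne_top (smul_le_mixture V P a)

lemma mixture_absolutelyContinuous {Q : Measure B}
    (h : ∀ a, 0 < P a → (V a : Measure B) ≪ Q) : mixture V P ≪ Q := by
  refine Measure.AbsolutelyContinuous.mk fun s _ hs => ?_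
  rw [mixture_apply]
  refine Finset.sum_eq_zero fun a _ => ?_
  rcases lt_or_ge 0 (P a) with ha | ha
  · rw [h a ha hs, mul_zero]
  · rw [ENNReal.ofReal_of_nonpos ha, zero_mul]

lemma integrable_mixture {f : B → ℝ} (hP : P ∈ stdSimplex ℝ A)
    (h : ∀ a, 0 < P a → Integrable f (V a : Measure B)) : Integrable f (mixture V P) := by
  rw [mixture, integrable_finsetSum_measure]
  intro a _
  rcases (hP.1 a).lt_or_eq with ha | ha
  · exact (h a ha).smul_measure ENNReal.ofReal_ne_top
  · simp [← ha]

lemma integral_mixture {f : B → ℝ} (hP : P ∈ stdSimplex ℝ A)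
    (h : ∀ a, 0 < P a → Integrable f (V a : Measure B)) :
    ∫ y, f y ∂mixture V P = ∑ a, P a * ∫ y, f y ∂(V a : Measure B) := by
  rw [mixture, integral_finsetSum_measure]
  · exact Finset.sum_congr rfl fun a _ => by
      rw [integral_smul_measure, ENNReal.toReal_ofReal (hP.1 a), smul_eq_mul]
  · exact (integrable_finsetSum_measure.1 (integrable_mixture V hP h))

/-- The compensation identity (as an inequality). -/
lemma sum_klDiv_mixture_add_le (hP : P ∈ stdSimplex ℝ A) (Q : Measure B)
    [IsProbabilityMeasure Q] :
    ∑ a, ENNReal.ofReal (P a) * klDiv (V a : Measure B) (mixture V P) + klDiv (mixture V P) Q ≤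
      ∑ a, ENNReal.ofReal (P a) * klDiv (V a : Measure B) Q := by
  by_cases hf : ∃ a, 0 < P a ∧ klDiv (V a : Measure B) Q = ∞
  · obtain ⟨a, ha, hinf⟩ := hf
    have : ∑ a, ENNReal.ofReal (P a) * klDiv (V a : Measure B) Q = ∞ :=
      ENNReal.sum_eq_top.2 ⟨a, Finset.mem_univ a, by
        rw [hinf]; exact ENNReal.mul_top (by simpa using ha)⟩
    simp [this]
  push Not at hf
  have hM := isProbabilityMeasure_mixture V hP
  have hac : ∀ a, 0 < P a → (V a : Measure B) ≪ Q := fun a ha => (klDiv_ne_top_iff.1 (hf a ha)).1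
  have hMac := mixture_absolutelyContinuous V hac
  -- The chain rule for densities, passing through the mixture; integrated and averaged it gives the
  -- compensation identity.
  have hsum : ∀ a, 0 < P a → llr (V a : Measure B) Q =ᵐ[(V a : Measure B)]
      llr (V a : Measure B) (mixture V P) + llr (mixture V P) Q := by
    intro a ha
    have hVM := absolutelyContinuous_mixture V ha
    filter_upwards [(hac a ha).ae_le (Measure.rnDeriv_mul_rnDeriv (μ := (V a : Measure B)) (κ := Q) hVM),
      Measure.rnDeriv_pos hVM, hVM.ae_le (Measure.rnDeriv_lt_top (V a : Measure B) (mixture V P)),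
      hVM.ae_le (Measure.rnDeriv_pos hMac), (hac a ha).ae_le (Measure.rnDeriv_lt_top (mixture V P) Q)]
      with y h1 h2 h3 h4 h5
    simp only [Pi.add_apply, llr, ← h1, Pi.mul_apply, ENNReal.toReal_mul]
    exact Real.log_mul (ENNReal.toReal_pos h2.ne' h3.ne).ne' (ENNReal.toReal_pos h4.ne' h5.ne).ne'
  have hi1 : ∀ a, 0 < P a → Integrable (llr (V a : Measure B) Q) (V a : Measure B) :=
    fun a ha => (klDiv_ne_top_iff.1 (hf a ha)).2
  have hi2 : ∀ a, 0 < P a → Integrable (llr (V a : Measure B) (mixture V P)) (V a : Measure B) :=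
    fun a ha => (memLp_llr_mixture V hP ha).integrable one_le_two
  have hi3 : ∀ a, 0 < P a → Integrable (llr (mixture V P) Q) (V a : Measure B) := by
    intro a ha
    refine (integrable_congr ?_).1 ((hi1 a ha).sub (hi2 a ha))
    filter_upwards [hsum a ha] with y hy
    simp [hy]
  have ht1 : ∀ a ∈ Finset.univ, ENNReal.ofReal (P a) * klDiv (V a : Measure B) (mixture V P) ≠ ∞ := by
    intro a _
    rcases (hP.1 a).lt_or_eq with ha | ha
    · exact ENNReal.mul_ne_top ENNReal.ofReal_ne_top (klDiv_mixture_ne_top V hP ha)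
    · simp [← ha]
  have ht2 : ∀ a ∈ Finset.univ, ENNReal.ofReal (P a) * klDiv (V a : Measure B) Q ≠ ∞ := by
    intro a _
    rcases (hP.1 a).lt_or_eq with ha | ha
    · exact ENNReal.mul_ne_top ENNReal.ofReal_ne_top (hf a ha)
    · simp [← ha]
  have ht3 : klDiv (mixture V P) Q ≠ ∞ := klDiv_ne_top hMac (integrable_mixture V hP hi3)
  rw [← ENNReal.toReal_le_toReal (ENNReal.add_ne_top.2 ⟨ENNReal.sum_ne_top.2 ht1, ht3⟩)
    (ENNReal.sum_ne_top.2 ht2), ENNReal.toReal_add (ENNReal.sum_ne_top.2 ht1) ht3,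
    ENNReal.toReal_sum ht1, ENNReal.toReal_sum ht2,
    toReal_klDiv_of_measure_eq hMac (by simp), integral_mixture V hP hi3, ← Finset.sum_add_distrib]
  refine Finset.sum_le_sum fun a _ => ?_
  rcases (hP.1 a).lt_or_eq with ha | ha
  · rw [ENNReal.toReal_mul, ENNReal.toReal_mul, ENNReal.toReal_ofReal ha.le, ← mul_add,
      toReal_klDiv_of_measure_eq (absolutelyContinuous_mixture V ha) (by simp),
      toReal_klDiv_of_measure_eq (hac a ha) (by simp), integral_congr_ae (hsum a ha)]
    simp only [Pi.add_apply]
    rw [integral_add (hi2 a ha) (hi3 a ha)]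
  · simp [← ha]

lemma sum_klBits_mixture_add_le (hP : P ∈ stdSimplex ℝ A) (Q : Measure B)
    [IsProbabilityMeasure Q] :
    ∑ a, ENNReal.ofReal (P a) * klBits (V a : Measure B) (mixture V P) + klBits (mixture V P) Q ≤
      ∑ a, ENNReal.ofReal (P a) * klBits (V a : Measure B) Q := by
  have h := ENNReal.div_le_div_right (sum_klDiv_mixture_add_le V hP Q) (ENNReal.ofReal (Real.log 2))
  simpa only [klBits, ENNReal.add_div, div_eq_mul_inv, Finset.sum_mul, add_mul, mul_assoc] using h

/-- Nothing is lost by `toReal` in `mutualInfo`: letters of positive weight are dominated by a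
multiple of the mixture and have finite divergence, the others have weight zero. -/
lemma ofReal_mutualInfo (hP : P ∈ stdSimplex ℝ A) :
    ENNReal.ofReal (mutualInfo V P) =
      ∑ a, ENNReal.ofReal (P a) * klBits (V a : Measure B) (mixture V P) := by
  rw [mutualInfo, ENNReal.ofReal_sum_of_nonneg
    fun a _ => mul_nonneg (hP.1 a) ENNReal.toReal_nonneg]
  refine Finset.sum_congr rfl fun a _ => ?_
  rw [ENNReal.ofReal_mul (hP.1 a)]
  rcases (hP.1 a).lt_or_eq with ha | ha
  · rw [ENNReal.ofReal_toReal (klBits_ne_top_iff.2 (klDiv_mixture_ne_top V hP ha))]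
  · simp [← ha]

lemma mutualInfo_nonneg (hP : ∀ a, 0 ≤ P a) : 0 ≤ mutualInfo V P :=
  Finset.sum_nonneg fun a _ => mul_nonneg (hP a) ENNReal.toReal_nonneg

end Mixture

/-! ### Shannon entropy and Gibbs' inequality -/

section Entropy

variable {A : Type*} [Fintype A]

/-- The Shannon entropy in bits. -/
noncomputable def entropy (P : A → ℝ) : ℝ := -∑ a, P a * Real.logb 2 (P a)

/-- Gibbs' inequality. -/
lemma entropy_le_cross {P R : A → ℝ} (hP : P ∈ stdSimplex ℝ A) (hR : ∀ a, 0 ≤ R a)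
    (hR1 : ∑ a, R a ≤ 1) (hPR : ∀ a, 0 < P a → 0 < R a) :
    entropy P ≤ -∑ a, P a * Real.logb 2 (R a) := by
  rw [entropy, neg_le_neg_iff, ← sub_nonpos, ← Finset.sum_sub_distrib]
  have key : ∀ a, P a * Real.logb 2 (R a) - P a * Real.logb 2 (P a) ≤
      (R a - P a) / Real.log 2 := by
    intro a
    rcases (hP.1 a).lt_or_eq with ha | ha
    · have h := Real.log_le_sub_one_of_pos (div_pos (hPR a ha) ha)
      rw [Real.log_div (hPR a ha).ne' ha.ne'] at h
      have h2 : P a * (Real.log (R a) - Real.log (P a)) ≤ R a - P a := by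
        calc _ ≤ P a * (R a / P a - 1) := by gcongr
          _ = _ := by field_simp
      rw [Real.logb, Real.logb, ← mul_sub, ← sub_div, ← mul_div_assoc]
      exact div_le_div_of_nonneg_right h2 (Real.log_nonneg one_le_two)
    · rw [← ha]
      simpa using div_nonneg (hR a) (Real.log_nonneg one_le_two)
  refine (Finset.sum_le_sum fun a _ => key a).trans ?_
  rw [← Finset.sum_div, Finset.sum_sub_distrib, hP.2]
  exact div_nonpos_of_nonpos_of_nonneg (by linarith) (Real.log_nonneg one_le_two)

end Entropy

/-! ### The convex set of information-entropy pairs under time sharing -/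

section InfoSet

variable {X Y : Type*} [Fintype X] [MeasurableSpace Y]

/-- The convex hull of the pairs (mutual information, entropy) of input distributions. -/
def infoSet (W : X → ProbabilityMeasure Y) : Set (ℝ × ℝ) :=
  convexHull ℝ {z | ∃ p ∈ stdSimplex ℝ X, z = (mutualInfo W p, entropy p)}

lemma mem_infoSet (W : X → ProbabilityMeasure Y) {p : X → ℝ} (hp : p ∈ stdSimplex ℝ X) :
    (mutualInfo W p, entropy p) ∈ infoSet W :=
  subset_convexHull _ _ ⟨p, hp, rfl⟩

lemma convex_infoSet (W : X → ProbabilityMeasure Y) : Convex ℝ (infoSet W) :=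
  convex_convexHull _ _

lemma infoSet_fst_nonneg {W : X → ProbabilityMeasure Y} {z : ℝ × ℝ} (hz : z ∈ infoSet W) :
    0 ≤ z.1 := by
  have : infoSet W ⊆ {z | 0 ≤ z.1} := by
    refine convexHull_min ?_ ?_
    · rintro _ ⟨p, hp, rfl⟩
      exact mutualInfo_nonneg W hp.1
    · exact convex_halfSpace_ge (LinearMap.fst ℝ ℝ ℝ).isLinear 0
  exact this hz

lemma condX_mem_stdSimplex {U : Type*} [Fintype U] {P : U × X → ℝ} (hP : ∀ a, 0 ≤ P a) {u : U}
    (hu : marginalU P u ≠ 0) : condX P u ∈ stdSimplex ℝ X := by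
  have h0 : 0 ≤ marginalU P u := Finset.sum_nonneg fun x _ => hP (u, x)
  refine ⟨fun x => div_nonneg (hP _) h0, ?_⟩
  simp only [condX, ← Finset.sum_div]
  exact div_self hu

/-- Every point of `infoSet` is realised by a finite time-sharing variable. -/
lemma exists_of_mem_infoSet (W : X → ProbabilityMeasure Y) {z : ℝ × ℝ} (hz : z ∈ infoSet W) :
    ∃ (k : ℕ) (P : Fin k × X → ℝ), P ∈ stdSimplex ℝ (Fin k × X) ∧
      condMutualInfo W P = z.1 ∧ condEntropy P = z.2 := by
  obtain ⟨ι, _, w, f, hw0, hw1, hf, rfl⟩ := mem_convexHull_iff_exists_fintype.1 hz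
  choose p hp hpf using hf
  let e := Fintype.equivFin ι
  let P : Fin (Fintype.card ι) × X → ℝ := fun a => w (e.symm a.1) * p (e.symm a.1) a.2
  have hm : ∀ u, marginalU P u = w (e.symm u) := fun u => by
    simp only [marginalU, P, ← Finset.mul_sum, (hp (e.symm u)).2, mul_one]
  have hc : ∀ u, w (e.symm u) ≠ 0 → condX P u = p (e.symm u) := fun u hu => by
    funext x
    simp only [condX, hm]
    exact mul_div_cancel_left₀ _ hu
  refine ⟨Fintype.card ι, P, ⟨fun a => mul_nonneg (hw0 _) ((hp _).1 _), ?_⟩, ?_, ?_⟩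
  · rw [Fintype.sum_prod_type]
    change ∑ u, marginalU P u = 1
    simp only [hm]
    rw [e.symm.sum_comp w, hw1]
  · simp only [condMutualInfo, hm, Prod.fst_sum, Prod.smul_fst, smul_eq_mul, hpf]
    rw [← e.symm.sum_comp]
    refine Finset.sum_congr rfl fun u _ => ?_
    by_cases hu : w (e.symm u) = 0
    · simp [hu]
    · rw [hc u hu]
  · simp only [condEntropy, Prod.snd_sum, Prod.smul_snd, smul_eq_mul, hpf]
    rw [← e.symm.sum_comp, ← Finset.sum_neg_distrib]
    refine Finset.sum_congr rfl fun u _ => ?_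
    by_cases hu : w (e.symm u) = 0
    · simp [P, hu]
    · rw [entropy, mul_neg, Finset.mul_sum]
      congr 1
      refine Finset.sum_congr rfl fun x _ => ?_
      have := congrFun (hc u hu) x
      rw [condX] at this
      rw [this, mul_assoc]

end InfoSet

/-! ### Single-letterisation of the information radius -/

section InfoRadius

variable {A B : Type*} [Fintype A] [MeasurableSpace B]

/-- The minimal average divergence of the outputs from a common distribution. -/
noncomputable def infoRadius (V : A → ProbabilityMeasure B) (P : A → ℝ) : ℝ≥0∞ :=
  ⨅ Q : ProbabilityMeasure B, ∑ a, ENNReal.ofReal (P a) * klBits (V a : Measure B) (Q : Measure B)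

variable {X Y : Type*} [Fintype X] [MeasurableSpace Y] {C : Type*} [MeasurableSpace C]

/-- One step of the chain rule: apply the compensation identity, then data processing along `f` in
the information term and along `g` in the remaining divergence. As the `g`-marginal does not depend
on `x`, it is also that of the mixture. -/
lemma mutualInfo_add_le (W : X → ProbabilityMeasure Y) (V : Measure B) [IsProbabilityMeasure V]
    (Z : X → ProbabilityMeasure C) {f : C → Y} {g : C → B} (hf : Measurable f) (hg : Measurable g)
    (hZf : ∀ x, (Z x : Measure C).map f = W x) (hZg : ∀ x, (Z x : Measure C).map g = V)
    {p : X → ℝ} (hp : p ∈ stdSimplex ℝ X) (Q : Measure C) [IsProbabilityMeasure Q] :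
    ENNReal.ofReal (mutualInfo W p) + klBits V (Q.map g) ≤
      ∑ x, ENNReal.ofReal (p x) * klBits (Z x : Measure C) Q := by
  have hM := isProbabilityMeasure_mixture Z hp
  refine le_trans ?_ (sum_klBits_mixture_add_le Z hp Q)
  have hmf : (mixture Z p).map f = mixture W p := by
    ext s hs
    rw [Measure.map_apply hf hs, mixture_apply, mixture_apply]
    simp only [← hZf, Measure.map_apply hf hs]
  have hmg : (mixture Z p).map g = V := by
    ext s hs
    rw [Measure.map_apply hg hs, mixture_apply]
    simp only [← Measure.map_apply hg hs, hZg, ← Finset.sum_mul]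
    rw [← ENNReal.ofReal_sum_of_nonneg fun a _ => hp.1 a, hp.2, ENNReal.ofReal_one, one_mul]
  refine add_le_add ?_ ?_
  · rw [ofReal_mutualInfo W hp]
    refine Finset.sum_le_sum fun x _ => ?_
    gcongr
    rw [← hmf, ← hZf x]
    exact klBits_map_le _ _ hf
  · nth_rewrite 1 [← hmg]
    exact klBits_map_le _ _ hg

lemma pi_map_tail {n : ℕ} (ν : Fin (n + 1) → Measure Y) [∀ i, IsProbabilityMeasure (ν i)] :
    (Measure.pi ν).map (Fin.tail (α := fun _ => Y)) = Measure.pi fun i : Fin n => ν i.succ := by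
  have hm : Measurable (Fin.tail (α := fun _ : Fin (n + 1) => Y)) :=
    measurable_pi_lambda _ fun i => measurable_pi_apply i.succ
  refine (Measure.pi_eq fun s hs => ?_).symm
  rw [Measure.map_apply hm (MeasurableSet.univ_pi hs)]
  have : Fin.tail (α := fun _ : Fin (n + 1) => Y) ⁻¹' Set.univ.pi s =
      Set.univ.pi (Fin.cons Set.univ s : Fin (n + 1) → Set Y) := by
    ext y
    simp [Fin.forall_fin_succ, Fin.tail]
  rw [this, Measure.pi_pi, Fin.prod_univ_succ]
  simp

/-- The marginal of the tail of a distribution on words. -/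
def tailMarginal {n : ℕ} (P : (Fin (n + 1) → X) → ℝ) (a : Fin n → X) : ℝ :=
  ∑ x, P (Fin.cons x a)

lemma sum_fin_succ {M : Type*} [AddCommMonoid M] {n : ℕ} (F : (Fin (n + 1) → X) → M) :
    ∑ y, F y = ∑ a : Fin n → X, ∑ x, F (Fin.cons x a) := by
  rw [← (Fin.consEquiv fun _ : Fin (n + 1) => X).sum_comp, Fintype.sum_prod_type_right]
  rfl

/-- Conditioning on the later letters can only decrease the information and does not decrease the
entropy below that of the word. -/
lemma exists_infoSet_le_infoRadius [Nonempty X] (W : X → ProbabilityMeasure Y) (n : ℕ) :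
    ∀ P ∈ stdSimplex ℝ (Fin n → X), ∃ z ∈ infoSet W,
      ENNReal.ofReal (n * z.1) ≤ infoRadius (channelPow W n) P ∧ entropy P ≤ n * z.2 := by
  classical
  let p0 : X → ℝ := Pi.single (Classical.arbitrary X) 1
  have hp0 : p0 ∈ stdSimplex ℝ X := single_mem_stdSimplex ℝ _
  induction n with
  | zero =>
    intro P hP
    refine ⟨_, mem_infoSet W hp0, by simp, ?_⟩
    have h := hP.2
    rw [Fintype.sum_unique] at h
    simp [entropy, h]
  | succ n ih =>
    intro P hP
    set P' := tailMarginal P with hP'def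
    have hP'0 : ∀ a, 0 ≤ P' a := fun a => Finset.sum_nonneg fun x _ => hP.1 _
    have hP' : P' ∈ stdSimplex ℝ (Fin n → X) := ⟨hP'0, by
      rw [← hP.2, sum_fin_succ]; rfl⟩
    obtain ⟨z, hz, hz1, hz2⟩ := ih P' hP'
    -- The law of the first letter given the tail; `p0` is a filler for tails of probability zero,
    -- which carry weight zero below.
    let p : (Fin n → X) → X → ℝ := fun a => if P' a = 0 then p0 else fun x => P (Fin.cons x a) / P' a
    have hp : ∀ a, p a ∈ stdSimplex ℝ X := by
      intro a
      by_cases ha : P' a = 0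
      · simp only [p, ha, if_true]; exact hp0
      · simp only [p, ha, if_false]
        refine ⟨fun x => div_nonneg (hP.1 _) (hP'0 a), ?_⟩
        rw [← Finset.sum_div]
        exact div_self ha
    have hPp : ∀ a x, P (Fin.cons x a) = P' a * p a x := by
      intro a x
      by_cases ha : P' a = 0
      · rw [ha, zero_mul]
        exact (Finset.sum_eq_zero_iff_of_nonneg fun x _ => hP.1 _).1 ha x (Finset.mem_univ x)
      · simp only [p, ha, if_false]
        field_simp
    -- The tail acts as the time-sharing variable for the first letter.
    set z' : ℝ × ℝ := ∑ a, P' a • (mutualInfo W (p a), entropy (p a)) with hz'def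
    have hz' : z' ∈ infoSet W :=
      (convex_infoSet W).sum_mem (fun a _ => hP'0 a) hP'.2 fun a _ => mem_infoSet W (hp a)
    have hz'1 : z'.1 = ∑ a, P' a * mutualInfo W (p a) := by simp [z', Prod.fst_sum]
    have hz'2 : z'.2 = ∑ a, P' a * entropy (p a) := by simp [z', Prod.snd_sum]
    have hn : (0 : ℝ) < n + 1 := by positivity
    -- The point z describes an average over n letters and z' a single letter, hence these weights.
    refine ⟨(n / (n + 1) : ℝ) • z + (1 / (n + 1) : ℝ) • z', convex_infoSet W hz hz' (by positivity)
      (by positivity) (by field_simp), ?_, ?_⟩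
    · have e1 : ((n + 1 : ℕ) : ℝ) * ((n / (n + 1) : ℝ) • z + (1 / (n + 1) : ℝ) • z').1 =
          n * z.1 + z'.1 := by
        simp; field_simp
      rw [e1, ENNReal.ofReal_add (mul_nonneg (Nat.cast_nonneg n) (infoSet_fst_nonneg hz))
        (infoSet_fst_nonneg hz')]
      refine le_iInf fun Q => ?_
      have htm : Measurable (Fin.tail (α := fun _ : Fin (n + 1) => Y)) :=
        measurable_pi_lambda _ fun i => measurable_pi_apply i.succ
      let Q' : ProbabilityMeasure (Fin n → Y) :=
        ⟨(Q : Measure (Fin (n + 1) → Y)).map (Fin.tail (α := fun _ => Y)),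
          Measure.isProbabilityMeasure_map htm.aemeasurable⟩
      have hstep : ∀ a, ENNReal.ofReal (P' a) *
          (ENNReal.ofReal (mutualInfo W (p a)) + klBits (channelPow W n a : Measure (Fin n → Y)) Q') ≤
          ∑ x, ENNReal.ofReal (P (Fin.cons x a)) *
            klBits (channelPow W (n + 1) (Fin.cons x a) : Measure _) (Q : Measure (Fin (n + 1) → Y)) := by
        intro a
        simp only [hPp, ENNReal.ofReal_mul (hP'0 a), mul_assoc, ← Finset.mul_sum]
        gcongr
        -- For a fixed tail, `f` reads the first output and `g` the remaining ones, whose law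
        -- depends on the tail only.
        refine mutualInfo_add_le W _ (fun x => channelPow W (n + 1) (Fin.cons x a))
          (measurable_pi_apply 0) htm (fun x => ?_) (fun x => ?_) (hp a) _
        · exact (measurePreserving_eval (fun i => (W ((Fin.cons x a : Fin (n + 1) → X) i) :
            Measure Y)) 0).map_eq
        · exact pi_map_tail fun i => (W ((Fin.cons x a : Fin (n + 1) → X) i) : Measure Y)
      rw [sum_fin_succ]
      refine le_trans ?_ (Finset.sum_le_sum fun a _ => hstep a)
      simp only [mul_add, Finset.sum_add_distrib]
      rw [add_comm]
      refine add_le_add (le_of_eq ?_) (hz1.trans (iInf_le _ Q'))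
      rw [hz'1, ENNReal.ofReal_sum_of_nonneg fun a _ => mul_nonneg (hP'0 a)
        (mutualInfo_nonneg W (hp a).1)]
      exact Finset.sum_congr rfl fun a _ => ENNReal.ofReal_mul (hP'0 a)
    · have e1 : ((n + 1 : ℕ) : ℝ) * ((n / (n + 1) : ℝ) • z + (1 / (n + 1) : ℝ) • z').2 =
          n * z.2 + z'.2 := by
        simp; field_simp
      rw [e1, hz'2]
      refine le_trans (le_of_eq ?_) (add_le_add_left hz2 _)
      -- The chain rule of entropy, which here is an equality.
      rw [entropy, entropy, sum_fin_succ, ← sub_eq_iff_eq_add', sub_neg_eq_add, neg_add_eq_sub,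
        ← Finset.sum_sub_distrib]
      refine Finset.sum_congr rfl fun a _ => ?_
      rw [entropy, mul_neg, Finset.mul_sum, sub_eq_iff_eq_add, neg_add_eq_sub]
      rw [eq_sub_iff_add_eq]
      have hone : P' a * Real.logb 2 (P' a) = ∑ x, P' a * p a x * Real.logb 2 (P' a) := by
        rw [← Finset.sum_mul, ← Finset.mul_sum, (hp a).2, mul_one]
      rw [hone, ← Finset.sum_add_distrib]
      refine Finset.sum_congr rfl fun x _ => ?_
      rw [hPp]
      rcases eq_or_ne (P' a) 0 with h1 | h1
      · simp [h1]
      rcases eq_or_ne (p a x) 0 with h2 | h2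
      · simp [h2]
      rw [Real.logb_mul h1 h2]
      ring

/-- The distribution of a single letter. -/
def letterMarginal {n : ℕ} [DecidableEq X] (P : (Fin n → X) → ℝ) (i : Fin n) (x : X) : ℝ :=
  ∑ a with a i = x, P a

lemma sum_letterMarginal {n : ℕ} [DecidableEq X] (P : (Fin n → X) → ℝ) (i : Fin n) (F : X → ℝ) :
    ∑ x, letterMarginal P i x * F x = ∑ a, P a * F (a i) := by
  simp only [letterMarginal, Finset.sum_mul]
  rw [← Finset.sum_fiberwise (g := fun a : Fin n → X => a i)]
  refine Finset.sum_congr rfl fun x _ => Finset.sum_congr rfl fun a ha => ?_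
  rw [(Finset.mem_filter.1 ha).2]

lemma letterMarginal_mem {n : ℕ} [DecidableEq X] {P : (Fin n → X) → ℝ}
    (hP : P ∈ stdSimplex ℝ (Fin n → X)) (i : Fin n) : letterMarginal P i ∈ stdSimplex ℝ X :=
  ⟨fun _ => Finset.sum_nonneg fun a _ => hP.1 a, by
    have := sum_letterMarginal P i fun _ => 1
    simpa [hP.2] using this⟩

/-- Using the product of the single-letter output distributions only increases the information. -/
lemma exists_infoRadius_le_infoSet (W : X → ProbabilityMeasure Y) {n : ℕ}
    (hn : 0 < n) {P : (Fin n → X) → ℝ} (hP : P ∈ stdSimplex ℝ (Fin n → X)) :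
    ∃ z ∈ infoSet W,
      infoRadius (channelPow W n) P ≤ ENNReal.ofReal (n * z.1) ∧ entropy P ≤ n * z.2 := by
  classical
  have hn' : (0 : ℝ) < n := by exact_mod_cast hn
  set p := letterMarginal P with hpdef
  have hp : ∀ i, p i ∈ stdSimplex ℝ X := letterMarginal_mem hP
  have hpos : ∀ a, 0 < P a → ∀ i, 0 < p i (a i) := fun a ha i =>
    lt_of_lt_of_le ha (Finset.single_le_sum (f := P) (fun b _ => hP.1 b)
      (Finset.mem_filter.2 ⟨Finset.mem_univ a, rfl⟩))
  -- Here the time-sharing variable is a uniformly distributed position.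
  set z : ℝ × ℝ := ∑ i, (1 / n : ℝ) • (mutualInfo W (p i), entropy (p i)) with hzdef
  have hz : z ∈ infoSet W := by
    refine (convex_infoSet W).sum_mem (fun _ _ => by positivity) ?_ fun i _ => mem_infoSet W (hp i)
    simp; field_simp
  have hz1 : n * z.1 = ∑ i, mutualInfo W (p i) := by
    simp only [z, Prod.fst_sum, Prod.smul_fst, smul_eq_mul, ← Finset.mul_sum]
    field_simp
  have hz2 : n * z.2 = ∑ i, entropy (p i) := by
    simp only [z, Prod.snd_sum, Prod.smul_snd, smul_eq_mul, ← Finset.mul_sum]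
    field_simp
  have hM : ∀ i, IsProbabilityMeasure (mixture W (p i)) :=
    fun i => isProbabilityMeasure_mixture W (hp i)
  refine ⟨z, hz, ?_, ?_⟩
  · let Q : ProbabilityMeasure (Fin n → Y) := ⟨Measure.pi fun i => mixture W (p i), inferInstance⟩
    refine (iInf_le _ Q).trans ?_
    have hfin : ∀ a, 0 < P a → ∀ i, klBits (W (a i) : Measure Y) (mixture W (p i)) ≠ ∞ :=
      fun a ha i => klBits_ne_top_iff.2 (klDiv_mixture_ne_top W (hp i) (hpos a ha i))
    have hle : ∀ a, ENNReal.ofReal (P a) * klBits (channelPow W n a : Measure (Fin n → Y)) Q ≤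
        ENNReal.ofReal (P a * ∑ i, (klBits (W (a i) : Measure Y) (mixture W (p i))).toReal) := by
      intro a
      rcases (hP.1 a).lt_or_eq with ha | ha
      · rw [ENNReal.ofReal_mul ha.le, ← ENNReal.toReal_sum fun i _ => hfin a ha i,
          ENNReal.ofReal_toReal (ENNReal.sum_ne_top.2 fun i _ => hfin a ha i)]
        gcongr
        exact klBits_pi_le _ _
      · simp [← ha]
    refine (Finset.sum_le_sum fun a _ => hle a).trans ?_
    rw [← ENNReal.ofReal_sum_of_nonneg fun a _ => mul_nonneg (hP.1 a)
      (Finset.sum_nonneg fun _ _ => ENNReal.toReal_nonneg), hz1]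
    refine ENNReal.ofReal_le_ofReal (le_of_eq ?_)
    simp only [Finset.mul_sum]
    rw [Finset.sum_comm]
    refine Finset.sum_congr rfl fun i _ => ?_
    rw [mutualInfo, sum_letterMarginal P i fun x => (klBits (W x : Measure Y) (mixture W (p i))).toReal]
  · rw [hz2]
    -- Subadditivity of entropy is Gibbs' inequality against the product of the letter marginals.
    refine (entropy_le_cross hP (R := fun a => ∏ i, p i (a i))
      (fun a => Finset.prod_nonneg fun i _ => (hp i).1 _) ?_
      fun a ha => Finset.prod_pos fun i _ => hpos a ha i).trans (le_of_eq ?_)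
    · rw [← Fintype.prod_sum]
      simp [fun i => (hp i).2]
    · simp only [entropy]
      rw [Finset.sum_neg_distrib, neg_inj]
      have h1 : ∀ a, P a * Real.logb 2 (∏ i, p i (a i)) = ∑ i, P a * Real.logb 2 (p i (a i)) := by
        intro a
        rcases (hP.1 a).lt_or_eq with ha | ha
        · rw [← Finset.mul_sum, Real.logb_prod]
          exact fun i _ => (hpos a ha i).ne'
        · simp [← ha]
      rw [Finset.sum_congr rfl fun a _ => h1 a, Finset.sum_comm]
      refine Finset.sum_congr rfl fun i _ => ?_
      rw [← sum_letterMarginal P i fun x => Real.logb 2 (p i x)]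

/-- The single-letter characterisation used in the converse: a suitable time-sharing between the
two extreme choices of the auxiliary variable matches the information radius exactly. -/
lemma exists_infoSet_eq_infoRadius [Nonempty X] (W : X → ProbabilityMeasure Y) {n : ℕ}
    (hn : 0 < n) {P : (Fin n → X) → ℝ} (hP : P ∈ stdSimplex ℝ (Fin n → X)) :
    ∃ z ∈ infoSet W,
      n * z.1 = (infoRadius (channelPow W n) P).toReal ∧ entropy P ≤ n * z.2 := by
  obtain ⟨z, hz, h1, h2⟩ := exists_infoSet_le_infoRadius W n P hP
  obtain ⟨z', hz', h1', h2'⟩ := exists_infoRadius_le_infoSet W hn hP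
  have hn' : (0 : ℝ) < n := by exact_mod_cast hn
  set J := infoRadius (channelPow W n) P with hJ
  have hJt : J ≠ ∞ := (h1'.trans_lt ENNReal.ofReal_lt_top).ne
  have g1 : n * z.1 ≤ J.toReal := (ENNReal.ofReal_le_iff_le_toReal hJt).1 h1
  have g2 : J.toReal ≤ n * z'.1 := ENNReal.toReal_le_of_le_ofReal
    (mul_nonneg hn'.le (infoSet_fst_nonneg hz')) h1'
  rcases (g1.trans g2).eq_or_lt with h | h
  · exact ⟨z, hz, le_antisymm g1 (h ▸ g2), h2⟩
  -- The interpolation weight for which the first coordinate becomes the radius per letter; the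
  -- entropy bound holds at both ends and is linear.
  set t := (J.toReal - n * z.1) / (n * z'.1 - n * z.1) with ht
  have hd : 0 < n * z'.1 - n * z.1 := sub_pos.2 h
  have ht0 : 0 ≤ t := div_nonneg (by linarith) hd.le
  have ht1 : t ≤ 1 := (div_le_one hd).2 (by linarith)
  refine ⟨(1 - t) • z + t • z', convex_infoSet W hz hz' (by linarith) ht0 (by ring), ?_, ?_⟩
  · have : t * (n * z'.1 - n * z.1) = J.toReal - n * z.1 := div_mul_cancel₀ _ hd.ne'
    simp only [Prod.fst_add, Prod.smul_fst, smul_eq_mul]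
    linarith
  · simp only [Prod.snd_add, Prod.smul_snd, smul_eq_mul]
    have e1 := mul_le_mul_of_nonneg_left h2 (by linarith : 0 ≤ 1 - t)
    have e2 := mul_le_mul_of_nonneg_left h2' ht0
    linarith

end InfoRadius

/-! ### Consequences of non-redundancy for information and entropy -/

section NonRedundant

variable {X Y : Type*} [Fintype X] [MeasurableSpace Y] {W : X → ProbabilityMeasure Y}

lemma NonRedundant.mixture_ne (hW : NonRedundant W) {P : X → ℝ} (hP : P ∈ stdSimplex ℝ X) {x : X}
    (hx : P x = 0) : mixture W P ≠ (W x : Measure Y) := by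
  intro h
  refine absurd hW (not_lt.2 ?_)
  refine (iInf_le_of_le x (iInf_le_of_le P (iInf_le_of_le ⟨hP, hx⟩ ?_)))
  rw [h, klBits, klDiv_self, ENNReal.zero_div]

lemma NonRedundant.injective (hW : NonRedundant W) : Function.Injective W := by
  classical
  intro x x' h
  by_contra hne
  refine hW.mixture_ne (single_mem_stdSimplex ℝ x') (x := x) (by simp [hne]) ?_
  rw [h]
  ext s _
  rw [mixture_apply, Finset.sum_eq_single x' (by simp +contextual) (by simp)]
  simp

/-- Zero information makes all letters of the support share the output law `mixture W p`; distinct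
letters have distinct output laws, so the support is a single letter. -/
lemma NonRedundant.entropy_le_zero (hW : NonRedundant W) {p : X → ℝ} (hp : p ∈ stdSimplex ℝ X)
    (h : mutualInfo W p = 0) : entropy p ≤ 0 := by
  have hM := isProbabilityMeasure_mixture W hp
  have h1 : ∀ x, 0 < p x → (W x : Measure Y) = mixture W p := by
    intro x hx
    have h2 := (Finset.sum_eq_zero_iff_of_nonneg fun x _ =>
      mul_nonneg (hp.1 x) ENNReal.toReal_nonneg).1 h x (Finset.mem_univ x)
    have h3 := (mul_eq_zero.1 h2).resolve_left hx.ne'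
    rw [toReal_klBits] at h3
    have h4 : (klDiv (W x : Measure Y) (mixture W p)).toReal = 0 :=
      (div_eq_zero_iff.1 h3).resolve_right (Real.log_pos one_lt_two).ne'
    exact klDiv_eq_zero_iff.1
      (((ENNReal.toReal_eq_zero_iff _).1 h4).resolve_right (klDiv_mixture_ne_top W hp hx))
  have h2 : ∃ x, 0 < p x := by
    by_contra! hc
    have := hp.2
    rw [Finset.sum_eq_zero fun x _ => le_antisymm (hc x) (hp.1 x)] at this
    exact zero_ne_one this
  obtain ⟨x, hx⟩ := h2
  have h3 : ∀ x', x' ≠ x → p x' = 0 := by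
    intro x' hne
    by_contra h0
    have hx' : 0 < p x' := (hp.1 x').lt_of_ne' h0
    exact hne (hW.injective (Subtype.ext ((h1 x' hx').trans (h1 x hx).symm)))
  have h4 : p x = 1 := by
    rw [← hp.2, Finset.sum_eq_single x (fun b _ hb => h3 b hb) (by simp)]
  rw [entropy, Finset.sum_eq_single x (fun b _ hb => by simp [h3 b hb]) (by simp), h4]
  simp

/-- The condition "information nonnegative, and entropy nonpositive if it vanishes" survives convex
combinations: if the combined information vanishes, each term of positive weight has zero
information. -/
lemma NonRedundant.infoSet_fst_pos (hW : NonRedundant W) {z : ℝ × ℝ} (hz : z ∈ infoSet W)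
    (h2 : 0 < z.2) : 0 < z.1 := by
  have hsub : infoSet W ⊆ {z | 0 ≤ z.1 ∧ (z.1 = 0 → z.2 ≤ 0)} := by
    refine convexHull_min ?_ ?_
    · rintro _ ⟨p, hp, rfl⟩
      exact ⟨mutualInfo_nonneg W hp.1, hW.entropy_le_zero hp⟩
    · rintro z ⟨hz0, hz⟩ w ⟨hw0, hw⟩ a b ha hb hab
      refine ⟨add_nonneg (mul_nonneg ha hz0) (mul_nonneg hb hw0), fun h => ?_⟩
      simp only [Prod.fst_add, Prod.smul_fst, smul_eq_mul, Prod.snd_add, Prod.smul_snd] at h ⊢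
      have e1 : a * z.1 = 0 := by nlinarith [mul_nonneg ha hz0, mul_nonneg hb hw0]
      have e2 : b * w.1 = 0 := by nlinarith [mul_nonneg ha hz0, mul_nonneg hb hw0]
      refine add_nonpos ?_ ?_
      · rcases mul_eq_zero.1 e1 with h | h
        · simp [h]
        · exact mul_nonpos_of_nonneg_of_nonpos ha (hz h)
      · rcases mul_eq_zero.1 e2 with h | h
        · simp [h]
        · exact mul_nonpos_of_nonneg_of_nonpos hb (hw h)
  exact lt_of_le_of_ne (hsub hz).1 fun h => absurd ((hsub hz).2 h.symm) (not_le.2 h2)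

end NonRedundant

/-! ### Fano's inequality, injectivity and the two binding parameters -/

section Codes

variable {A B : Type*} [MeasurableSpace B] (V : A → ProbabilityMeasure B) (c : ListCode A B)

/-- The minimal average divergence of the outputs of the codewords. -/
noncomputable def codeRadius : ℝ≥0∞ :=
  ⨅ Q : ProbabilityMeasure B,
    ∑ m, (c.M : ℝ≥0∞)⁻¹ * klBits (V (c.φ m) : Measure B) (Q : Measure B)

lemma equivocation_eq : equivocation V c = Real.logb 2 c.M - (codeRadius V c).toReal := rfl

lemma ListCode.M_pos : 0 < c.M := (Nat.zero_lt_of_lt c.L_lt_M)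

/-- Integrate the list size, which is at most `c.L` at every output. -/
lemma sum_measure_mem_le (Q : Measure B) [IsProbabilityMeasure Q] :
    ∑ m, Q.real {y | m ∈ c.Ψ y} ≤ c.L := by
  have hint : ∀ m, Integrable ({y | m ∈ c.Ψ y}.indicator fun _ => (1 : ℝ)) Q :=
    fun m => (integrable_const _).indicator (c.measurableSet_mem m)
  have h1 : ∀ m, Q.real {y | m ∈ c.Ψ y} = ∫ y, {y | m ∈ c.Ψ y}.indicator (fun _ => (1 : ℝ)) y ∂Q :=
    fun m => by rw [integral_indicator_const _ (c.measurableSet_mem m)]; simp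
  simp only [h1]
  rw [← integral_finsetSum _ fun m _ => hint m]
  calc _ ≤ ∫ _, (c.L : ℝ) ∂Q := by
        refine integral_mono (integrable_finsetSum _ fun m _ => hint m) (integrable_const _) ?_
        intro y
        simp only [Set.indicator_apply, Set.mem_ofPred_eq]
        rw [Finset.sum_ite_mem]
        simpa using c.card_le y
    _ = c.L := by simp

/-- Fano's inequality for list decoding. -/
lemma le_codeRadius {e : ℝ} (he : ∀ m, (V (c.φ m) : Measure B).real {y | m ∉ c.Ψ y} ≤ e) :
    ENNReal.ofReal ((1 - e) * (Real.logb 2 c.M - Real.logb 2 c.L) - 1 / Real.log 2) ≤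
      codeRadius V c := by
  refine le_iInf fun Q => ?_
  have hM0 : (0 : ℝ) < c.M := by exact_mod_cast c.M_pos
  have hL0 : (0 : ℝ) < c.L := by exact_mod_cast c.one_le_L
  have hML : (c.L : ℝ) ≤ c.M := by exact_mod_cast c.L_lt_M.le
  have hl2 := Real.log_pos one_lt_two
  by_cases hf : ∃ m, klDiv (V (c.φ m) : Measure B) (Q : Measure B) = ∞
  · obtain ⟨m, hm⟩ := hf
    have : ∑ m, (c.M : ℝ≥0∞)⁻¹ * klBits (V (c.φ m) : Measure B) (Q : Measure B) = ∞ :=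
      ENNReal.sum_eq_top.2 ⟨m, Finset.mem_univ m, by
        rw [klBits, hm, ENNReal.top_div_of_ne_top ENNReal.ofReal_ne_top]
        exact ENNReal.mul_top (by simp)⟩
    rw [this]
    exact le_top
  push Not at hf
  -- With exp t = M/L, the average over messages of the subtracted term exp t · Q(m listed) is at
  -- most 1, which is the loss 1/log 2 in bits.
  set t := Real.log (c.M / c.L) with ht
  have ht0 : 0 ≤ t := Real.log_nonneg ((one_le_div hL0).2 hML)
  have hexp : Real.exp t = c.M / c.L := Real.exp_log (by positivity)
  have hnt : ∀ m ∈ Finset.univ,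
      (c.M : ℝ≥0∞)⁻¹ * klBits (V (c.φ m) : Measure B) (Q : Measure B) ≠ ∞ := fun m _ =>
    ENNReal.mul_ne_top (by simp [c.M_pos.ne']) (klBits_ne_top_iff.2 (hf m))
  rw [ENNReal.ofReal_le_iff_le_toReal (ENNReal.sum_ne_top.2 hnt), ENNReal.toReal_sum hnt]
  have key : ∀ m, t * (1 - e) - c.M / c.L * (Q : Measure B).real {y | m ∈ c.Ψ y} ≤
      (klDiv (V (c.φ m) : Measure B) (Q : Measure B)).toReal := by
    intro m
    have h := le_klDiv_toReal (V (c.φ m) : Measure B) (Q : Measure B) (hf m)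
      (c.measurableSet_mem m) ht0
    rw [hexp] at h
    refine le_trans ?_ h
    have hc := probReal_compl_eq_one_sub (μ := (V (c.φ m) : Measure B)) (c.measurableSet_mem m)
    have h1 : 1 - e ≤ (V (c.φ m) : Measure B).real {y | m ∈ c.Ψ y} := by
      have := he m
      have e2 : {y | m ∉ c.Ψ y} = {y | m ∈ c.Ψ y}ᶜ := rfl
      rw [e2, hc] at this
      linarith
    have := mul_le_mul_of_nonneg_left h1 ht0
    linarith
  have hsum := Finset.sum_le_sum fun m (_ : m ∈ Finset.univ) => key m
  rw [Finset.sum_sub_distrib, Finset.sum_const, Finset.card_univ, Fintype.card_fin, nsmul_eq_mul,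
    ← Finset.mul_sum] at hsum
  have hq := mul_le_mul_of_nonneg_left (sum_measure_mem_le c (Q : Measure B))
    (by positivity : 0 ≤ (c.M : ℝ) / c.L)
  rw [div_mul_cancel₀ _ hL0.ne'] at hq
  have hlog : Real.logb 2 c.M - Real.logb 2 c.L = t / Real.log 2 := by
    rw [ht, Real.log_div hM0.ne' hL0.ne', Real.logb, Real.logb, sub_div]
  rw [hlog]
  simp only [ENNReal.toReal_mul, ENNReal.toReal_inv, ENNReal.toReal_natCast, toReal_klBits]
  rw [← Finset.mul_sum, ← Finset.sum_div, inv_mul_eq_div, le_div_iff₀ hM0, le_div_iff₀ hl2]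
  refine le_trans (le_of_eq ?_) ((sub_le_sub_left hq _).trans hsum)
  field_simp

/-- The uniform law on the image of the encoder does both; injectivity gives every codeword exactly
the weight 1/M. -/
lemma codeRadius_eq_infoRadius [Fintype A] (hinj : Function.Injective c.φ) :
    ∃ P ∈ stdSimplex ℝ A, codeRadius V c = infoRadius V P ∧ entropy P = Real.logb 2 c.M := by
  classical
  have hM0 : (c.M : ℝ) ≠ 0 := by exact_mod_cast c.M_pos.ne'
  let P : A → ℝ := fun a => if a ∈ Finset.univ.image c.φ then (c.M : ℝ)⁻¹ else 0
  have hsum : ∀ {M : Type} [AddCommMonoid M] (F : A → M) (_ : ∀ a, P a = 0 → F a = 0),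
      ∑ a, F a = ∑ m, F (c.φ m) := by
    intro M _ F hF
    rw [← Finset.sum_image (f := F) fun a _ b _ h => hinj h]
    refine (Finset.sum_subset (Finset.subset_univ _) fun a _ ha => hF a ?_).symm
    simp only [P, ha, if_false]
  have hPφ : ∀ m, P (c.φ m) = (c.M : ℝ)⁻¹ := fun m => by
    simp only [P, Finset.mem_image_of_mem c.φ (Finset.mem_univ m), if_true]
  refine ⟨P, ⟨fun a => ?_, ?_⟩, ?_, ?_⟩
  · simp only [P]; split_ifs <;> positivity
  · rw [hsum P fun _ h => h]
    simp [hPφ, hM0]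
  · refine iInf_congr fun Q => ?_
    rw [hsum _ fun a ha => by rw [ha]; simp]
    refine Finset.sum_congr rfl fun m _ => ?_
    rw [hPφ, ENNReal.ofReal_inv_of_pos (by exact_mod_cast c.M_pos), ENNReal.ofReal_natCast]
  · rw [entropy, hsum _ fun a ha => by rw [ha]; simp]
    simp [hPφ, Real.logb_inv, hM0]

/-- If two messages shared a codeword, the second would be missed with probability at most ε_A and
listed with probability at most δ_C, and these probabilities add up to 1. -/
lemma injective_of_small (h : errA V c + deltaC V c < 1) : Function.Injective c.φ := by
  intro m m' hφ
  by_contra hne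
  have h1 : (V (c.φ m') : Measure B) {y | m' ∉ c.Ψ y} ≤ errA V c :=
    le_iSup (fun m => (V (c.φ m) : Measure B) {y | m ∉ c.Ψ y}) m'
  have h2 : (V (c.φ m) : Measure B) {y | m' ∈ c.Ψ y} ≤ deltaC V c :=
    le_iSup_of_le m (le_iSup_of_le m' (le_iSup_of_le (Ne.symm hne) le_rfl))
  rw [hφ] at h2
  have h3 : (V (c.φ m') : Measure B) {y | m' ∉ c.Ψ y} + (V (c.φ m') : Measure B) {y | m' ∈ c.Ψ y} = 1 := by
    rw [add_comm]
    exact prob_add_prob_compl (c.measurableSet_mem m')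
  exact absurd (h3 ▸ add_le_add h1 h2) (not_le.2 h)

/-- Binding for a dishonest sender together with reliability implies binding for an honest one. -/
lemma deltaC_le (h : errA V c + deltaD V c < 1) : deltaC V c ≤ deltaD V c := by
  refine iSup_le fun m => iSup_le fun m' => iSup_le fun hne => ?_
  have h1 : (V (c.φ m) : Measure B) {y | m ∉ c.Ψ y} ≤ errA V c :=
    le_iSup (fun m => (V (c.φ m) : Measure B) {y | m ∉ c.Ψ y}) m
  have h2 : min ((V (c.φ m) : Measure B) {y | m ∈ c.Ψ y}) ((V (c.φ m) : Measure B) {y | m' ∈ c.Ψ y})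
      ≤ deltaD V c :=
    le_iSup_of_le (c.φ m) (le_iSup_of_le m (le_iSup_of_le m' (le_iSup_of_le hne le_rfl)))
  rcases min_le_iff.1 h2 with h2 | h2
  · have h3 : (V (c.φ m) : Measure B) {y | m ∉ c.Ψ y} + (V (c.φ m) : Measure B) {y | m ∈ c.Ψ y} = 1 := by
      rw [add_comm]
      exact prob_add_prob_compl (c.measurableSet_mem m)
    exact absurd (h3 ▸ add_le_add h1 h2) (not_le.2 h)
  · exact h2

end Codes

/-! ### The converse -/

section Converse

variable {X Y : Type*} [MeasurableSpace Y] {W : X → ProbabilityMeasure Y}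

lemma Secure.weak {G : Binding} {c : ∀ n : ℕ, ListCode (Fin n → X) (Fin n → Y)}
    (h : Secure G W c) : Secure .weak W c := by
  cases G with
  | weak => exact h
  | strong =>
    refine ⟨h.1, ?_⟩
    have hs := h.1.add h.2
    rw [add_zero] at hs
    refine tendsto_of_tendsto_of_tendsto_of_le_of_le' tendsto_const_nhds h.2
      (Eventually.of_forall fun _ => zero_le) ?_
    filter_upwards [hs.eventually (gt_mem_nhds one_pos)] with n hn
    exact deltaC_le _ _ hn

variable [Fintype X]

/-- The pair `z` satisfies the defining inequalities of 𝒞 up to `ε`. Lowering the rates by multiples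
of `ε` makes them hold; the delicate one is that R₁ - R₂ must lie strictly between 0 and the
information. -/
lemma NonRedundant.exists_regionC_near (hW : NonRedundant W) {R₁ R₂ R₃ ε : ℝ} (hε : 0 < ε)
    (h1 : 5 * ε < R₁) (h3 : 5 * ε < R₃) (h12 : R₂ ≤ R₁) {z : ℝ × ℝ}
    (hz : z ∈ infoSet W) (hz1 : R₁ - R₂ - ε ≤ z.1) (hz1' : z.1 ≤ R₁ - R₃ + ε)
    (hz2 : R₁ - ε ≤ z.2) :
    ∃ R' ∈ regionC W, dist (R₁, R₂, R₃) R' ≤ 4 * ε := by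
  have hz0 : 0 < z.1 := hW.infoSet_fst_pos hz (by linarith)
  -- The new value of R₁ - R₂. The old one may be zero, and then a small positive number below `z.1`
  -- is taken, which exists because `z.1` is positive.
  obtain ⟨t, ht0, htz, ht1, ht2⟩ : ∃ t, 0 < t ∧ t < z.1 ∧ t ≤ R₁ - R₂ + 2 * ε ∧
      R₁ - R₂ - 2 * ε ≤ t := by
    by_cases h : 2 * ε < R₁ - R₂
    · exact ⟨R₁ - R₂ - 2 * ε, by linarith, by linarith, by linarith, le_rfl⟩
    · refine ⟨min ε (z.1 / 2), lt_min hε (by linarith), ?_, ?_, ?_⟩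
      · exact (min_le_right _ _).trans_lt (by linarith)
      · exact (min_le_left _ _).trans (by linarith)
      · have : 0 < min ε (z.1 / 2) := lt_min hε (by linarith)
        linarith
  obtain ⟨k, P, hP, hI, hH⟩ := exists_of_mem_infoSet W hz
  refine ⟨(R₁ - 2 * ε, R₁ - 2 * ε - t, R₃ - 3 * ε), ⟨k, P, hP, ?_, ?_, ?_, ?_⟩, ?_⟩
  · simp only [hI]
    constructor <;> linarith
  · simp only [hI]; linarith
  · simp only [hH]; linarith
  -- The new list rate is positive because t < `z.1` ≤ R₁ - R₃ + ε, so it exceeds R₃ - 3ε.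
  · exact ⟨by linarith, by simp only; linarith, by linarith⟩
  · simp only [Prod.dist_eq, Real.dist_eq]
    refine max_le ?_ (max_le ?_ ?_) <;> rw [abs_le] <;> constructor <;> linarith

/-- The converse part. -/
theorem achievable_subset_closure (hW : NonRedundant W) (G : Binding) :
    achievable G W ⊆ closure (regionC W) := by
  rintro ⟨R₁, R₂, R₃⟩ ⟨⟨h1, h2, h3⟩, c, hs, ⟨hM, hL⟩, hE⟩
  simp only at h1 h2 h3 hM hL hE
  have hX : Nonempty X := ⟨(c 1).φ ⟨0, (c 1).M_pos⟩ 0⟩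
  rw [Metric.mem_closure_iff]
  intro ε₀ hε₀
  obtain ⟨ε, hε, hε1, hε3, hε4⟩ : ∃ ε, 0 < ε ∧ 5 * ε < R₁ ∧ 5 * ε < R₃ ∧ 4 * ε < ε₀ := by
    refine ⟨min R₁ (min R₃ ε₀) / 6, by positivity, ?_, ?_, ?_⟩
    all_goals
      have a1 := min_le_left R₁ (min R₃ ε₀)
      have a2 := min_le_right R₁ (min R₃ ε₀)
      have a5 := min_le_left R₃ ε₀
      have a6 := min_le_right R₃ ε₀
      linarith
  have h12 : R₂ ≤ R₁ := by
    refine le_of_tendsto_of_tendsto' hL hM fun n => ?_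
    refine div_le_div_of_nonneg_right ?_ (Nat.cast_nonneg n)
    refine Real.logb_le_logb_of_le one_lt_two (by exact_mod_cast (c n).one_le_L) ?_
    exact_mod_cast (c n).L_lt_M.le
  have hw := hs.weak
  have hsmall : ∀ᶠ n in atTop, errA (channelPow W n) (c n) + deltaC (channelPow W n) (c n) < 1 := by
    have := hw.1.add hw.2
    rw [add_zero] at this
    exact this.eventually (gt_mem_nhds one_pos)
  have he : Tendsto (fun n => (errA (channelPow W n) (c n)).toReal) atTop (𝓝 0) := by
    exact (ENNReal.tendsto_toReal ENNReal.zero_ne_top).comp hs.1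
  have hfano : Tendsto (fun n : ℕ => (1 - (errA (channelPow W n) (c n)).toReal) *
      (Real.logb 2 (c n).M / n - Real.logb 2 (c n).L / n) - 1 / Real.log 2 / n) atTop
      (𝓝 ((1 - 0) * (R₁ - R₂) - 0)) :=
    ((he.const_sub 1).mul (hM.sub hL)).sub (tendsto_const_div_atTop_nhds_zero_nat _)
  rw [sub_zero, sub_zero, one_mul] at hfano
  have hE' : ∀ᶠ n : ℕ in atTop, R₃ - ε / 2 < equivocation (channelPow W n) (c n) / n := by
    have hlt : ((R₃ - ε / 2 : ℝ) : EReal) < R₃ := by exact_mod_cast (by linarith : R₃ - ε / 2 < R₃)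
    filter_upwards [eventually_lt_of_lt_liminf (hlt.trans_le hE)] with n hn
    exact_mod_cast hn
  -- The single-letter bounds are not asymptotic, so one good block length suffices.
  obtain ⟨n, hn0, hnE, hnF, hnM, hnM', hns⟩ := (((eventually_gt_atTop 0).and (hE'.and
    ((hfano.eventually (lt_mem_nhds (by linarith : R₁ - R₂ - ε < R₁ - R₂))).and
    ((hM.eventually (lt_mem_nhds (by linarith : R₁ - ε < R₁))).and
    ((hM.eventually (gt_mem_nhds (by linarith : R₁ < R₁ + ε / 2))).and hsmall))))).exists)
  have hn' : (0 : ℝ) < n := by exact_mod_cast hn0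
  have hinj := injective_of_small _ _ hns
  obtain ⟨P, hP, hPr, hPe⟩ := codeRadius_eq_infoRadius (channelPow W n) (c n) hinj
  obtain ⟨z, hz, hz1, hz2⟩ := exists_infoSet_eq_infoRadius W hn0 hP
  have hz1' : z.1 = (codeRadius (channelPow W n) (c n)).toReal / n := by
    rw [hPr, ← hz1]; field_simp
  have hz2' : Real.logb 2 (c n).M / n ≤ z.2 := by
    rw [div_le_iff₀ hn', ← hPe, mul_comm]; exact hz2
  have hrt : codeRadius (channelPow W n) (c n) ≠ ∞ := by
    rw [hPr]
    obtain ⟨z', _, h, _⟩ := exists_infoRadius_le_infoSet W hn0 hP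
    exact (h.trans_lt ENNReal.ofReal_lt_top).ne
  have herr : errA (channelPow W n) (c n) ≠ ∞ :=
    ((le_self_add.trans_lt hns).trans ENNReal.one_lt_top).ne
  have hF := le_codeRadius (channelPow W n) (c n)
    (e := (errA (channelPow W n) (c n)).toReal) fun m => ENNReal.toReal_mono herr
      (le_iSup (fun m => (channelPow W n ((c n).φ m) : Measure (Fin n → Y)) {y | m ∉ (c n).Ψ y}) m)
  rw [ENNReal.ofReal_le_iff_le_toReal hrt] at hF
  obtain ⟨R', hR', hd⟩ := hW.exists_regionC_near hε hε1 hε3 h12 hz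
    (by
      refine hnF.le.trans ?_
      rw [hz1', ← sub_div, ← mul_div_assoc, ← sub_div]
      exact div_le_div_of_nonneg_right hF hn'.le)
    (by
      rw [equivocation_eq, sub_div, ← hz1'] at hnE
      linarith)
    (hnM.le.trans hz2')
  exact ⟨R', hR', hd.trans_lt hε4⟩

end Converse

/-! ### Separating test functions from non-redundancy -/

section TestFunctions

variable {X Y : Type*} [Fintype X] [MeasurableSpace Y] {W : X → ProbabilityMeasure Y}

/-- The densities of the channel with respect to the sum of its output distributions. -/
noncomputable def channelDensity (W : X → ProbabilityMeasure Y) (x : X) (y : Y) : ℝ :=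
  min ((W x : Measure Y).rnDeriv (∑ x, (W x : Measure Y)) y).toReal 1

lemma measurable_channelDensity (x : X) : Measurable (channelDensity W x) :=
  (Measure.measurable_rnDeriv _ _).ennreal_toReal.min measurable_const

lemma abs_channelDensity_le (x : X) (y : Y) : |channelDensity W x y| ≤ 1 := by
  rw [channelDensity, abs_of_nonneg (le_min ENNReal.toReal_nonneg zero_le_one)]
  exact min_le_right _ _

/-- The truncation at 1 changes the density only on a null set, because `W x` is one of the summands
of the reference measure; it provides a bound that holds everywhere. -/
lemma integral_channelDensity_mul (x : X) (g : Y → ℝ) :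
    ∫ y, channelDensity W x y * g y ∂(∑ x, (W x : Measure Y)) = ∫ y, g y ∂(W x : Measure Y) := by
  have hle : (W x : Measure Y) ≤ ∑ x, (W x : Measure Y) := by
    refine Measure.le_iff.2 fun s _ => ?_
    rw [Measure.finsetSum_apply]
    exact Finset.single_le_sum (f := fun x => (W x : Measure Y) s) (fun _ _ => zero_le)
      (Finset.mem_univ x)
  rw [← integral_rnDeriv_smul (Measure.absolutelyContinuous_of_le hle)]
  refine integral_congr_ae ?_
  filter_upwards [Measure.rnDeriv_le_one_of_le hle] with y hy
  have : ((W x : Measure Y).rnDeriv (∑ x, (W x : Measure Y)) y).toReal ≤ 1 :=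
    ENNReal.toReal_le_of_le_ofReal zero_le_one (by simpa using hy)
  simp only [channelDensity, min_eq_left this, smul_eq_mul]

/-- The vector of the expectations of the densities. -/
noncomputable def densityVector (W : X → ProbabilityMeasure Y) (x x' : X) : ℝ :=
  ∫ y, channelDensity W x' y ∂(W x : Measure Y)

lemma integrable_channelDensity (x : X) (μ : Measure Y) [IsFiniteMeasure μ] :
    Integrable (channelDensity W x) μ :=
  Integrable.of_bound (measurable_channelDensity x).aestronglyMeasurable 1
    (Eventually.of_forall fun y => abs_channelDensity_le x y)

/-- `densityVector W` is the Gram matrix of the densities in L²(μ). The hypothesis says that the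
difference d of the densities of `W x` and of the mixture is orthogonal to all of them, hence to
itself, so d = 0 almost everywhere. -/
lemma mixture_eq_of_densityVector_eq {P : X → ℝ} (hP : P ∈ stdSimplex ℝ X) {x : X}
    (h : ∀ x'', ∑ x', P x' * densityVector W x' x'' = densityVector W x x'') :
    mixture W P = (W x : Measure Y) := by
  set μ : Measure Y := ∑ x, (W x : Measure Y)
  have hM := isProbabilityMeasure_mixture W hP
  set d : Y → ℝ := fun y => channelDensity W x y - ∑ x', P x' * channelDensity W x' y with hd
  have hint : ∀ (g : Y → ℝ), Integrable g μ → ∀ x', Integrable (fun y => channelDensity W x' y * g y) μ :=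
    fun g hg x' => hg.bdd_mul (measurable_channelDensity x').aestronglyMeasurable
      (Eventually.of_forall fun y => abs_channelDensity_le x' y)
  have hdg : ∀ g : Y → ℝ, Integrable g μ →
      ∫ y, d y * g y ∂μ = ∫ y, g y ∂(W x : Measure Y) - ∑ x', P x' * ∫ y, g y ∂(W x' : Measure Y) := by
    intro g hg
    have e : ∀ y, d y * g y = channelDensity W x y * g y -
        ∑ x', P x' * (channelDensity W x' y * g y) := by
      intro y
      simp only [d, sub_mul, Finset.sum_mul, mul_assoc]
    simp only [e]
    rw [integral_sub (hint g hg x) (integrable_finsetSum _ fun x' _ => (hint g hg x').const_mul _),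
      integral_finsetSum _ fun x' _ => (hint g hg x').const_mul _]
    simp only [integral_const_mul, integral_channelDensity_mul, μ]
  have hdm : Measurable d := (measurable_channelDensity x).sub
    (Finset.measurable_sum _ fun x' _ => (measurable_channelDensity x').const_mul _)
  have hdi : ∀ ν : Measure Y, IsFiniteMeasure ν → Integrable d ν := fun ν _ =>
    (integrable_channelDensity x ν).sub
      (integrable_finsetSum _ fun x' _ => (integrable_channelDensity x' ν).const_mul _)
  have hdW : ∀ z, ∫ y, d y ∂(W z : Measure Y) =
      densityVector W z x - ∑ x', P x' * densityVector W z x' := by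
    intro z
    simp only [d]
    rw [integral_sub (integrable_channelDensity x _)
      (integrable_finsetSum _ fun x' _ => (integrable_channelDensity x' _).const_mul _),
      integral_finsetSum _ fun x' _ => (integrable_channelDensity x' _).const_mul _]
    simp only [integral_const_mul, densityVector]
  have hsq : ∫ y, d y * d y ∂μ = 0 := by
    rw [hdg d (hdi μ inferInstance)]
    simp only [hdW, mul_sub, Finset.sum_sub_distrib, Finset.mul_sum]
    rw [h x, Finset.sum_comm (f := fun i j => P i * (P j * densityVector W i j))]
    rw [sub_sub_sub_cancel_left, sub_eq_zero]
    refine Finset.sum_congr rfl fun x' _ => ?_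
    rw [← h x', Finset.mul_sum]
    exact Finset.sum_congr rfl fun i _ => by ring
  have hdint : Integrable (fun y => d y * d y) μ := by
    refine (hdi μ inferInstance).bdd_mul (c := 1 + ∑ x', |P x'|) hdm.aestronglyMeasurable
      (Eventually.of_forall fun y => ?_)
    refine (norm_sub_le _ _).trans (add_le_add (abs_channelDensity_le x y) ?_)
    refine (norm_sum_le _ _).trans (Finset.sum_le_sum fun x' _ => ?_)
    rw [norm_mul]
    exact mul_le_of_le_one_right (norm_nonneg _) (abs_channelDensity_le x' y)
  have hd0 : d =ᵐ[μ] 0 := by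
    have := (integral_eq_zero_iff_of_nonneg (fun y => mul_self_nonneg (d y)) hdint).1 hsq
    filter_upwards [this] with y hy
    exact mul_self_eq_zero.1 hy
  ext s hs
  have h0 := hdg (s.indicator fun _ => 1) ((integrable_const _).indicator hs)
  rw [integral_eq_zero_of_ae (hd0.mono fun y hy => by simp [hy])] at h0
  simp only [integral_indicator_const _ hs, smul_eq_mul, mul_one] at h0
  rw [mixture_apply, ← ofReal_measureReal (measure_ne_top _ _), sub_eq_zero.1 h0.symm,
    ENNReal.ofReal_sum_of_nonneg fun x' _ => mul_nonneg (hP.1 x') measureReal_nonneg]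
  exact Finset.sum_congr rfl fun x' _ => by
    rw [ENNReal.ofReal_mul (hP.1 x'), ofReal_measureReal (measure_ne_top _ _)]

/-- Under non-redundancy, every letter has a bounded test function that separates its output
distribution from the other ones. -/
lemma NonRedundant.exists_test (hW : NonRedundant W) (x : X) :
    ∃ (f : Y → ℝ) (η K : ℝ), Measurable f ∧ 0 < η ∧ (∀ y, |f y| ≤ K) ∧
      ∫ y, f y ∂(W x : Measure Y) = 0 ∧ ∀ x', x' ≠ x → η ≤ ∫ y, f y ∂(W x' : Measure Y) := by
  classical
  let L : (X → ℝ) →ₗ[ℝ] (X → ℝ) := Fintype.linearCombination ℝ (densityVector W)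
  let S : Set (X → ℝ) := stdSimplex ℝ X ∩ {P | P x = 0}
  have hSc : IsCompact S := (isCompact_stdSimplex ℝ X).inter_right
    (isClosed_eq (continuous_apply x) continuous_const)
  have hSv : Convex ℝ S := (convex_stdSimplex ℝ X).inter
    (convex_hyperplane (LinearMap.proj (R := ℝ) (φ := fun _ : X => ℝ) x).isLinear 0)
  have hnot : densityVector W x ∉ L '' S := by
    rintro ⟨P, ⟨hP, hPx⟩, h⟩
    refine hW.mixture_ne hP hPx (mixture_eq_of_densityVector_eq hP fun x'' => ?_)
    rw [← h]
    simp [L, Fintype.linearCombination_apply, Finset.sum_apply]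
  -- The Gram rows turn the separation problem into a finite-dimensional one: a point outside a
  -- compact convex set.
  obtain ⟨F, u, hFu, hF⟩ := geometric_hahn_banach_point_closed (hSv.linear_image L)
    (hSc.image L.continuous_of_finiteDimensional).isClosed hnot
  have hFsum : ∀ v : X → ℝ, F v = ∑ i, F (Pi.single i 1) * v i := by
    intro v
    have := LinearMap.pi_apply_eq_sum_univ (F : (X → ℝ) →ₗ[ℝ] ℝ) v
    refine this.trans (Finset.sum_congr rfl fun i _ => ?_)
    have e : (fun j => if i = j then (1 : ℝ) else 0) = Pi.single i 1 := by
      funext j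
      simp [Pi.single_apply, eq_comm]
    rw [smul_eq_mul, mul_comm, e]
    rfl
  set a := F (densityVector W x) with ha
  -- The functional turned into a function on the outputs: its mean under `W z` is `F` of the row of
  -- z, minus the value at x.
  let f : Y → ℝ := fun y => ∑ i, F (Pi.single i 1) * channelDensity W i y - a
  have hfi : ∀ z, ∫ y, f y ∂(W z : Measure Y) = F (densityVector W z) - a := by
    intro z
    simp only [f]
    rw [integral_sub (integrable_finsetSum _ fun i _ => (integrable_channelDensity i _).const_mul _)
      (integrable_const _), integral_finsetSum _ fun i _ => (integrable_channelDensity i _).const_mul _]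
    simp [integral_const_mul, hFsum (densityVector W z), densityVector]
  refine ⟨f, u - a, ∑ i, |F (Pi.single i 1)| + |a|, ?_, sub_pos.2 hFu, fun y => ?_, ?_, ?_⟩
  · exact (Finset.measurable_sum _ fun i _ => (measurable_channelDensity i).const_mul _).sub_const _
  · refine (abs_sub _ _).trans (add_le_add ?_ le_rfl)
    refine (Finset.abs_sum_le_sum_abs _ _).trans (Finset.sum_le_sum fun i _ => ?_)
    rw [abs_mul]
    exact mul_le_of_le_one_right (abs_nonneg _) (abs_channelDensity_le i y)
  · rw [hfi, sub_self]
  · intro x' hx'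
    rw [hfi]
    refine sub_le_sub_right (hF _ ⟨Pi.single x' 1, ⟨single_mem_stdSimplex ℝ x', ?_⟩, ?_⟩).le _
    · simp [hx'.symm]
    · simp [L]

lemma NonRedundant.exists_tests (hW : NonRedundant W) :
    ∃ (f : X → Y → ℝ) (η K : ℝ), (∀ x, Measurable (f x)) ∧ 0 < η ∧ (∀ x y, |f x y| ≤ K) ∧
      (∀ x, ∫ y, f x y ∂(W x : Measure Y) = 0) ∧
      ∀ x x', x' ≠ x → η ≤ ∫ y, f x y ∂(W x' : Measure Y) := by
  choose f η K hf hη hK h0 h1 using hW.exists_test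
  obtain ⟨η', hη', hle⟩ : ∃ η' > 0, ∀ x, η' ≤ η x := by
    rcases isEmpty_or_nonempty X with h | h
    · exact ⟨1, one_pos, fun x => h.elim x⟩
    · obtain ⟨x0, hx0⟩ := Finite.exists_min η
      exact ⟨η x0, hη x0, hx0⟩
  refine ⟨f, η', ∑ x, |K x|, hf, hη', fun x y => ?_, h0, fun x x' h => (hle x).trans (h1 x x' h)⟩
  exact (hK x y).trans ((le_abs_self _).trans
    (Finset.single_le_sum (f := fun x => |K x|) (fun _ _ => abs_nonneg _) (Finset.mem_univ x)))

end TestFunctions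

/-! ### Codeword selection by averaging, expurgation and threshold list decoding -/

section Selection

variable {A : Type*} {p : A → ℝ≥0∞} {S : Finset A} {c : A → A → ℝ≥0∞} {C : ℝ≥0∞}

/-- Codewords can be chosen one after the other with small total pair cost. -/
lemma exists_words_total_cost (hp : ∀ x ∈ S, p x ≠ 0 ∧ p x ≠ ∞) (hS : S.Nonempty)
    (hS2 : 1 ≤ 2 * ∑ x ∈ S, p x) (hsymm : ∀ x x', c x x' = c x' x)
    (hC : ∀ x ∈ S, ∑ x' ∈ S, p x' * c x x' ≤ C) (N : ℕ) :
    ∃ φ : Fin N → A, (∀ m, φ m ∈ S) ∧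
      ∑ m, ∑ m', (if m' = m then 0 else c (φ m) (φ m')) ≤ N * N * (2 * C) := by
  induction N with
  | zero => exact ⟨fun m => m.elim0, fun m => m.elim0, by simp⟩
  | succ N ih =>
    obtain ⟨φ, hφ, hT⟩ := ih
    -- The average cost of a new word against the chosen ones is at most N·C by symmetry; the factor
    -- 2 pays for `S` having mass at least 1/2 only.
    obtain ⟨x, hx, hxc⟩ : ∃ x ∈ S, ∑ m, c x (φ m) ≤ N * (2 * C) := by
      have h : ∑ x ∈ S, p x * ∑ m, c x (φ m) ≤ ∑ x ∈ S, p x * (N * (2 * C)) := by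
        simp only [Finset.mul_sum]
        rw [Finset.sum_comm, ← Finset.sum_mul]
        calc ∑ m, ∑ x ∈ S, p x * c x (φ m) ≤ ∑ m : Fin N, C := by
              refine Finset.sum_le_sum fun m _ => ?_
              simp only [hsymm _ (φ m)]
              exact hC _ (hφ m)
          _ = 1 * (N * C) := by simp
          _ ≤ (2 * ∑ x ∈ S, p x) * (N * C) := by gcongr
          _ = _ := by ring
      by_contra! hlt
      refine absurd h (not_le.2 (ENNReal.sum_lt_sum_of_nonempty hS fun x hx => ?_))
      refine lt_of_not_ge fun hle => absurd (hlt x hx) (not_lt.2 ?_)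
      exact (ENNReal.mul_le_mul_iff_right (hp x hx).1 (hp x hx).2).1 hle
    refine ⟨Fin.cons x φ, Fin.cases hx hφ, ?_⟩
    simp only [Fin.sum_univ_succ, Fin.cons_zero, Fin.cons_succ, Fin.succ_ne_zero, if_true,
      if_false, Fin.succ_inj, zero_add, (Fin.succ_ne_zero _).symm, Finset.sum_add_distrib]
    simp only [hsymm _ x]
    calc _ ≤ N * (2 * C) + (N * (2 * C) + N * N * (2 * C)) := by gcongr
      _ ≤ N * (2 * C) + (N * (2 * C) + N * N * (2 * C)) + 2 * C := le_self_add
      _ = _ := by push_cast; ring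

/-- Expurgation: half of the codewords have a cost of the order of the average. -/
lemma exists_words_cost (hp : ∀ x ∈ S, p x ≠ 0 ∧ p x ≠ ∞) (hS : S.Nonempty)
    (hS2 : 1 ≤ 2 * ∑ x ∈ S, p x) (hsymm : ∀ x x', c x x' = c x' x)
    (hC : ∀ x ∈ S, ∑ x' ∈ S, p x' * c x x' ≤ C) {M : ℕ} {t : ℝ≥0∞} (ht : t ≠ 0) (ht' : t ≠ ∞)
    (hMC : 8 * M * C ≤ t) :
    ∃ φ : Fin M → A, (∀ m, φ m ∈ S) ∧
      ∀ m, ∑ m', (if m' = m then 0 else c (φ m) (φ m')) < t := by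
  classical
  -- For 2M words the total cost is at most (2M)²·2C = M·8MC ≤ M·t, so at most M words have cost t
  -- or more.
  obtain ⟨φ, hφ, hT⟩ := exists_words_total_cost hp hS hS2 hsymm hC (2 * M)
  set b : Fin (2 * M) → ℝ≥0∞ := fun m => ∑ m', (if m' = m then 0 else c (φ m) (φ m')) with hb
  have hbad : (Finset.univ.filter fun m => ¬ b m < t).card ≤ M := by
    have h1 : ((Finset.univ.filter fun m => ¬ b m < t).card : ℝ≥0∞) * t ≤ M * t := by
      calc _ = ∑ m with ¬ b m < t, t := by simp
        _ ≤ ∑ m with ¬ b m < t, b m :=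
          Finset.sum_le_sum fun m hm => not_lt.1 (Finset.mem_filter.1 hm).2
        _ ≤ ∑ m, b m := Finset.sum_le_univ_sum_of_nonneg fun _ => zero_le
        _ ≤ _ := hT
        _ = M * (8 * M * C) := by push_cast; ring
        _ ≤ M * t := by gcongr
    exact_mod_cast (ENNReal.mul_le_mul_iff_left ht ht').1 h1
  have hgood : M ≤ (Finset.univ.filter fun m => b m < t).card := by
    have := Finset.card_filter_add_card_filter_not (s := (Finset.univ : Finset (Fin (2 * M))))
      (fun m => b m < t)
    rw [Finset.card_univ, Fintype.card_fin] at this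
    omega
  obtain ⟨G, hG, hGc⟩ := Finset.exists_subset_card_eq hgood
  let e := G.orderEmbOfFin hGc
  refine ⟨φ ∘ e, fun m => hφ _, fun m => ?_⟩
  refine lt_of_le_of_lt ?_ (Finset.mem_filter.1 (hG (G.orderEmbOfFin_mem hGc m))).2
  calc _ = ∑ m', (if e m' = e m then 0 else c (φ (e m)) (φ (e m'))) := by
        simp only [Function.comp, e.injective.eq_iff]
    _ = ∑ m' ∈ Finset.univ.image e, (if m' = e m then 0 else c (φ (e m)) (φ m')) := by
        rw [Finset.sum_image fun _ _ _ _ h => e.injective h]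
    _ ≤ b (e m) := Finset.sum_le_univ_sum_of_nonneg fun _ => zero_le

variable {B : Type*} [MeasurableSpace B] (V : A → ProbabilityMeasure B) {T : A → Set B}

open Classical in
/-- The list decoder that lists all messages whose test is passed, unless there are too many. -/
noncomputable def thresholdCode (hT : ∀ x, MeasurableSet (T x)) {M L : ℕ} (hL : 1 ≤ L) (hLM : L < M) (φ : Fin M → A) :
    ListCode A B where
  M := M
  L := L
  one_le_L := hL
  L_lt_M := hLM
  φ := φ
  Ψ y := if (Finset.univ.filter fun m => y ∈ T (φ m)).card ≤ L then
    Finset.univ.filter fun m => y ∈ T (φ m) else ∅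
  card_le y := by
    split_ifs with h
    · exact h
    · simp
  measurableSet_mem m := by
    have h1 : {y | m ∈ if (Finset.univ.filter fun m => y ∈ T (φ m)).card ≤ L then
        Finset.univ.filter fun m => y ∈ T (φ m) else ∅} =
        T (φ m) ∩ {y | ∑ m', (T (φ m')).indicator (fun _ => (1 : ℝ)) y ≤ L} := by
      ext y
      have : ∑ m', (T (φ m')).indicator (fun _ => (1 : ℝ)) y =
          ((Finset.univ.filter fun m => y ∈ T (φ m)).card : ℝ) := by
        simp [Set.indicator_apply]
      simp only [Set.mem_ofPred_eq, Set.mem_inter_iff, this, Nat.cast_le]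
      split_ifs with h <;> simp [h]
    rw [h1]
    exact (hT _).inter (measurableSet_le (Finset.measurable_sum _ fun m' _ =>
      measurable_const.indicator (hT _)) measurable_const)

open Classical in
lemma mem_thresholdCode {hT : ∀ x, MeasurableSet (T x)} {M L : ℕ} {hL : 1 ≤ L} {hLM : L < M}
    {φ : Fin M → A} (m : Fin M) (y : B) :
    m ∈ (thresholdCode hT hL hLM φ).Ψ y ↔
      (Finset.univ.filter fun m => y ∈ T (φ m)).card ≤ L ∧ y ∈ T (φ m) := by
  change m ∈ (if (Finset.univ.filter fun m => y ∈ T (φ m)).card ≤ L then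
    Finset.univ.filter fun m => y ∈ T (φ m) else ∅) ↔ _
  split_ifs with h <;> simp [h]

/-- A pair cost below 1 excludes close pairs, and the false acceptance probabilities divided by L
are what Markov's inequality needs to bound the probability of an overfull list. Both acceptance
directions enter so that the cost is symmetric. -/
lemma exists_code_of_tests (hT : ∀ x, MeasurableSet (T x)) (hp : ∀ x ∈ S, p x ≠ 0 ∧ p x ≠ ∞) (hS : S.Nonempty)
    (hS2 : 1 ≤ 2 * ∑ x ∈ S, p x) {close : A → A → Prop} (hclose : ∀ x x', close x x' → close x' x)
    [DecidableRel close] {C₁ C₂ C₃ : ℝ≥0∞}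
    (hC₁ : ∀ x ∈ S, ∑ x' ∈ S, p x' * (if close x x' then 1 else 0) ≤ C₁)
    (hC₂ : ∀ x ∈ S, ∑ x' ∈ S, p x' * (V x : Measure B) (T x') ≤ C₂)
    (hC₃ : ∀ x ∈ S, ∑ x' ∈ S, p x' * (V x' : Measure B) (T x) ≤ C₃)
    {M L : ℕ} (hL : 1 ≤ L) (hLM : L < M) {t : ℝ≥0∞} (ht : t ≠ 0) (ht1 : t ≤ 1)
    (hMC : 8 * M * (C₁ + (C₂ + C₃) / L) ≤ t) :
    ∃ c : ListCode A B, c.M = M ∧ c.L = L ∧ (∀ m, c.φ m ∈ S) ∧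
      (∀ m m', m' ≠ m → ¬ close (c.φ m) (c.φ m')) ∧ (∀ m y, m ∈ c.Ψ y → y ∈ T (c.φ m)) ∧
      ∀ m, (V (c.φ m) : Measure B) {y | m ∉ c.Ψ y} ≤
        (V (c.φ m) : Measure B) (T (c.φ m))ᶜ + t := by
  classical
  let cost : A → A → ℝ≥0∞ := fun x x' => (if close x x' then 1 else 0) +
    ((V x : Measure B) (T x') + (V x' : Measure B) (T x)) / L
  have hL0 : (L : ℝ≥0∞) ≠ 0 := by exact_mod_cast (Nat.one_le_iff_ne_zero.1 hL)
  obtain ⟨φ, hφ, hcost⟩ := exists_words_cost (c := cost) (C := C₁ + (C₂ + C₃) / L) (M := M) hp hS hS2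
    (fun x x' => by
      simp only [cost, add_comm ((V x : Measure B) (T x'))]
      congr 1
      exact if_congr ⟨hclose _ _, hclose _ _⟩ rfl rfl)
    (fun x hx => by
      have e : ∀ x', p x' * cost x x' = p x' * (if close x x' then 1 else 0) +
          (p x' * (V x : Measure B) (T x') + p x' * (V x' : Measure B) (T x)) / L := by
        intro x'
        simp only [cost, mul_add, ENNReal.add_div, mul_div_assoc]
      simp only [e, Finset.sum_add_distrib, ENNReal.div_eq_inv_mul, ← Finset.mul_sum]
      gcongr
      exacts [hC₁ x hx, hC₂ x hx, hC₃ x hx])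
    ht (ht1.trans_lt ENNReal.one_lt_top).ne hMC
  have hdist : ∀ m m' : Fin M, m' ≠ m → ¬ close (φ m) (φ m') := by
    intro m m' hne hc
    refine absurd (hcost m) (not_lt.2 (ht1.trans ?_))
    refine le_trans ?_ (Finset.single_le_sum (f := fun m' => if m' = m then 0 else
      cost (φ m) (φ m')) (fun _ _ => zero_le) (Finset.mem_univ m'))
    simp only [if_neg hne, cost]
    rw [if_pos hc]
    exact le_self_add
  refine ⟨thresholdCode hT hL hLM φ, rfl, rfl, hφ, hdist,
    fun m y hm => ((mem_thresholdCode m y).1 hm).2, fun (m : Fin M) => ?_⟩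
  change (V (φ m) : Measure B) {y | ¬ m ∈ (thresholdCode hT hL hLM φ).Ψ y} ≤
    (V (φ m) : Measure B) (T (φ m))ᶜ + t
  simp only [mem_thresholdCode]
  set g : B → ℝ≥0∞ := fun y => ∑ m', if m' = m then 0 else (T (φ m')).indicator (fun _ => 1) y
    with hg
  have hgm : ∀ m', Measurable fun y => if m' = m then (0 : ℝ≥0∞) else
      (T (φ m')).indicator (fun _ => 1) y := by
    intro m'
    split_ifs
    · exact measurable_const
    · exact measurable_const.indicator (hT _)
  -- The true message is missed only if its own test fails or at least L other messages pass, which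
  -- overfills the list.
  have hsub : {y | ¬ ((Finset.univ.filter fun m => y ∈ T (φ m)).card ≤ L ∧ y ∈ T (φ m))} ⊆
      (T (φ m))ᶜ ∪ {y | (L : ℝ≥0∞) ≤ g y} := by
    intro y hy
    by_cases hyT : y ∈ T (φ m)
    · right
      have h : ¬ (Finset.univ.filter fun m => y ∈ T (φ m)).card ≤ L := fun h => hy ⟨h, hyT⟩
      have h2 : g y = ((Finset.univ.filter fun m' => y ∈ T (φ m')).erase m).card := by
        rw [Finset.card_eq_sum_ones, Nat.cast_sum, ← Finset.filter_ne', Finset.filter_filter,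
          Finset.sum_filter]
        simp only [g]
        refine Finset.sum_congr rfl fun m' _ => ?_
        by_cases h1 : m' = m <;> by_cases h3 : y ∈ T (φ m') <;> simp [h1, h3]
      change (L : ℝ≥0∞) ≤ g y
      rw [h2, Finset.card_erase_of_mem (Finset.mem_filter.2 ⟨Finset.mem_univ m, hyT⟩)]
      have : L ≤ (Finset.univ.filter fun m' => y ∈ T (φ m')).card - 1 := by omega
      exact_mod_cast this
    · left; exact hyT
  refine (measure_mono hsub).trans ((measure_union_le _ _).trans (add_le_add le_rfl ?_))
  have hmark := mul_meas_ge_le_lintegral (μ := (V (φ m) : Measure B))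
    (Finset.measurable_sum Finset.univ fun m' _ => hgm m') (L : ℝ≥0∞)
  rw [lintegral_finsetSum _ fun m' _ => hgm m'] at hmark
  have hint : ∀ m', ∫⁻ y, (if m' = m then (0 : ℝ≥0∞) else (T (φ m')).indicator (fun _ => 1) y)
      ∂(V (φ m) : Measure B) ≤ L * (if m' = m then 0 else cost (φ m) (φ m')) := by
    intro m'
    split_ifs
    · simp
    · rw [lintegral_indicator_const (hT _), one_mul]
      simp only [cost, mul_add, ENNReal.add_div]
      rw [ENNReal.mul_div_cancel hL0 (ENNReal.natCast_ne_top L)]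
      exact le_self_add.trans le_add_self
  have := hmark.trans (Finset.sum_le_sum fun m' _ => hint m')
  rw [← Finset.mul_sum] at this
  exact ((ENNReal.mul_le_mul_iff_right hL0 (ENNReal.natCast_ne_top L)).1 this).trans (hcost m).le

end Selection

/-! ### Random words, prescribed frequencies and Hamming balls -/

section Words

variable {X : Type*} [Fintype X]

/-- The noiseless channel. -/
noncomputable def diracChannel (X : Type*) [MeasurableSpace X] (x : X) : ProbabilityMeasure X :=
  ⟨Measure.dirac x, inferInstance⟩

lemma mixture_dirac_singleton [MeasurableSpace X] [DiscreteMeasurableSpace X] (p : X → ℝ) (x : X) :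
    mixture (diracChannel X) p {x} = ENNReal.ofReal (p x) := by
  classical
  rw [mixture_apply, Finset.sum_eq_single x]
  · simp [diracChannel]
  · intro b _ hb
    simp [diracChannel, hb]
  · simp

lemma integral_mixture_dirac [MeasurableSpace X] [DiscreteMeasurableSpace X] {p : X → ℝ}
    (hp : p ∈ stdSimplex ℝ X) (h : X → ℝ) :
    ∫ x, h x ∂mixture (diracChannel X) p = ∑ x, p x * h x := by
  rw [integral_mixture _ hp fun a _ => Integrable.of_finite]
  exact Finset.sum_congr rfl fun a _ => by simp [diracChannel]

/-- A sequence in a finite set with prescribed frequencies. -/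
lemma exists_sequence_frequencies {U : Type*} [Fintype U] {w : U → ℝ} (hw : w ∈ stdSimplex ℝ U) :
    ∃ u : ℕ → U, ∀ h : U → ℝ,
      Tendsto (fun n : ℕ => (∑ i : Fin n, h (u i)) / n) atTop (𝓝 (∑ v, w v * h v)) := by
  classical
  let _ : MeasurableSpace U := ⊤
  have hν := isProbabilityMeasure_mixture (diracChannel U) hw
  -- By the strong law of large numbers almost every realisation of an i.i.d. sequence with law `w`
  -- has the right frequencies.
  obtain ⟨Ω, _, P, Z, hZm, hZ, hind, _⟩ := exists_iid ℕ (mixture (diracChannel U) w)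
  have hmeas : ∀ h : U → ℝ, Measurable h := fun h => measurable_from_top
  have key : ∀ v : U, ∀ᵐ ω ∂P, Tendsto (fun n : ℕ =>
      (∑ i ∈ Finset.range n, (Pi.single v (1 : ℝ) : U → ℝ) (Z i ω)) / n) atTop (𝓝 (w v)) := by
    intro v
    have h1 := strong_law_ae_real (μ := P) (fun i ω => (Pi.single v (1 : ℝ) : U → ℝ) (Z i ω)) ?_ ?_ ?_
    · have h2 : ∫ ω, (Pi.single v (1 : ℝ) : U → ℝ) (Z 0 ω) ∂P = w v := by
        refine ((hZ 0).integral_comp (f := (Pi.single v (1 : ℝ) : U → ℝ))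
          (hmeas _).aestronglyMeasurable).trans ?_
        rw [integral_mixture_dirac hw, Finset.sum_eq_single v (by simp +contextual) (by simp)]
        simp
      rw [h2] at h1
      exact h1
    · refine Integrable.of_bound ((hmeas _).comp (hZm 0)).aestronglyMeasurable 1
        (Eventually.of_forall fun ω => ?_)
      by_cases h : Z 0 ω = v <;> simp [h]
    · intro i j hij
      exact (hind.indepFun hij).comp (hmeas _) (hmeas _)
    · intro i
      exact (((hZ i).identDistrib (hZ 0)).comp (hmeas _))
  obtain ⟨ω, hω⟩ := (ae_all_iff.2 key).exists
  refine ⟨fun i => Z i ω, fun h => ?_⟩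
  have := tendsto_finsetSum Finset.univ fun v (_ : v ∈ Finset.univ) => (hω v).mul_const (h v)
  refine this.congr fun n => ?_
  rw [Fin.sum_univ_eq_sum_range (fun i => h (Z i ω))]
  simp only [div_mul_eq_mul_div, ← Finset.sum_div, Finset.sum_mul]
  rw [Finset.sum_comm]
  congr 1
  refine Finset.sum_congr rfl fun i _ => ?_
  rw [Finset.sum_eq_single (Z i ω) (by intro b _ hb; simp [hb.symm]) (by simp)]
  simp

variable {n : ℕ} {r : Fin n → X → ℝ}

/-- The probability of a word with independent letters. -/
noncomputable def wordWeight (r : Fin n → X → ℝ) (x : Fin n → X) : ℝ≥0∞ :=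
  ∏ i, ENNReal.ofReal (r i (x i))

lemma sum_wordWeight (hr : ∀ i, r i ∈ stdSimplex ℝ X) : ∑ x, wordWeight r x = 1 := by
  simp only [wordWeight]
  rw [← Fintype.prod_sum (f := fun i a => ENNReal.ofReal (r i a))]
  refine Finset.prod_eq_one fun i _ => ?_
  rw [← ENNReal.ofReal_sum_of_nonneg fun a _ => (hr i).1 a, (hr i).2, ENNReal.ofReal_one]

/-- The weak law of large numbers for words. -/
lemma sum_wordWeight_le (hr : ∀ i, r i ∈ stdSimplex ℝ X) (h : Fin n → X → ℝ) {b t : ℝ}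
    (hb : ∀ i a, |h i a| ≤ b) (ht : 0 < t) (E : Finset (Fin n → X))
    (hE : ∀ x ∈ E, ∑ i, h i (x i) ≤ ∑ i, ∑ a, r i a * h i a - t) :
    ∑ x ∈ E, wordWeight r x ≤ ENNReal.ofReal (n * b ^ 2 / t ^ 2) := by
  let _ : MeasurableSpace X := ⊤
  have hν : ∀ i, IsProbabilityMeasure (mixture (diracChannel X) (r i)) :=
    fun i => isProbabilityMeasure_mixture _ (hr i)
  have hm : ∀ i, MemLp (h i) 2 (mixture (diracChannel X) (r i)) := fun i =>
    MemLp.of_bound (Measurable.of_discrete).aestronglyMeasurable b (Eventually.of_forall (hb i))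
  have hv : ∑ i, Var[h i; mixture (diracChannel X) (r i)] ≤ n * b ^ 2 := by
    have : ∀ i, Var[h i; mixture (diracChannel X) (r i)] ≤ b ^ 2 := by
      intro i
      have := variance_le_sq_of_bounded (μ := mixture (diracChannel X) (r i)) (X := h i)
        (a := -b) (b := b) (Eventually.of_forall fun a => abs_le.1 (hb i a))
        (Measurable.of_discrete).aemeasurable
      refine this.trans (le_of_eq (by ring))
    refine (Finset.sum_le_sum fun i _ => this i).trans (by simp)
  have key := pi_sum_le_sub_le hm ht hv
  simp only [integral_mixture_dirac (hr _)] at key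
  refine le_trans ?_ key
  have hw : ∀ x, wordWeight r x = Measure.pi (fun i => mixture (diracChannel X) (r i)) {x} := by
    intro x
    rw [← Set.univ_pi_singleton, Measure.pi_pi]
    simp only [mixture_dirac_singleton, wordWeight]
  simp only [hw]
  rw [sum_measure_singleton]
  exact measure_mono fun x hx => hE x hx

/-- The volume of a Hamming ball. -/
lemma card_hammingBall_le [DecidableEq X] (x : Fin n → X) {s d : ℝ} (hs : 0 < s) (hs1 : s ≤ 1) :
    ((Finset.univ.filter fun x' => (hammingDist x x' : ℝ) ≤ d).card : ℝ) ≤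
      s ^ (-d) * (1 + Fintype.card X * s) ^ n := by
  -- A Chernoff bound: the indicator of the ball is dominated by a weight that factors over the
  -- letters.
  have h1 : ∀ x', (hammingDist x x' : ℝ) ≤ d → 1 ≤ s ^ (-d) * s ^ hammingDist x x' := by
    intro x' h
    rw [← Real.rpow_natCast, ← Real.rpow_add hs]
    exact Real.one_le_rpow_of_pos_of_le_one_of_nonpos hs hs1 (by linarith)
  have h2 : ∑ x' : Fin n → X, s ^ hammingDist x x' ≤ (1 + Fintype.card X * s) ^ n := by
    have e : ∀ x', s ^ hammingDist x x' = ∏ i, if x i ≠ x' i then s else 1 := by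
      intro x'
      rw [Finset.prod_ite, Finset.prod_const, Finset.prod_const_one, mul_one]
      rfl
    simp only [e]
    rw [← Fintype.prod_sum (f := fun i a => if x i ≠ a then s else 1)]
    calc _ ≤ ∏ _i : Fin n, (1 + Fintype.card X * s) := by
          refine Finset.prod_le_prod (fun i _ => Finset.sum_nonneg fun a _ => by
            split_ifs <;> linarith) fun i _ => ?_
          calc ∑ a, (if x i ≠ a then s else 1) ≤ ∑ a, ((if x i = a then 1 else 0) + s) := by
                refine Finset.sum_le_sum fun a _ => ?_
                by_cases h : x i = a <;> simp [h, hs.le]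
            _ = 1 + Fintype.card X * s := by simp [Finset.sum_add_distrib]
      _ = _ := by simp
  calc ((Finset.univ.filter fun x' => (hammingDist x x' : ℝ) ≤ d).card : ℝ)
      = ∑ x' with (hammingDist x x' : ℝ) ≤ d, (1 : ℝ) := by simp
    _ ≤ ∑ x' with (hammingDist x x' : ℝ) ≤ d, s ^ (-d) * s ^ hammingDist x x' :=
        Finset.sum_le_sum fun x' hx' => h1 x' (Finset.mem_filter.1 hx').2
    _ ≤ ∑ x', s ^ (-d) * s ^ hammingDist x x' :=
        Finset.sum_le_univ_sum_of_nonneg fun x' => by positivity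
    _ ≤ _ := by rw [← Finset.mul_sum]; gcongr

/-- Small Hamming balls have small exponential growth. -/
lemma exists_ball_exponent (X : Type*) [Fintype X] [DecidableEq X] {γ : ℝ} (hγ : 0 < γ) :
    ∃ θ > 0, ∀ (n : ℕ) (x : Fin n → X),
      ((Finset.univ.filter fun x' => (hammingDist x x' : ℝ) ≤ θ * n).card : ℝ) ≤ 2 ^ (n * γ) := by
  have hl2 := Real.log_pos one_lt_two
  -- The exponent is halved: `s` is small enough for (1 + |X| s)ⁿ to use one half, and then θ is
  -- chosen so that s^(-θn) uses the other.
  obtain ⟨s, hs, hs1, hs2⟩ : ∃ s : ℝ, 0 < s ∧ s < 1 ∧ Fintype.card X * s ≤ γ * Real.log 2 / 2 := by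
    set a := γ * Real.log 2 / 2
    have ha : 0 < a := by positivity
    refine ⟨min (1 / 2) (a / (Fintype.card X + 1)), by positivity,
      (min_le_left _ _).trans_lt (by norm_num), ?_⟩
    calc (Fintype.card X : ℝ) * min (1 / 2) (a / (Fintype.card X + 1))
        ≤ (Fintype.card X + 1) * (a / (Fintype.card X + 1)) := by
          gcongr
          · linarith
          · exact min_le_right _ _
      _ = a := by field_simp
  have hls : 0 < -Real.log s := by linarith [Real.log_neg hs hs1]
  refine ⟨γ * Real.log 2 / 2 / (-Real.log s), by positivity, fun n x => ?_⟩
  refine (card_hammingBall_le x hs hs1.le).trans ?_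
  rw [Real.rpow_def_of_pos hs, Real.rpow_def_of_pos two_pos]
  have h1 : (1 + Fintype.card X * s) ^ n ≤ Real.exp (n * (γ * Real.log 2 / 2)) := by
    rw [Real.exp_nat_mul]
    gcongr
    linarith [Real.add_one_le_exp (γ * Real.log 2 / 2)]
  calc _ ≤ Real.exp (Real.log s * -(γ * Real.log 2 / 2 / (-Real.log s) * n)) *
        Real.exp (n * (γ * Real.log 2 / 2)) := by gcongr
    _ = _ := by
      rw [← Real.exp_add]
      congr 1
      have := (neg_pos.1 hls).ne
      have h2 : Real.log s * -(γ * Real.log 2 / 2 / (-Real.log s) * n) = γ * Real.log 2 / 2 * n := by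
        field_simp
      rw [h2]
      ring

end Words

/-! ### Likelihood-ratio tests -/

section Kernel

variable {X Y : Type*} [Fintype X] [MeasurableSpace Y] (W : X → ProbabilityMeasure Y)

/-- The sum is the density of the mixture with respect to itself; comparing integrals over
measurable sets gives the upper bound without absolute continuity of zero-weight letters. -/
lemma sum_rnDeriv_mixture_le {p : X → ℝ} (hp : p ∈ stdSimplex ℝ X) :
    (fun y => ∑ a, ENNReal.ofReal (p a) * (W a : Measure Y).rnDeriv (mixture W p) y)
      ≤ᵐ[mixture W p] fun _ => 1 := by
  have hM := isProbabilityMeasure_mixture W hp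
  have hm : ∀ a, Measurable fun y => ENNReal.ofReal (p a) * (W a : Measure Y).rnDeriv (mixture W p) y :=
    fun a => (Measure.measurable_rnDeriv _ _).const_mul _
  refine ae_le_of_forall_setLIntegral_le_of_sigmaFinite (Finset.measurable_sum _ fun a _ => hm a)
    fun s hs _ => ?_
  rw [lintegral_finsetSum _ fun a _ => hm a, setLIntegral_one, mixture_apply]
  refine Finset.sum_le_sum fun a _ => ?_
  rw [lintegral_const_mul _ (Measure.measurable_rnDeriv _ _)]
  gcongr
  exact Measure.setLIntegral_rnDeriv_le s

/-- The expected density ratio of one letter when another one is sent. -/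
noncomputable def crossDensity (p : X → ℝ) (a b : X) : ℝ≥0∞ :=
  ∫⁻ y, (W a : Measure Y).rnDeriv (mixture W p) y ∂(W b : Measure Y)

/-- Averaging over the tested letter bounds the density by 1 almost everywhere under the mixture;
the positive weight of `b` transfers this to `W b`. -/
lemma sum_crossDensity_left {p : X → ℝ} (hp : p ∈ stdSimplex ℝ X) {b : X} (hb : 0 < p b) :
    ∑ a, ENNReal.ofReal (p a) * crossDensity W p a b ≤ 1 := by
  simp only [crossDensity]
  simp only [← lintegral_const_mul _ (Measure.measurable_rnDeriv _ _)]
  rw [← lintegral_finsetSum _ fun a _ => (Measure.measurable_rnDeriv _ _).const_mul _]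
  calc _ ≤ ∫⁻ _, 1 ∂(W b : Measure Y) :=
        lintegral_mono_ae ((absolutelyContinuous_mixture W hb).ae_le (sum_rnDeriv_mixture_le W hp))
    _ = 1 := by simp

lemma lintegral_mixture (p : X → ℝ) (f : Y → ℝ≥0∞) :
    ∫⁻ y, f y ∂mixture W p = ∑ b, ENNReal.ofReal (p b) * ∫⁻ y, f y ∂(W b : Measure Y) := by
  rw [mixture, lintegral_finsetSum_measure]
  simp [lintegral_smul_measure]

lemma sum_crossDensity_right {p : X → ℝ} (a : X) :
    ∑ b, ENNReal.ofReal (p b) * crossDensity W p a b ≤ 1 := by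
  simp only [crossDensity]
  rw [← lintegral_mixture]
  exact (Measure.lintegral_rnDeriv_le).trans (by simp)

variable {n : ℕ}

/-- The likelihood-ratio test of a word. -/
def ratioTest (r : Fin n → X → ℝ) (c : ℝ≥0∞) (x : Fin n → X) : Set (Fin n → Y) :=
  {y | c ≤ ∏ i, (W (x i) : Measure Y).rnDeriv (mixture W (r i)) (y i)}

lemma measurableSet_ratioTest (r : Fin n → X → ℝ) (c : ℝ≥0∞) (x : Fin n → X) :
    MeasurableSet (ratioTest W r c x) :=
  measurableSet_le measurable_const (Finset.measurable_prod _ fun i _ =>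
    (Measure.measurable_rnDeriv _ _).comp (measurable_pi_apply i))

lemma ratioTest_le (r : Fin n → X → ℝ) {c : ℝ≥0∞} (hc : c ≠ 0) (hc' : c ≠ ∞) (x x' : Fin n → X) :
    (channelPow W n x' : Measure (Fin n → Y)) (ratioTest W r c x) ≤
      c⁻¹ * ∏ i, crossDensity W (r i) (x i) (x' i) := by
  have hm : Measurable fun y : Fin n → Y =>
      ∏ i, (W (x i) : Measure Y).rnDeriv (mixture W (r i)) (y i) :=
    Finset.measurable_prod _ fun i _ => (Measure.measurable_rnDeriv _ _).comp (measurable_pi_apply i)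
  have h := mul_meas_ge_le_lintegral (μ := (channelPow W n x' : Measure (Fin n → Y))) hm c
  have e : ∫⁻ y, ∏ i, (W (x i) : Measure Y).rnDeriv (mixture W (r i)) (y i)
      ∂(channelPow W n x' : Measure (Fin n → Y)) = ∏ i, crossDensity W (r i) (x i) (x' i) :=
    lintegral_pi_prod (fun i => (W (x' i) : Measure Y)) fun i => Measure.measurable_rnDeriv _ _
  rw [e] at h
  rw [← ENNReal.div_eq_inv_mul]
  rw [ENNReal.le_div_iff_mul_le (.inl hc) (.inl hc'), mul_comm]
  exact h

lemma sum_ratioTest_left {r : Fin n → X → ℝ} (hr : ∀ i, r i ∈ stdSimplex ℝ X) {c : ℝ≥0∞}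
    (hc : c ≠ 0) (hc' : c ≠ ∞) {x : Fin n → X} (hx : ∀ i, 0 < r i (x i)) (S : Finset (Fin n → X)) :
    ∑ x' ∈ S, wordWeight r x' * (channelPow W n x : Measure (Fin n → Y)) (ratioTest W r c x') ≤
      c⁻¹ := by
  calc _ ≤ ∑ x', wordWeight r x' * (c⁻¹ * ∏ i, crossDensity W (r i) (x' i) (x i)) :=
        (Finset.sum_le_univ_sum_of_nonneg fun _ => zero_le).trans
          (Finset.sum_le_sum fun x' _ => by gcongr; exact ratioTest_le W r hc hc' x' x)
    _ = c⁻¹ * ∏ i, ∑ a, ENNReal.ofReal (r i a) * crossDensity W (r i) a (x i) := by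
        rw [Fintype.prod_sum, Finset.mul_sum]
        refine Finset.sum_congr rfl fun x' _ => ?_
        rw [Finset.prod_mul_distrib, wordWeight]
        ring
    _ ≤ c⁻¹ * 1 := by
        gcongr
        exact Finset.prod_le_one' fun i _ => sum_crossDensity_left W (hr i) (hx i)
    _ = c⁻¹ := mul_one _

lemma sum_ratioTest_right (r : Fin n → X → ℝ) {c : ℝ≥0∞}
    (hc : c ≠ 0) (hc' : c ≠ ∞) (x : Fin n → X) (S : Finset (Fin n → X)) :
    ∑ x' ∈ S, wordWeight r x' * (channelPow W n x' : Measure (Fin n → Y)) (ratioTest W r c x) ≤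
      c⁻¹ := by
  calc _ ≤ ∑ x', wordWeight r x' * (c⁻¹ * ∏ i, crossDensity W (r i) (x i) (x' i)) :=
        (Finset.sum_le_univ_sum_of_nonneg fun _ => zero_le).trans
          (Finset.sum_le_sum fun x' _ => by gcongr; exact ratioTest_le W r hc hc' x x')
    _ = c⁻¹ * ∏ i, ∑ a, ENNReal.ofReal (r i a) * crossDensity W (r i) (x i) a := by
        rw [Fintype.prod_sum, Finset.mul_sum]
        refine Finset.sum_congr rfl fun x' _ => ?_
        rw [Finset.prod_mul_distrib, wordWeight]
        ring
    _ ≤ c⁻¹ * 1 := by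
        gcongr
        exact Finset.prod_le_one' fun i _ => sum_crossDensity_right W (x i)
    _ = c⁻¹ := mul_one _

/-- A word passes its own likelihood-ratio test. -/
lemma compl_ratioTest_le {r : Fin n → X → ℝ} (hr : ∀ i, r i ∈ stdSimplex ℝ X) {x : Fin n → X}
    (hx : ∀ i, 0 < r i (x i)) {v t τ : ℝ} (ht : 0 < t)
    (hv : ∀ i, Var[llr (W (x i) : Measure Y) (mixture W (r i)); (W (x i) : Measure Y)] ≤ v)
    (hτ : τ ≤ ∑ i, (klDiv (W (x i) : Measure Y) (mixture W (r i))).toReal - t) :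
    (channelPow W n x : Measure (Fin n → Y)) (ratioTest W r (ENNReal.ofReal (Real.exp τ)) x)ᶜ ≤
      ENNReal.ofReal (n * v / t ^ 2) := by
  have hM : ∀ i, IsProbabilityMeasure (mixture W (r i)) := fun i =>
    isProbabilityMeasure_mixture W (hr i)
  have hac : ∀ i, (W (x i) : Measure Y) ≪ mixture W (r i) := fun i =>
    absolutelyContinuous_mixture W (hx i)
  have key := pi_sum_le_sub_le (P := fun i => (W (x i) : Measure Y))
    (h := fun i => llr (W (x i) : Measure Y) (mixture W (r i)))
    (fun i => memLp_llr_mixture W (hr i) (hx i)) ht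
    (V := n * v) ((Finset.sum_le_sum fun i _ => hv i).trans (by simp))
  refine le_trans (measure_mono_ae ?_) key
  have h1 := ae_pi_eval (fun i => (W (x i) : Measure Y))
    (p := fun i y => 0 < (W (x i) : Measure Y).rnDeriv (mixture W (r i)) y)
    fun i => Measure.rnDeriv_pos (hac i)
  have h2 := ae_pi_eval (fun i => (W (x i) : Measure Y))
    (p := fun i y => (W (x i) : Measure Y).rnDeriv (mixture W (r i)) y < ∞)
    fun i => (hac i).ae_le (Measure.rnDeriv_lt_top _ _)
  filter_upwards [h1, h2] with y h1 h2 hy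
  have hy' : ∏ i, (W (x i) : Measure Y).rnDeriv (mixture W (r i)) (y i) <
      ENNReal.ofReal (Real.exp τ) := not_le.1 hy
  change ∑ i, llr (W (x i) : Measure Y) (mixture W (r i)) (y i) ≤ _
  simp only [← toReal_klDiv_of_measure_eq (hac _) (by simp)]
  refine le_trans ?_ hτ
  simp only [llr]
  rw [← Real.log_prod fun i _ => (ENNReal.toReal_pos (h1 i).ne' (h2 i).ne).ne', ← ENNReal.toReal_prod]
  rw [Real.log_le_iff_le_exp]
  · exact ENNReal.toReal_le_of_le_ofReal (Real.exp_nonneg _) hy'.le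
  · rw [ENNReal.toReal_prod]
    exact Finset.prod_pos fun i _ => ENNReal.toReal_pos (h1 i).ne' (h2 i).ne

end Kernel

/-! ### Distance tests -/

section WordTests

variable {X Y : Type*} [MeasurableSpace Y] {W : X → ProbabilityMeasure Y}
  {f : X → Y → ℝ} {η K : ℝ} {n : ℕ}

/-- The distance test of a word. -/
def distanceTest (f : X → Y → ℝ) (s : ℝ) (x : Fin n → X) : Set (Fin n → Y) :=
  {y | ∑ i, f (x i) (y i) < s}

lemma measurableSet_distanceTest (hf : ∀ x, Measurable (f x)) (s : ℝ) (x : Fin n → X) :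
    MeasurableSet (distanceTest f s x) :=
  measurableSet_lt (Finset.measurable_sum _ fun i _ => (hf _).comp (measurable_pi_apply i))
    measurable_const

lemma sum_variance_le (hf : ∀ x, Measurable (f x)) (hK : ∀ x y, |f x y| ≤ K)
    (x z : Fin n → X) : ∑ i, Var[f (x i); (W (z i) : Measure Y)] ≤ n * K ^ 2 := by
  have : ∀ i, Var[f (x i); (W (z i) : Measure Y)] ≤ K ^ 2 := by
    intro i
    have := variance_le_sq_of_bounded (μ := (W (z i) : Measure Y)) (X := f (x i)) (a := -K) (b := K)
      (Eventually.of_forall fun y => abs_le.1 (hK _ y)) (hf _).aemeasurable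
    exact this.trans (le_of_eq (by ring))
  exact (Finset.sum_le_sum fun i _ => this i).trans (by simp)

lemma compl_distanceTest_le (hf : ∀ x, Measurable (f x)) (hK : ∀ x y, |f x y| ≤ K)
    (h0 : ∀ x, ∫ y, f x y ∂(W x : Measure Y) = 0) {s : ℝ} (hs : 0 < s) (x : Fin n → X) :
    (channelPow W n x : Measure (Fin n → Y)) (distanceTest f s x)ᶜ ≤
      ENNReal.ofReal (n * K ^ 2 / s ^ 2) := by
  have key := pi_sum_le_sub_le (P := fun i => (W (x i) : Measure Y)) (h := fun i y => -f (x i) y)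
    (V := n * K ^ 2) (t := s) (fun i => (MemLp.of_bound (hf _).aestronglyMeasurable K
      (Eventually.of_forall (hK _))).neg) hs ?_
  · refine (measure_mono fun y hy => ?_).trans key
    have hy' : s ≤ ∑ i, f (x i) (y i) := not_lt.1 hy
    simp only [Set.mem_ofPred_eq, integral_neg, h0, Finset.sum_neg_distrib]
    simpa using hy'
  · have e : ∀ i, Var[fun y => -f (x i) y; (W (x i) : Measure Y)] =
        Var[f (x i); (W (x i) : Measure Y)] := fun i => variance_neg
    simp only [e]
    exact sum_variance_le hf hK x x

/-- Every position where the words differ contributes at least η to the mean, which is thus at least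
2s; passing the test is a deviation of more than s. -/
lemma distanceTest_le [DecidableEq X] (hf : ∀ x, Measurable (f x)) (hK : ∀ x y, |f x y| ≤ K)
    (h0 : ∀ x, ∫ y, f x y ∂(W x : Measure Y) = 0)
    (h1 : ∀ x x', x' ≠ x → η ≤ ∫ y, f x y ∂(W x' : Measure Y)) {s : ℝ} (hs : 0 < s)
    {x z : Fin n → X} (hxz : 2 * s ≤ η * hammingDist z x) :
    (channelPow W n z : Measure (Fin n → Y)) (distanceTest f s x) ≤
      ENNReal.ofReal (n * K ^ 2 / s ^ 2) := by
  have key := pi_sum_le_sub_le (P := fun i => (W (z i) : Measure Y)) (h := fun i => f (x i))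
    (V := n * K ^ 2) (t := s) (fun i => MemLp.of_bound (hf _).aestronglyMeasurable K
      (Eventually.of_forall (hK _))) hs (sum_variance_le hf hK x z)
  refine (measure_mono fun y hy => ?_).trans key
  have hy' : ∑ i, f (x i) (y i) < s := hy
  have hmean : η * hammingDist z x ≤ ∑ i, ∫ y, f (x i) y ∂(W (z i) : Measure Y) := by
    have e : η * hammingDist z x = ∑ i, if z i ≠ x i then η else 0 := by
      rw [Finset.sum_ite, Finset.sum_const_zero, add_zero, Finset.sum_const, nsmul_eq_mul, mul_comm]
      rfl
    rw [e]
    refine Finset.sum_le_sum fun i _ => ?_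
    split_ifs with h
    · exact h1 _ _ h
    · rw [not_not.1 h, h0]
  simp only [Set.mem_ofPred_eq]
  linarith

end WordTests

/-! ### Codes of fixed block length -/

section WordCodes

variable {X Y : Type*} [Fintype X] [DecidableEq X] [MeasurableSpace Y]
  {W : X → ProbabilityMeasure Y} {f : X → Y → ℝ} {η K : ℝ} {n : ℕ}

/-- Acceptance means passing both tests: the ratio test controls the list size, the distance test
the binding. Binding holds against every input word, since by the triangle inequality none is close
to two codewords. -/
lemma exists_wordCode (hf : ∀ x, Measurable (f x)) (hη : 0 < η) (hK : ∀ x y, |f x y| ≤ K)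
    (h0 : ∀ x, ∫ y, f x y ∂(W x : Measure Y) = 0)
    (h1 : ∀ x x', x' ≠ x → η ≤ ∫ y, f x y ∂(W x' : Measure Y)) (hn : 0 < n)
    {r : Fin n → X → ℝ} (hr : ∀ i, r i ∈ stdSimplex ℝ X) {S : Finset (Fin n → X)}
    (hS : ∀ x ∈ S, ∀ i, 0 < r i (x i)) (hS2 : 1 ≤ 2 * ∑ x ∈ S, wordWeight r x) {θ : ℝ} (hθ : 0 < θ)
    {C : ℝ≥0∞} (hC : ∀ x ∈ S, ∑ x' ∈ S, wordWeight r x' *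
      (if (hammingDist x x' : ℝ) ≤ θ * n then 1 else 0) ≤ C)
    {v t τ : ℝ} (ht : 0 < t)
    (hv : ∀ x ∈ S, ∀ i, Var[llr (W (x i) : Measure Y) (mixture W (r i)); (W (x i) : Measure Y)] ≤ v)
    (hτ : ∀ x ∈ S, τ ≤ ∑ i, (klDiv (W (x i) : Measure Y) (mixture W (r i))).toReal - t)
    {M L : ℕ} (hL : 1 ≤ L) (hLM : L < M) {κ : ℝ≥0∞} (hκ : κ ≠ 0) (hκ1 : κ ≤ 1)
    (hM : 8 * M * (C + (ENNReal.ofReal (Real.exp (-τ)) + ENNReal.ofReal (Real.exp (-τ))) / L) ≤ κ) :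
    ∃ c : ListCode (Fin n → X) (Fin n → Y), c.M = M ∧ c.L = L ∧ (∀ m, c.φ m ∈ S) ∧
      errA (channelPow W n) c ≤ ENNReal.ofReal (n * v / t ^ 2) +
        ENNReal.ofReal (n * K ^ 2 / (θ * η / 4 * n) ^ 2) + κ ∧
      deltaD (channelPow W n) c ≤ ENNReal.ofReal (n * K ^ 2 / (θ * η / 4 * n) ^ 2) := by
  have hn' : (0 : ℝ) < n := by exact_mod_cast hn
  -- Half of the mean η·θn/2 accumulated at distance θn/2.
  set s := θ * η / 4 * n with hs
  have hs0 : 0 < s := by positivity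
  let T : (Fin n → X) → Set (Fin n → Y) := fun x =>
    ratioTest W r (ENNReal.ofReal (Real.exp τ)) x ∩ distanceTest f s x
  have hT : ∀ x, MeasurableSet (T x) := fun x =>
    (measurableSet_ratioTest W r _ x).inter (measurableSet_distanceTest hf s x)
  have he0 : ENNReal.ofReal (Real.exp τ) ≠ 0 := by simpa using Real.exp_pos τ
  have hinv : (ENNReal.ofReal (Real.exp τ))⁻¹ = ENNReal.ofReal (Real.exp (-τ)) := by
    rw [Real.exp_neg, ENNReal.ofReal_inv_of_pos (Real.exp_pos τ)]
  have hSne : S.Nonempty := by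
    rw [Finset.nonempty_iff_ne_empty]
    rintro rfl
    simp at hS2
  obtain ⟨c, hcM, hcL, hcS, hcd, hcT, hce⟩ := exists_code_of_tests (channelPow W n) hT
    (p := wordWeight r) (S := S)
    (fun x hx => ⟨Finset.prod_ne_zero_iff.2 fun i _ => by simpa using hS x hx i,
      ENNReal.prod_ne_top fun i _ => ENNReal.ofReal_ne_top⟩) hSne hS2
    (close := fun x x' => (hammingDist x x' : ℝ) ≤ θ * n)
    (fun x x' h => by rw [hammingDist_comm]; exact h) hC
    (C₂ := ENNReal.ofReal (Real.exp (-τ))) (C₃ := ENNReal.ofReal (Real.exp (-τ)))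
    (fun x hx => by
      rw [← hinv]
      refine le_trans (Finset.sum_le_sum fun x' _ => ?_)
        (sum_ratioTest_left W hr he0 ENNReal.ofReal_ne_top (hS x hx) S)
      gcongr
      exact Set.inter_subset_left)
    (fun x hx => by
      rw [← hinv]
      refine le_trans (Finset.sum_le_sum fun x' _ => ?_)
        (sum_ratioTest_right W r he0 ENNReal.ofReal_ne_top x S)
      gcongr
      exact Set.inter_subset_left)
    hL hLM hκ hκ1 hM
  refine ⟨c, hcM, hcL, hcS, iSup_le fun m => (hce m).trans ?_, ?_⟩
  · gcongr
    simp only [T, Set.compl_inter]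
    refine (measure_union_le _ _).trans (add_le_add ?_ ?_)
    · exact compl_ratioTest_le W hr (hS _ (hcS m)) ht (hv _ (hcS m)) (hτ _ (hcS m))
    · exact compl_distanceTest_le hf hK h0 hs0 _
  · refine iSup_le fun z => iSup_le fun m => iSup_le fun m' => iSup_le fun hne => ?_
    have hd := hcd m m' hne
    have htri : (hammingDist (c.φ m) (c.φ m') : ℝ) ≤
        hammingDist z (c.φ m) + hammingDist z (c.φ m') := by
      have := hammingDist_triangle (c.φ m) z (c.φ m')
      rw [hammingDist_comm (c.φ m) z] at this
      exact_mod_cast this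
    have hsub : ∀ m, (channelPow W n z : Measure (Fin n → Y)) {y | m ∈ c.Ψ y} ≤
        (channelPow W n z : Measure (Fin n → Y)) (distanceTest f s (c.φ m)) := fun m =>
      measure_mono fun y hy => (hcT m y hy).2
    have hbig : θ * n / 2 ≤ hammingDist z (c.φ m) ∨ θ * n / 2 ≤ hammingDist z (c.φ m') := by
      by_contra! h
      linarith [h.1, h.2, not_le.1 hd]
    have hcalc : ∀ d : ℝ, θ * n / 2 ≤ d → 2 * s ≤ η * d := fun d hd => by
      calc 2 * s = η * (θ * n / 2) := by rw [hs]; ring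
        _ ≤ η * d := by gcongr
    rcases hbig with h | h
    · exact (min_le_left _ _).trans ((hsub m).trans
        (distanceTest_le hf hK h0 h1 hs0 (hcalc _ h)))
    · exact (min_le_right _ _).trans ((hsub m').trans
        (distanceTest_le hf hK h0 h1 hs0 (hcalc _ h)))

end WordCodes

/-! ### Elementary asymptotics of rates and error bounds -/

section Asymptotics

lemma tendsto_chebyshev_bound (v : ℝ) {c : ℝ} (hc : 0 < c) :
    Tendsto (fun n : ℕ => ENNReal.ofReal (n * v / (c * n) ^ 2)) atTop (𝓝 0) := by
  have h : Tendsto (fun n : ℕ => v / c ^ 2 / (n : ℝ)) atTop (𝓝 0) :=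
    tendsto_const_div_atTop_nhds_zero_nat _
  have h2 := (ENNReal.continuous_ofReal.tendsto 0).comp h
  rw [ENNReal.ofReal_zero] at h2
  refine h2.congr fun n => ?_
  simp only [Function.comp]
  congr 1
  rcases eq_or_ne (n : ℝ) 0 with h0 | h0
  · simp [h0]
  · field_simp

lemma one_le_two_rpow {n : ℕ} {R : ℝ} (hR : 0 ≤ R) : (1 : ℝ) ≤ 2 ^ (n * R) :=
  Real.one_le_rpow one_le_two (by positivity)

lemma le_ceil_two_rpow (n : ℕ) (R : ℝ) : (2 : ℝ) ^ (n * R) ≤ ⌈(2 : ℝ) ^ (n * R)⌉₊ := Nat.le_ceil _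

lemma ceil_two_rpow_le {n : ℕ} {R : ℝ} (hR : 0 ≤ R) :
    (⌈(2 : ℝ) ^ (n * R)⌉₊ : ℝ) ≤ 2 * 2 ^ (n * R) := by
  have h := (Nat.ceil_lt_add_one (by positivity : (0 : ℝ) ≤ 2 ^ (n * R))).le
  linarith [one_le_two_rpow (n := n) hR]

lemma tendsto_logb_ceil {R : ℝ} (hR : 0 ≤ R) :
    Tendsto (fun n : ℕ => Real.logb 2 ⌈(2 : ℝ) ^ (n * R)⌉₊ / n) atTop (𝓝 R) := by
  have h1 : Tendsto (fun n : ℕ => R + 1 / (n : ℝ)) atTop (𝓝 (R + 0)) :=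
    (tendsto_const_div_atTop_nhds_zero_nat 1).const_add R
  rw [add_zero] at h1
  refine tendsto_of_tendsto_of_tendsto_of_le_of_le' tendsto_const_nhds h1 ?_ ?_
  · filter_upwards [eventually_gt_atTop 0] with n hn
    have hn' : (0 : ℝ) < n := by exact_mod_cast hn
    rw [le_div_iff₀ hn', mul_comm]
    calc (n : ℝ) * R = Real.logb 2 (2 ^ (n * R)) := by rw [Real.logb_rpow] <;> norm_num
      _ ≤ _ := Real.logb_le_logb_of_le one_lt_two (by positivity) (le_ceil_two_rpow n R)
  · filter_upwards [eventually_gt_atTop 0] with n hn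
    have hn' : (0 : ℝ) < n := by exact_mod_cast hn
    rw [div_le_iff₀ hn', add_mul, one_div_mul_cancel hn'.ne']
    calc _ ≤ Real.logb 2 (2 * 2 ^ (n * R)) := Real.logb_le_logb_of_le one_lt_two
          (lt_of_lt_of_le (by positivity) (le_ceil_two_rpow n R)) (ceil_two_rpow_le hR)
      _ = 1 + n * R := by
        rw [Real.logb_mul (by norm_num) (by positivity), Real.logb_rpow (by norm_num) (by norm_num),
          Real.logb_self_eq_one one_lt_two]
      _ = _ := by ring

lemma eventually_ceil_lt_ceil {R₁ R₂ : ℝ} (h2 : 0 ≤ R₂) (h : R₂ < R₁) :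
    ∀ᶠ n : ℕ in atTop, ⌈(2 : ℝ) ^ (n * R₂)⌉₊ < ⌈(2 : ℝ) ^ (n * R₁)⌉₊ := by
  have ht : Tendsto (fun n : ℕ => (n : ℝ) * (R₁ - R₂)) atTop atTop :=
    tendsto_natCast_atTop_atTop.atTop_mul_const (sub_pos.2 h)
  filter_upwards [ht.eventually_ge_atTop 1] with n hn
  have h3 : (2 : ℝ) ^ (n * R₂) + 1 ≤ 2 ^ (n * R₁) := by
    have e : (2 : ℝ) ^ (n * R₁) = 2 ^ (n * R₂) * 2 ^ (n * (R₁ - R₂)) := by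
      rw [← Real.rpow_add two_pos]; congr 1; ring
    have h4 : (2 : ℝ) ≤ 2 ^ (n * (R₁ - R₂)) := by
      calc (2 : ℝ) = 2 ^ (1 : ℝ) := (Real.rpow_one 2).symm
        _ ≤ _ := Real.rpow_le_rpow_of_exponent_le one_le_two hn
    have h5 := one_le_two_rpow (n := n) h2
    rw [e]
    nlinarith
  have h4 := Nat.ceil_lt_add_one (by positivity : (0 : ℝ) ≤ 2 ^ (n * R₂))
  exact_mod_cast h4.trans_le (h3.trans (le_ceil_two_rpow n R₁))

lemma tendsto_two_rpow_neg {δ : ℝ} (hδ : 0 < δ) (c : ℝ) :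
    Tendsto (fun n : ℕ => c * (2 : ℝ) ^ (-(n * δ))) atTop (𝓝 0) := by
  have ht : Tendsto (fun n : ℕ => (n : ℝ) * δ) atTop atTop :=
    tendsto_natCast_atTop_atTop.atTop_mul_const hδ
  have h := (tendsto_rpow_atBot_of_base_gt_one 2 one_lt_two).comp (tendsto_neg_atTop_atBot.comp ht)
  simpa using h.const_mul c

end Asymptotics

/-! ### Typical words -/

section Typical

variable {U X : Type*} [Fintype U] [Fintype X] {w : U → ℝ} {q : U → X → ℝ} {u : ℕ → U}

/-- The mean of a function of the auxiliary and the input letter. -/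
def pairMean (w : U → ℝ) (q : U → X → ℝ) (h : U → X → ℝ) : ℝ := ∑ v, w v * ∑ a, q v a * h v a

open Classical in
/-- The words that are possible and for which the empirical sums of finitely many functions are
not much below their means. -/
noncomputable def typicalWords {J : Type*} (w : U → ℝ) (q : U → X → ℝ) (u : ℕ → U)
    (h : J → U → X → ℝ) (δ : ℝ) (n : ℕ) : Finset (Fin n → X) :=
  Finset.univ.filter fun x => (∀ i : Fin n, 0 < q (u i) (x i)) ∧
    ∀ j, n * (pairMean w q (h j) - 2 * δ) ≤ ∑ i : Fin n, h j (u i) (x i)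

lemma mem_typicalWords {J : Type*} {h : J → U → X → ℝ} {δ : ℝ} {n : ℕ}
    {x : Fin n → X} : x ∈ typicalWords w q u h δ n ↔ (∀ i : Fin n, 0 < q (u i) (x i)) ∧
      ∀ j, n * (pairMean w q (h j) - 2 * δ) ≤ ∑ i : Fin n, h j (u i) (x i) := by
  simp [typicalWords]

/-- Chebyshev's inequality for each of the finitely many functions and a union bound. One δ covers
the frequencies of `u`, the other the random fluctuation; words with an impossible letter have
weight zero. -/
lemma eventually_typicalWords {J : Type*} [Fintype J] (hq : ∀ v, q v ∈ stdSimplex ℝ X)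
    (hu : ∀ h : U → ℝ, Tendsto (fun n : ℕ => (∑ i : Fin n, h (u i)) / n) atTop (𝓝 (∑ v, w v * h v)))
    (h : J → U → X → ℝ) {δ : ℝ} (hδ : 0 < δ) :
    ∀ᶠ n : ℕ in atTop,
      1 ≤ 2 * ∑ x ∈ typicalWords w q u h δ n, wordWeight (fun i : Fin n => q (u i)) x := by
  classical
  set b : ℝ := ∑ j, ∑ v, ∑ a, |h j v a| with hb
  have hbd : ∀ j v a, |h j v a| ≤ b := fun j v a =>
    (Finset.single_le_sum (f := fun a => |h j v a|) (fun _ _ => abs_nonneg _)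
      (Finset.mem_univ a)).trans
    ((Finset.single_le_sum (f := fun v => ∑ a, |h j v a|)
      (fun _ _ => Finset.sum_nonneg fun _ _ => abs_nonneg _) (Finset.mem_univ v)).trans
    (Finset.single_le_sum (f := fun j => ∑ v, ∑ a, |h j v a|)
      (fun _ _ => Finset.sum_nonneg fun _ _ => Finset.sum_nonneg fun _ _ => abs_nonneg _)
      (Finset.mem_univ j)))
  have hmean : ∀ᶠ n : ℕ in atTop, ∀ j, pairMean w q (h j) - δ <
      (∑ i : Fin n, ∑ a, q (u i) a * h j (u i) a) / n :=
    eventually_all.2 fun j => (hu fun v => ∑ a, q v a * h j v a).eventually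
      (lt_mem_nhds (sub_lt_self _ hδ))
  have hsmall : ∀ᶠ n : ℕ in atTop,
      (Fintype.card J : ℝ≥0∞) * ENNReal.ofReal (n * b ^ 2 / (δ * n) ^ 2) < 2⁻¹ := by
    have := ENNReal.Tendsto.const_mul (tendsto_chebyshev_bound (b ^ 2) hδ)
      (a := (Fintype.card J : ℝ≥0∞)) (.inr (by simp))
    rw [mul_zero] at this
    exact this.eventually (gt_mem_nhds (by simp))
  filter_upwards [hmean, hsmall, eventually_gt_atTop 0] with n hmean hsmall hn
  have hn' : (0 : ℝ) < n := by exact_mod_cast hn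
  set S := typicalWords w q u h δ n
  set p := wordWeight fun i : Fin n => q (u i)
  let E : J → Finset (Fin n → X) := fun j => Finset.univ.filter fun x =>
    ∑ i : Fin n, h j (u i) (x i) ≤ ∑ i : Fin n, ∑ a, q (u i) a * h j (u i) a - δ * n
  have hE : ∀ j, ∑ x ∈ E j, p x ≤ ENNReal.ofReal (n * b ^ 2 / (δ * n) ^ 2) := fun j =>
    sum_wordWeight_le (fun i => hq _) (fun i => h j (u i)) (fun i a => hbd j _ a) (by positivity)
      (E j) fun x hx => (Finset.mem_filter.1 hx).2
  have hcompl : ∀ x, p x ≤ (if x ∈ S then p x else 0) + ∑ j, if x ∈ E j then p x else 0 := by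
    intro x
    by_cases hx : x ∈ S
    · simp [hx]
    · simp only [hx, if_false, zero_add]
      by_cases hpos : ∀ i : Fin n, 0 < q (u i) (x i)
      · have : ∃ j, ∑ i : Fin n, h j (u i) (x i) < n * (pairMean w q (h j) - 2 * δ) := by
          by_contra! hc
          exact hx (mem_typicalWords.2 ⟨hpos, hc⟩)
        obtain ⟨j, hj⟩ := this
        have hxE : x ∈ E j := by
          refine Finset.mem_filter.2 ⟨Finset.mem_univ x, hj.le.trans ?_⟩
          have := (lt_div_iff₀ hn').1 (hmean j)
          linarith
        refine le_trans ?_ (Finset.single_le_sum (f := fun j => if x ∈ E j then p x else 0)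
          (fun _ _ => zero_le) (Finset.mem_univ j))
        simp [hxE]
      · push Not at hpos
        obtain ⟨i, hi⟩ := hpos
        have : p x = 0 := Finset.prod_eq_zero (Finset.mem_univ i) (ENNReal.ofReal_of_nonpos hi)
        simp [this]
  have htot : 1 ≤ ∑ x ∈ S, p x + 2⁻¹ := by
    calc 1 = ∑ x, p x := (sum_wordWeight fun i => hq _).symm
      _ ≤ ∑ x, ((if x ∈ S then p x else 0) + ∑ j, if x ∈ E j then p x else 0) :=
          Finset.sum_le_sum fun x _ => hcompl x
      _ = ∑ x ∈ S, p x + ∑ j, ∑ x ∈ E j, p x := by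
          rw [Finset.sum_add_distrib, Finset.sum_comm]
          simp [Finset.sum_ite_mem]
      _ ≤ ∑ x ∈ S, p x + 2⁻¹ := by
          gcongr
          refine le_trans (Finset.sum_le_sum fun j _ => hE j) ?_
          simpa using hsmall.le
  have hhalf : (2⁻¹ : ℝ≥0∞) ≤ ∑ x ∈ S, p x := by
    rw [← ENNReal.inv_two_add_inv_two] at htot
    exact (ENNReal.add_le_add_iff_right (by simp)).1 htot
  calc (1 : ℝ≥0∞) = 2 * 2⁻¹ := (ENNReal.mul_inv_cancel (by simp) (by simp)).symm
    _ ≤ _ := by gcongr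

omit [Fintype X] in
lemma wordWeight_le {n : ℕ} {r : Fin n → X → ℝ} {x : Fin n → X} (hx : ∀ i, 0 < r i (x i)) {s : ℝ}
    (hs : s ≤ ∑ i, -Real.logb 2 (r i (x i))) : wordWeight r x ≤ ENNReal.ofReal (2 ^ (-s)) := by
  rw [wordWeight, ← ENNReal.ofReal_prod_of_nonneg fun i _ => (hx i).le]
  refine ENNReal.ofReal_le_ofReal ?_
  rw [← Real.logb_le_iff_le_rpow one_lt_two (Finset.prod_pos fun i _ => hx i),
    Real.logb_prod _ _ fun i _ => (hx i).ne']
  rw [Finset.sum_neg_distrib] at hs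
  linarith

end Typical

/-! ### Existence of strongly secure codes -/

section Direct

variable {U X Y : Type*} [Fintype U] [Fintype X] [MeasurableSpace Y]
  {W : X → ProbabilityMeasure Y} {w : U → ℝ} {q : U → X → ℝ}

/-- A trivial code. -/
def trivialCode {A : Type*} (B : Type*) [MeasurableSpace B] (a : A) : ListCode A B where
  M := 2
  L := 1
  one_le_L := le_rfl
  L_lt_M := one_lt_two
  φ _ := a
  Ψ _ := ∅
  card_le _ := by simp
  measurableSet_mem _ := by simp

/-- The slack 4δ leaves the exponent -δ in both terms, after the losses 3δ for ball size and
typicality and 3δ for the ratio test. The constant is 16·(1 + 2), with 16 from the rounding of M. -/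
lemma eight_mul_cost_le {n M L : ℕ} {R₁ R₂ H I δ : ℝ}
    (hH : 4 * δ ≤ H - R₁) (hI : 4 * δ ≤ I - (R₁ - R₂))
    (hM : (M : ℝ) ≤ 2 * 2 ^ (n * R₁)) (hL : (2 : ℝ) ^ (n * R₂) ≤ L) :
    8 * (M : ℝ≥0∞) * (ENNReal.ofReal (2 ^ (n * δ) * 2 ^ (-(n * (H - 2 * δ)))) +
      (ENNReal.ofReal (2 ^ (-(n * (I - 3 * δ)))) + ENNReal.ofReal (2 ^ (-(n * (I - 3 * δ))))) / L) ≤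
      ENNReal.ofReal (48 * 2 ^ (-(n * δ))) := by
  have hL0 : (0 : ℝ) < L := lt_of_lt_of_le (by positivity) hL
  set e : ℝ := 2 ^ (-(n * (I - 3 * δ))) with he
  have he0 : 0 ≤ e := by positivity
  have ha0 : (0 : ℝ) ≤ 2 ^ (n * δ) * 2 ^ (-(n * (H - 2 * δ))) := by positivity
  have h1 : 8 * (M : ℝ≥0∞) * (ENNReal.ofReal (2 ^ (n * δ) * 2 ^ (-(n * (H - 2 * δ)))) +
      (ENNReal.ofReal e + ENNReal.ofReal e) / L) =
      ENNReal.ofReal (8 * M * (2 ^ (n * δ) * 2 ^ (-(n * (H - 2 * δ))) + (e + e) / L)) := by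
    generalize (2 : ℝ) ^ (n * δ) * 2 ^ (-(n * (H - 2 * δ))) = a at *
    rw [ENNReal.ofReal_mul (by positivity), ENNReal.ofReal_mul (by norm_num),
      ENNReal.ofReal_natCast, ENNReal.ofReal_add ha0 (by positivity),
      ENNReal.ofReal_div_of_pos hL0, ENNReal.ofReal_natCast, ENNReal.ofReal_add he0 he0]
    norm_num
  rw [h1]
  refine ENNReal.ofReal_le_ofReal ?_
  have h2 : (2 : ℝ) ^ (n * R₁) * (2 ^ (n * δ) * 2 ^ (-(n * (H - 2 * δ)))) ≤ 2 ^ (-(n * δ)) := by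
    rw [← Real.rpow_add two_pos, ← Real.rpow_add two_pos]
    refine Real.rpow_le_rpow_of_exponent_le one_le_two ?_
    nlinarith [Nat.cast_nonneg (α := ℝ) n]
  have h3 : (2 : ℝ) ^ (n * R₁) * (e / L) ≤ 2 ^ (-(n * δ)) := by
    calc _ ≤ (2 : ℝ) ^ (n * R₁) * (e / 2 ^ (n * R₂)) := by gcongr
      _ ≤ _ := by
        rw [he, ← Real.rpow_sub two_pos, ← Real.rpow_add two_pos]
        refine Real.rpow_le_rpow_of_exponent_le one_le_two ?_
        nlinarith [Nat.cast_nonneg (α := ℝ) n]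
  calc _ ≤ 8 * (2 * 2 ^ (n * R₁)) * (2 ^ (n * δ) * 2 ^ (-(n * (H - 2 * δ))) + (e + e) / L) := by
        gcongr
    _ = 16 * (2 ^ (n * R₁) * (2 ^ (n * δ) * 2 ^ (-(n * (H - 2 * δ)))) +
          2 * (2 ^ (n * R₁) * (e / L))) := by ring
    _ ≤ 16 * (2 ^ (-(n * δ)) + 2 * 2 ^ (-(n * δ))) := by gcongr
    _ = _ := by ring

/-- Existence of strongly secure codes whose codewords have nearly prescribed letter statistics. -/
theorem exists_secure_codes (hW : NonRedundant W) (hw : w ∈ stdSimplex ℝ U)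
    (hq : ∀ v, q v ∈ stdSimplex ℝ X) {R₁ R₂ : ℝ} (hR₂ : 0 < R₂) (hR : R₂ < R₁)
    (hI : R₁ - R₂ < ∑ v, w v * mutualInfo W (q v)) (hH : R₁ < ∑ v, w v * entropy (q v))
    (g : U → X → ℝ) {ε : ℝ} (hε : 0 < ε) :
    ∃ (u : ℕ → U) (c : ∀ n : ℕ, ListCode (Fin n → X) (Fin n → Y)),
      Secure .strong W c ∧ HasRates c R₁ R₂ ∧ ∀ᶠ n : ℕ in atTop, ∀ m,
        (∀ i : Fin n, 0 < q (u i) ((c n).φ m i)) ∧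
        ∑ i : Fin n, g (u i) ((c n).φ m i) ≤ n * (pairMean w q g + ε) := by
  classical
  obtain ⟨u, hu⟩ := exists_sequence_frequencies hw
  obtain ⟨f, η, K, hf, hη, hK, h0, h1⟩ := hW.exists_tests
  have hl2 := Real.log_pos one_lt_two
  set I := ∑ v, w v * mutualInfo W (q v) with hIdef
  set H := ∑ v, w v * entropy (q v) with hHdef
  obtain ⟨δ, hδ, hδH, hδI, hδε⟩ : ∃ δ > 0, 4 * δ ≤ H - R₁ ∧ 4 * δ ≤ I - (R₁ - R₂) ∧ 2 * δ ≤ ε := by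
    refine ⟨min (min (H - R₁) (I - (R₁ - R₂))) ε / 4, ?_, ?_, ?_, ?_⟩
    · have : 0 < min (min (H - R₁) (I - (R₁ - R₂))) ε :=
        lt_min (lt_min (by linarith) (by linarith)) hε
      positivity
    all_goals
      have a1 := min_le_left (min (H - R₁) (I - (R₁ - R₂))) ε
      have a2 := min_le_right (min (H - R₁) (I - (R₁ - R₂))) ε
      have a3 := min_le_left (H - R₁) (I - (R₁ - R₂))
      have a4 := min_le_right (H - R₁) (I - (R₁ - R₂))
      linarith
  obtain ⟨θ, hθ, hball⟩ := exists_ball_exponent X hδ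
  -- Typicality gives lower bounds only: for the information (ratio test), the negative
  -- log-probability (ball mass) and, with a sign, for g.
  let h : Fin 3 → U → X → ℝ := ![fun v a => (klBits (W a : Measure Y) (mixture W (q v))).toReal,
    fun v a => -Real.logb 2 (q v a), fun v a => -g v a]
  have hm0 : pairMean w q (h 0) = I := rfl
  have hm1 : pairMean w q (h 1) = H := by
    simp only [pairMean, h, hHdef, entropy, Matrix.cons_val_one, Matrix.cons_val_zero, mul_neg,
      Finset.sum_neg_distrib]
  have hm2 : pairMean w q (h 2) = -pairMean w q g := by
    simp [pairMean, h]
  set v : ℝ := ∑ b, ∑ a, Var[llr (W a : Measure Y) (mixture W (q b)); (W a : Measure Y)] with hv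
  have hvle : ∀ b a, Var[llr (W a : Measure Y) (mixture W (q b)); (W a : Measure Y)] ≤ v :=
    fun b a => (Finset.single_le_sum
      (f := fun a => Var[llr (W a : Measure Y) (mixture W (q b)); (W a : Measure Y)])
      (fun _ _ => variance_nonneg _ _) (Finset.mem_univ a)).trans
      (Finset.single_le_sum
        (f := fun b => ∑ a, Var[llr (W a : Measure Y) (mixture W (q b)); (W a : Measure Y)])
        (fun _ _ => Finset.sum_nonneg fun _ _ => variance_nonneg _ _) (Finset.mem_univ b))
  let good : ∀ n : ℕ, ListCode (Fin n → X) (Fin n → Y) → Prop := fun n c =>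
    c.M = ⌈(2 : ℝ) ^ (n * R₁)⌉₊ ∧ c.L = ⌈(2 : ℝ) ^ (n * R₂)⌉₊ ∧
    (∀ m, c.φ m ∈ typicalWords w q u h δ n) ∧
    errA (channelPow W n) c ≤ ENNReal.ofReal (n * v / (δ * Real.log 2 * n) ^ 2) +
      ENNReal.ofReal (n * K ^ 2 / (θ * η / 4 * n) ^ 2) + ENNReal.ofReal (48 * 2 ^ (-(n * δ))) ∧
    deltaD (channelPow W n) c ≤ ENNReal.ofReal (n * K ^ 2 / (θ * η / 4 * n) ^ 2)
  have hgood : ∀ᶠ n : ℕ in atTop, ∃ c, good n c := by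
    filter_upwards [eventually_typicalWords hq hu h hδ, eventually_gt_atTop 0,
      eventually_ceil_lt_ceil hR₂.le hR,
      (tendsto_two_rpow_neg hδ 48).eventually (gt_mem_nhds one_pos)] with n hS2 hn hLM hκ
    have hn' : (0 : ℝ) < n := by exact_mod_cast hn
    have hS : ∀ x ∈ typicalWords w q u h δ n, (∀ i : Fin n, 0 < q (u i) (x i)) ∧
        ∀ j, n * (pairMean w q (h j) - 2 * δ) ≤ ∑ i : Fin n, h j (u i) (x i) :=
      fun x hx => mem_typicalWords.1 hx
    -- The threshold `τ` is in nats. Of the 3δ in it, 2δ come from typicality and δ is the Chebyshev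
    -- deviation `t`.
    refine exists_wordCode (W := W) (C := ENNReal.ofReal (2 ^ (n * δ) * 2 ^ (-(n * (H - 2 * δ)))))
      (τ := n * (I - 3 * δ) * Real.log 2) (t := δ * Real.log 2 * n) hf hη hK h0 h1 hn
      (fun i => hq (u i)) (fun x hx => (hS x hx).1) hS2 hθ ?_ (by positivity) ?_ ?_ ?_ hLM ?_ ?_ ?_
    · intro x _
      have hp : ∀ x' ∈ typicalWords w q u h δ n, wordWeight (fun i : Fin n => q (u i)) x' ≤
          ENNReal.ofReal (2 ^ (-(n * (H - 2 * δ)))) := by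
        intro x' hx'
        refine wordWeight_le (hS x' hx').1 ?_
        have := (hS x' hx').2 1
        rw [hm1] at this
        exact this
      calc _ ≤ ∑ x' ∈ typicalWords w q u h δ n, ENNReal.ofReal (2 ^ (-(n * (H - 2 * δ)))) *
            (if (hammingDist x x' : ℝ) ≤ θ * n then 1 else 0) :=
            Finset.sum_le_sum fun x' hx' => by gcongr; exact hp x' hx'
        _ ≤ ∑ x', ENNReal.ofReal (2 ^ (-(n * (H - 2 * δ)))) *
            (if (hammingDist x x' : ℝ) ≤ θ * n then 1 else 0) :=
            Finset.sum_le_univ_sum_of_nonneg fun _ => zero_le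
        _ = ENNReal.ofReal (2 ^ (-(n * (H - 2 * δ)))) *
            ENNReal.ofReal ((Finset.univ.filter fun x' => (hammingDist x x' : ℝ) ≤ θ * n).card : ℝ) := by
            rw [← Finset.mul_sum, Finset.sum_boole, ENNReal.ofReal_natCast]
        _ ≤ ENNReal.ofReal (2 ^ (-(n * (H - 2 * δ)))) * ENNReal.ofReal (2 ^ (n * δ)) := by
            gcongr
            exact hball n x
        _ = _ := by rw [← ENNReal.ofReal_mul (by positivity), mul_comm]
    · exact fun x hx i => hvle _ _
    · intro x hx
      have h2 := (hS x hx).2 0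
      rw [hm0] at h2
      have h3 : ∑ i : Fin n, (klDiv (W (x i) : Measure Y) (mixture W (q (u i)))).toReal =
          Real.log 2 * ∑ i : Fin n, h 0 (u i) (x i) := by
        rw [Finset.mul_sum]
        refine Finset.sum_congr rfl fun i _ => ?_
        simp only [h, Matrix.cons_val_zero, toReal_klBits]
        field_simp
      rw [h3]
      have := mul_le_mul_of_nonneg_left h2 hl2.le
      linarith
    · exact Nat.one_le_iff_ne_zero.2 (Nat.ceil_pos.2 (by positivity)).ne'
    · simp [Real.rpow_pos_of_pos]
    · rw [← ENNReal.ofReal_one]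
      exact ENNReal.ofReal_le_ofReal hκ.le
    · have e : Real.exp (-(n * (I - 3 * δ) * Real.log 2)) = 2 ^ (-(n * (I - 3 * δ))) := by
        rw [Real.rpow_def_of_pos two_pos]
        congr 1
        ring
      rw [e]
      exact eight_mul_cost_le hδH hδI (ceil_two_rpow_le (hR₂.trans hR).le)
        (le_ceil_two_rpow n R₂)
  -- Over an empty alphabet all entropies vanish, contrary to 0 < R₁ < H.
  have hX : Nonempty X := by
    by_contra hne
    rw [not_nonempty_iff] at hne
    have hz : ∀ v, entropy (q v) = 0 := fun v => by simp [entropy]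
    simp only [hz, mul_zero, Finset.sum_const_zero] at hHdef
    linarith
  -- The trivial code fills the block lengths without a good code, of which there are finitely many.
  let c : ∀ n : ℕ, ListCode (Fin n → X) (Fin n → Y) := fun n =>
    if hc : ∃ c, good n c then hc.choose else trivialCode _ fun _ => Classical.arbitrary X
  have hc : ∀ᶠ n : ℕ in atTop, good n (c n) := by
    filter_upwards [hgood] with n hn
    simp only [c, dif_pos hn]
    exact hn.choose_spec
  have hK0 : Tendsto (fun n : ℕ => ENNReal.ofReal (n * K ^ 2 / (θ * η / 4 * n) ^ 2)) atTop (𝓝 0) :=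
    tendsto_chebyshev_bound _ (by positivity)
  have hv0 : Tendsto (fun n : ℕ => ENNReal.ofReal (n * v / (δ * Real.log 2 * n) ^ 2)) atTop (𝓝 0) :=
    tendsto_chebyshev_bound _ (by positivity)
  have hκ0 : Tendsto (fun n : ℕ => ENNReal.ofReal (48 * 2 ^ (-(n * δ)))) atTop (𝓝 0) := by
    have := (ENNReal.continuous_ofReal.tendsto 0).comp (tendsto_two_rpow_neg hδ 48)
    rwa [ENNReal.ofReal_zero] at this
  refine ⟨u, c, ⟨?_, ?_⟩, ⟨?_, ?_⟩, ?_⟩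
  · have hs := (hv0.add hK0).add hκ0
    rw [add_zero, add_zero] at hs
    exact tendsto_of_tendsto_of_tendsto_of_le_of_le' tendsto_const_nhds hs
      (Eventually.of_forall fun _ => zero_le) (hc.mono fun n hn => hn.2.2.2.1)
  · exact tendsto_of_tendsto_of_tendsto_of_le_of_le' tendsto_const_nhds hK0
      (Eventually.of_forall fun _ => zero_le) (hc.mono fun n hn => hn.2.2.2.2)
  · exact (tendsto_logb_ceil (hR₂.trans hR).le).congr' (hc.mono fun n hn => by simp only [hn.1])
  · exact (tendsto_logb_ceil hR₂.le).congr' (hc.mono fun n hn => by simp only [hn.2.1])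
  · filter_upwards [hc] with n hn m
    have hm := mem_typicalWords.1 (hn.2.2.1 m)
    refine ⟨hm.1, ?_⟩
    have h2 := hm.2 2
    rw [hm2] at h2
    have h3 : ∑ i : Fin n, h 2 (u i) ((c n).φ m i) = -∑ i : Fin n, g (u i) ((c n).φ m i) := by
      simp [h]
    rw [h3] at h2
    have h4 : (n : ℝ) * (2 * δ) ≤ n * ε := by gcongr
    linarith

end Direct

/-! ### Rényi moments -/

section Renyi

variable {α : ℝ}

lemma log2_div_le_iff (hα : 1 < α) {s : ℝ≥0∞} {b : ℝ} :
    log2 s / ((α - 1 : ℝ) : EReal) ≤ b ↔ s ≤ ENNReal.ofReal (2 ^ ((α - 1) * b)) := by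
  have h1 : (0 : EReal) < ((α - 1 : ℝ) : EReal) := by exact_mod_cast sub_pos.2 hα
  have h2 : (0 : EReal) < ((Real.log 2 : ℝ) : EReal) := by
    exact_mod_cast Real.log_pos one_lt_two
  rw [EReal.div_le_iff_le_mul h1 (EReal.coe_ne_top _), log2,
    EReal.div_le_iff_le_mul h2 (EReal.coe_ne_top _), ← ENNReal.log_le_log_iff,
    ENNReal.log_ofReal_of_pos (by positivity), Real.log_rpow two_pos, ← EReal.coe_mul,
    ← EReal.coe_mul, mul_comm (Real.log 2)]

lemma log2_div_nonneg (hα : 1 < α) {s : ℝ≥0∞} (hs : 1 ≤ s) :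
    0 ≤ log2 s / ((α - 1 : ℝ) : EReal) := by
  have h1 : (0 : EReal) ≤ ((α - 1 : ℝ) : EReal) := by exact_mod_cast (sub_pos.2 hα).le
  have h2 : (0 : EReal) ≤ ((Real.log 2 : ℝ) : EReal) := by
    exact_mod_cast (Real.log_pos one_lt_two).le
  exact EReal.div_nonneg (EReal.div_nonneg (ENNReal.zero_le_log_iff.2 hs) h2) h1

variable {B : Type*} [MeasurableSpace B]

lemma exp2_renyiDiv (hα : 1 < α) (P Q : Measure B) :
    exp2 (((α - 1 : ℝ) : EReal) * renyiDiv α P Q) = renyiMoment α P Q := by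
  have h1 : (α - 1 : ℝ) ≠ 0 := (sub_pos.2 hα).ne'
  rw [renyiDiv, EReal.mul_div_cancel (EReal.coe_ne_bot _) (EReal.coe_ne_top _)
    (by exact_mod_cast h1), exp2, log2, EReal.div_mul_cancel (EReal.coe_ne_bot _)
    (EReal.coe_ne_top _) (by exact_mod_cast (Real.log_pos one_lt_two).ne'), ENNReal.exp_log]

/-- The moment is the α-th power of the L^α(Q) norm of the density, which dominates its L¹(Q) norm 1
as `Q` is a probability measure. -/
lemma one_le_renyiMoment (hα : 1 < α) (P Q : Measure B) [IsProbabilityMeasure P]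
    [IsProbabilityMeasure Q] : 1 ≤ renyiMoment α P Q := by
  by_cases h : P ≪ Q
  · have hα0 : 0 < α := one_pos.trans hα
    have e : renyiMoment α P Q = ∫⁻ y, (P.rnDeriv Q y) ^ α ∂Q := by
      rw [renyiMoment, if_pos h, ← lintegral_rnDeriv_mul h
        ((Measure.measurable_rnDeriv P Q).pow_const _).aemeasurable]
      refine lintegral_congr_ae ?_
      filter_upwards [Measure.rnDeriv_ne_top P Q] with y hy
      rcases eq_or_ne (P.rnDeriv Q y) 0 with h0 | h0
      · simp [h0, hα0]
      · rw [show α = 1 + (α - 1) by ring, ENNReal.rpow_add _ _ h0 hy, ENNReal.rpow_one]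
        simp
    have h2 := eLpNorm_le_eLpNorm_of_exponent_le (μ := Q) (p := 1) (q := ENNReal.ofReal α)
      (by simpa using hα.le) (Measure.measurable_rnDeriv P Q).aestronglyMeasurable
    rw [eLpNorm_one_eq_lintegral_enorm, eLpNorm_eq_lintegral_rpow_enorm_toReal (by simpa using hα0)
      ENNReal.ofReal_ne_top] at h2
    simp only [enorm_eq_self, Measure.lintegral_rnDeriv h, measure_univ,
      ENNReal.toReal_ofReal hα0.le, ← e] at h2
    have h3 := ENNReal.rpow_le_rpow h2 hα0.le
    rwa [ENNReal.one_rpow, ← ENNReal.rpow_mul, one_div_mul_cancel hα0.ne', ENNReal.rpow_one] at h3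
  · simp [renyiMoment, h]

lemma renyiMoment_ne_top_of_smul_le (hα : 1 < α) {P Q : Measure B} [IsProbabilityMeasure P]
    [IsFiniteMeasure Q] {c : ℝ≥0∞} (hc : c ≠ 0) (hc' : c ≠ ∞) (h : c • P ≤ Q) :
    renyiMoment α P Q ≠ ∞ := by
  have hac : P ≪ Q :=
    (Measure.absolutelyContinuous_smul hc).trans (Measure.absolutelyContinuous_of_le h)
  have hb : ∀ᵐ y ∂Q, P.rnDeriv Q y ≤ c⁻¹ := by
    filter_upwards [Measure.rnDeriv_le_one_of_le h, Measure.rnDeriv_smul_left_of_ne_top P Q hc']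
      with y h1 h2
    rw [h2] at h1
    simp only [Pi.smul_apply, smul_eq_mul, Pi.one_apply] at h1
    rw [← one_div]
    exact (ENNReal.le_div_iff_mul_le (.inl hc) (.inl hc')).2 (by rwa [mul_comm])
  rw [renyiMoment, if_pos hac]
  have hle : ∫⁻ y, (P.rnDeriv Q y) ^ (α - 1) ∂P ≤ ∫⁻ _, c⁻¹ ^ (α - 1) ∂P :=
    lintegral_mono_ae (by
      filter_upwards [hac.ae_le hb] with y hy
      exact ENNReal.rpow_le_rpow hy (sub_pos.2 hα).le)
  refine (hle.trans_lt ?_).ne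
  simp only [lintegral_const, measure_univ, mul_one]
  exact ENNReal.rpow_lt_top_of_nonneg (sub_pos.2 hα).le (ENNReal.inv_ne_top.2 hc)

end Renyi

/-! ### Nearly optimal reference laws for Rényi information -/

section RenyiInfo

variable {X Y : Type*} [Fintype X] [MeasurableSpace Y] {W : X → ProbabilityMeasure Y} {α : ℝ}
  {p : X → ℝ}

lemma renyiInfo_eq (hα : 1 < α) (W : X → ProbabilityMeasure Y) (p : X → ℝ) :
    renyiInfo α W p = (⨅ Q : ProbabilityMeasure Y,
      log2 (∑ x, ENNReal.ofReal (p x) * renyiMoment α (W x : Measure Y) (Q : Measure Y))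
        / ((α - 1 : ℝ) : EReal)).toReal := by
  simp only [renyiInfo, exp2_renyiDiv hα]

lemma renyiInfo_nonneg (hα : 1 < α) (hp : p ∈ stdSimplex ℝ X) : 0 ≤ renyiInfo α W p := by
  rw [renyiInfo_eq hα]
  refine EReal.toReal_nonneg (le_iInf fun Q => log2_div_nonneg hα ?_)
  calc (1 : ℝ≥0∞) = ∑ x, ENNReal.ofReal (p x) * 1 := by
        simp only [mul_one]
        rw [← ENNReal.ofReal_sum_of_nonneg fun a _ => hp.1 a, hp.2, ENNReal.ofReal_one]
    _ ≤ _ := Finset.sum_le_sum fun x _ => by gcongr; exact one_le_renyiMoment hα _ _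

/-- A nearly optimal output distribution for `renyiInfo`, with the exponents of the letters. -/
lemma exists_renyiInfo_near (hα : 1 < α) (hp : p ∈ stdSimplex ℝ X) {ε : ℝ} (hε : 0 < ε) :
    ∃ (Q : ProbabilityMeasure Y) (g : X → ℝ),
      (∀ a, 0 < p a → (W a : Measure Y) ≪ Q ∧
        renyiMoment α (W a : Measure Y) Q = ENNReal.ofReal (2 ^ ((α - 1) * g a))) ∧
      ∑ a, p a * g a ≤ renyiInfo α W p + ε := by
  have hα1 := sub_pos.2 hα
  set F : ProbabilityMeasure Y → ℝ≥0∞ := fun Q =>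
    ∑ x, ENNReal.ofReal (p x) * renyiMoment α (W x : Measure Y) (Q : Measure Y) with hF
  set J : EReal := ⨅ Q : ProbabilityMeasure Y, log2 (F Q) / ((α - 1 : ℝ) : EReal) with hJ
  have hmix := isProbabilityMeasure_mixture W hp
  have hfin : F ⟨mixture W p, hmix⟩ ≠ ∞ := by
    refine ENNReal.sum_ne_top.2 fun x _ => ?_
    rcases (hp.1 x).eq_or_lt with h0 | h0
    · simp [← h0]
    · exact ENNReal.mul_ne_top ENNReal.ofReal_ne_top (renyiMoment_ne_top_of_smul_le hα
        (Q := mixture W p) (by simpa using h0) ENNReal.ofReal_ne_top (smul_le_mixture W p x))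
  have hJtop : J ≠ ⊤ := by
    refine ((iInf_le _ ⟨mixture W p, hmix⟩).trans_lt ?_).ne
    obtain ⟨b, hb⟩ : ∃ b : ℝ, (F ⟨mixture W p, hmix⟩).toReal ≤ 2 ^ ((α - 1) * b) := by
      refine ⟨Real.logb 2 (max 1 (F ⟨mixture W p, hmix⟩).toReal) / (α - 1), ?_⟩
      rw [mul_div_cancel₀ _ hα1.ne', Real.rpow_logb two_pos (by norm_num) (by positivity)]
      exact le_max_right _ _
    have := (log2_div_le_iff hα).2 ((ENNReal.ofReal_toReal hfin).symm.le.trans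
      (ENNReal.ofReal_le_ofReal hb))
    exact this.trans_lt (EReal.coe_lt_top b)
  have hJr : J ≤ ((renyiInfo α W p : ℝ) : EReal) := by
    rw [renyiInfo_eq hα]
    exact EReal.le_coe_toReal hJtop
  have hlt : J < ((renyiInfo α W p + ε : ℝ) : EReal) :=
    hJr.trans_lt (by exact_mod_cast lt_add_of_pos_right _ hε)
  obtain ⟨Q, hQ⟩ := iInf_lt_iff.1 hlt
  have hQF := (log2_div_le_iff hα).1 hQ.le
  have hFt : F Q ≠ ∞ := (hQF.trans_lt ENNReal.ofReal_lt_top).ne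
  have hm : ∀ a, 0 < p a → renyiMoment α (W a : Measure Y) Q ≠ ∞ := fun a ha h =>
    (ENNReal.sum_ne_top.1 hFt a (Finset.mem_univ a))
      (by rw [h]; exact ENNReal.mul_top (by simpa using ha))
  -- The value 1 off the support is a filler that keeps the logarithms in Jensen's inequality
  -- meaningful; the moments there may be infinite.
  set m : X → ℝ := fun a => if 0 < p a then (renyiMoment α (W a : Measure Y) Q).toReal else 1
    with hmdef
  have hm1 : ∀ a, 0 < m a := by
    intro a
    simp only [hmdef]
    split_ifs with ha
    · exact ENNReal.toReal_pos (one_pos.trans_le (one_le_renyiMoment hα _ _)).ne' (hm a ha)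
    · exact one_pos
  have hsum : ∑ a, p a * m a = (F Q).toReal := by
    rw [hF, ENNReal.toReal_sum (ENNReal.sum_ne_top.1 hFt)]
    refine Finset.sum_congr rfl fun a _ => ?_
    rw [ENNReal.toReal_mul, ENNReal.toReal_ofReal (hp.1 a)]
    rcases (hp.1 a).eq_or_lt with h0 | h0
    · simp [← h0]
    · simp [hmdef, h0]
  refine ⟨Q, fun a => Real.logb 2 (m a) / (α - 1), fun a ha => ⟨?_, ?_⟩, ?_⟩
  · by_contra hac
    exact hm a ha (by simp [renyiMoment, hac])
  · rw [mul_div_cancel₀ _ hα1.ne', Real.rpow_logb two_pos (by norm_num) (hm1 a)]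
    simp only [hmdef, if_pos ha]
    exact (ENNReal.ofReal_toReal (hm a ha)).symm
  -- Concavity of the logarithm: the mean exponent, which is what typical words see, is at most the
  -- exponent of the mean moment.
  · have hjensen := strictConcaveOn_log_Ioi.concaveOn.le_map_sum (t := Finset.univ) (w := p) (p := m)
      (fun a _ => hp.1 a) hp.2 (fun a _ => hm1 a)
    simp only [smul_eq_mul, hsum] at hjensen
    have hpos : 0 < (F Q).toReal := by
      rw [← hsum]
      obtain ⟨a, ha⟩ : ∃ a, 0 < p a := by
        by_contra! hc
        linarith [hp.2, Finset.sum_nonpos fun a (_ : a ∈ Finset.univ) => hc a]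
      exact Finset.sum_pos' (fun a _ => mul_nonneg (hp.1 a) (hm1 a).le)
        ⟨a, Finset.mem_univ a, mul_pos ha (hm1 a)⟩
    have hlog : Real.log (F Q).toReal ≤ (α - 1) * (renyiInfo α W p + ε) * Real.log 2 := by
      rw [← Real.log_rpow two_pos]
      refine Real.log_le_log hpos ?_
      exact ENNReal.toReal_le_of_le_ofReal (by positivity) hQF
    have hl2 := Real.log_pos one_lt_two
    have e : ∑ a, p a * (Real.logb 2 (m a) / (α - 1)) =
        (∑ a, p a * Real.log (m a)) / (Real.log 2 * (α - 1)) := by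
      rw [Finset.sum_div]
      refine Finset.sum_congr rfl fun a _ => ?_
      rw [Real.logb]
      field_simp
    rw [e, div_le_iff₀ (by positivity)]
    linarith

end RenyiInfo

/-! ### Lower bounds for the equivocation from a reference law -/

section Equivocation

variable {A B : Type*} [MeasurableSpace B] {V : A → ProbabilityMeasure B} {c : ListCode A B} {b : ℝ}

lemma average_le {f : Fin c.M → ℝ≥0∞} {C : ℝ≥0∞} (h : ∀ m, f m ≤ C) :
    ∑ m, (c.M : ℝ≥0∞)⁻¹ * f m ≤ C := by
  calc _ ≤ ∑ _m : Fin c.M, (c.M : ℝ≥0∞)⁻¹ * C := Finset.sum_le_sum fun m _ => by gcongr; exact h m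
    _ = C := by
      rw [Finset.sum_const, Finset.card_univ, Fintype.card_fin, nsmul_eq_mul, ← mul_assoc,
        ENNReal.mul_inv_cancel (by exact_mod_cast c.M_pos.ne') (by simp), one_mul]

lemma le_equivocation (hb : 0 ≤ b) (Q : Measure B) [hQ : IsProbabilityMeasure Q]
    (h : ∀ m, klBits (V (c.φ m) : Measure B) Q ≤ ENNReal.ofReal b) :
    Real.logb 2 c.M - b ≤ equivocation V c := by
  rw [equivocation_eq]
  refine sub_le_sub_left ?_ _
  refine ENNReal.toReal_le_of_le_ofReal hb ((iInf_le _ ⟨Q, hQ⟩).trans ?_)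
  exact average_le h

lemma le_renyiEquivocation {α : ℝ} (hα : 1 < α) (hb : 0 ≤ b) (Q : Measure B)
    [hQ : IsProbabilityMeasure Q]
    (h : ∀ m, renyiMoment α (V (c.φ m) : Measure B) Q ≤ ENNReal.ofReal (2 ^ ((α - 1) * b))) :
    Real.logb 2 c.M - b ≤ renyiEquivocation α V c := by
  refine sub_le_sub_left ?_ _
  simp only [exp2_renyiDiv hα]
  set J : EReal := ⨅ Q : ProbabilityMeasure B,
    log2 (∑ m, (c.M : ℝ≥0∞)⁻¹ * renyiMoment α (V (c.φ m) : Measure B) (Q : Measure B))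
      / ((α - 1 : ℝ) : EReal)
  have hJ : J ≤ b := by
    refine (iInf_le _ ⟨Q, hQ⟩).trans ?_
    exact (log2_div_le_iff hα).2 (average_le h)
  -- At ⊥ the real value defaults to 0, which is where b ≥ 0 enters.
  rcases eq_or_ne J ⊥ with h0 | h0
  · simpa [h0] using hb
  · have := EReal.toReal_le_toReal hJ h0 (EReal.coe_ne_top b)
    simpa using this

end Equivocation

/-! ### Conditional laws of a time-sharing distribution -/

section TimeSharing

variable {U X : Type*} [Fintype U] [Fintype X] {P : U × X → ℝ}

lemma marginalU_mem_stdSimplex (hP : P ∈ stdSimplex ℝ (U × X)) :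
    marginalU P ∈ stdSimplex ℝ U := by
  refine ⟨fun u => Finset.sum_nonneg fun x _ => hP.1 (u, x), ?_⟩
  simp only [marginalU]
  rw [← hP.2, Fintype.sum_prod_type]

/-- For `u` of probability zero, division by zero makes `condX P u` the zero function; another
conditional law replaces it at no cost, its weight being zero. -/
lemma exists_timeSharing (hP : P ∈ stdSimplex ℝ (U × X)) :
    ∃ q : U → X → ℝ, (∀ u, q u ∈ stdSimplex ℝ X) ∧ ∀ F : (X → ℝ) → ℝ,
      ∑ u, marginalU P u * F (condX P u) = ∑ u, marginalU P u * F (q u) := by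
  classical
  obtain ⟨u₀, hu₀⟩ : ∃ u, marginalU P u ≠ 0 := by
    by_contra! h
    have := (marginalU_mem_stdSimplex hP).2
    simp [h] at this
  refine ⟨fun u => if marginalU P u = 0 then condX P u₀ else condX P u, fun u => ?_, fun F => ?_⟩
  · dsimp only
    split_ifs with h
    · exact condX_mem_stdSimplex hP.1 hu₀
    · exact condX_mem_stdSimplex hP.1 h
  · refine Finset.sum_congr rfl fun u _ => ?_
    by_cases h : marginalU P u = 0
    · simp [h]
    · simp [h]

lemma condEntropy_eq (hP : ∀ a, 0 ≤ P a) :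
    condEntropy P = ∑ u, marginalU P u * entropy (condX P u) := by
  simp only [condEntropy, entropy, mul_neg, Finset.sum_neg_distrib, Finset.mul_sum]
  congr 1
  refine Finset.sum_congr rfl fun u _ => Finset.sum_congr rfl fun x _ => ?_
  by_cases h : marginalU P u = 0
  · have := (Finset.sum_eq_zero_iff_of_nonneg fun x _ => hP (u, x)).1 h x (Finset.mem_univ x)
    simp [h, this]
  · rw [← mul_assoc, condX, mul_div_cancel₀ _ h]

end TimeSharing

/-! ### The direct part -/

section Achievability

variable {X Y : Type*} [Fintype X] [MeasurableSpace Y] {W : X → ProbabilityMeasure Y}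

lemma le_liminf_of_eventually {E m : ℕ → ℝ} {R₁ R₃ b : ℝ}
    (hm : Tendsto (fun n : ℕ => m n / n) atTop (𝓝 R₁)) (h : ∀ᶠ n : ℕ in atTop, m n - n * b ≤ E n)
    (hR : R₃ < R₁ - b) :
    (R₃ : EReal) ≤ liminf (fun n : ℕ => ((E n / n : ℝ) : EReal)) atTop := by
  refine le_liminf_of_le (by isBoundedDefault) ?_
  filter_upwards [h, hm.eventually (lt_mem_nhds (by linarith : R₃ + b < R₁)),
    eventually_gt_atTop 0] with n h1 h2 hn
  have hn' : (0 : ℝ) < n := by exact_mod_cast hn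
  have h3 : (m n - n * b) / n ≤ E n / n := by gcongr
  rw [sub_div, mul_div_cancel_left₀ _ hn'.ne'] at h3
  exact_mod_cast (by linarith : R₃ ≤ E n / n)

variable {U : Type*} [Fintype U] {P : U × X → ℝ} {R₁ R₂ R₃ : ℝ}

/-- The direct part for the equivocation. -/
lemma exists_codes_equivocation (hW : NonRedundant W) (hP : P ∈ stdSimplex ℝ (U × X))
    (hR₂ : 0 < R₂) (hR : R₂ < R₁) (hI : R₁ - R₂ < condMutualInfo W P) (hH : R₁ < condEntropy P)
    (hR₃ : R₃ < R₁ - condMutualInfo W P) :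
    ∃ c : ∀ n : ℕ, ListCode (Fin n → X) (Fin n → Y), Secure .strong W c ∧ HasRates c R₁ R₂ ∧
      (R₃ : EReal) ≤
        liminf (fun n : ℕ => ((equivocation (channelPow W n) (c n) / n : ℝ) : EReal)) atTop := by
  obtain ⟨q, hq, hF⟩ := exists_timeSharing hP
  have hw := marginalU_mem_stdSimplex hP
  rw [condEntropy_eq hP.1, hF] at hH
  rw [condMutualInfo, hF] at hI hR₃
  set w := marginalU P
  set I := ∑ u, w u * mutualInfo W (q u) with hIdef
  obtain ⟨u, c, hs, hr, hc⟩ := exists_secure_codes hW hw hq hR₂ hR hI hH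
    (fun v a => (klBits (W a : Measure Y) (mixture W (q v))).toReal)
    (ε := (R₁ - I - R₃) / 2) (by linarith)
  refine ⟨c, hs, hr, le_liminf_of_eventually (b := I + (R₁ - I - R₃) / 2) hr.1 ?_ (by linarith)⟩
  have hI0 : 0 ≤ I := Finset.sum_nonneg fun v _ =>
    mul_nonneg (hw.1 v) (mutualInfo_nonneg W (hq v).1)
  filter_upwards [hc] with n hn
  have hprob : ∀ i : Fin n, IsProbabilityMeasure (mixture W (q (u i))) :=
    fun i => isProbabilityMeasure_mixture W (hq _)
  -- The reference law is the product of the output laws prescribed by `u`; it need not be optimal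
  -- for the code, but any law bounds the minimum.
  refine le_equivocation (mul_nonneg (Nat.cast_nonneg n) (by linarith))
    (Measure.pi fun i : Fin n => mixture W (q (u i))) fun m => ?_
  obtain ⟨hpos, hsum⟩ := hn m
  refine (klBits_pi_le (fun i => (W ((c n).φ m i) : Measure Y)) _).trans ?_
  refine le_trans (le_of_eq ?_) (ENNReal.ofReal_le_ofReal hsum)
  rw [ENNReal.ofReal_sum_of_nonneg fun _ _ => ENNReal.toReal_nonneg]
  refine Finset.sum_congr rfl fun i _ => (ENNReal.ofReal_toReal ?_).symm
  exact klBits_ne_top_iff.2 (klDiv_mixture_ne_top W (hq _) (hpos i))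

/-- The direct part for the Rényi equivocation. -/
lemma exists_codes_renyiEquivocation (hW : NonRedundant W) {α : ℝ} (hα : 1 < α)
    (hP : P ∈ stdSimplex ℝ (U × X)) (hR₂ : 0 < R₂) (hR : R₂ < R₁)
    (hI : R₁ - R₂ < condMutualInfo W P) (hH : R₁ < condEntropy P)
    (hR₃ : R₃ < R₁ - condRenyiInfo α W P) :
    ∃ c : ∀ n : ℕ, ListCode (Fin n → X) (Fin n → Y), Secure .strong W c ∧ HasRates c R₁ R₂ ∧
      (R₃ : EReal) ≤ liminf
        (fun n : ℕ => ((renyiEquivocation α (channelPow W n) (c n) / n : ℝ) : EReal)) atTop := by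
  obtain ⟨q, hq, hF⟩ := exists_timeSharing hP
  have hw := marginalU_mem_stdSimplex hP
  rw [condEntropy_eq hP.1, hF] at hH
  rw [condMutualInfo, hF] at hI
  rw [condRenyiInfo, hF] at hR₃
  set w := marginalU P
  set I := ∑ u, w u * renyiInfo α W (q u) with hIdef
  set δ := (R₁ - I - R₃) / 3 with hδ
  have hδ0 : 0 < δ := by linarith
  choose Q g hQ hg using fun v => exists_renyiInfo_near (W := W) hα (hq v) hδ0
  obtain ⟨u, c, hs, hr, hc⟩ := exists_secure_codes hW hw hq hR₂ hR hI hH g hδ0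
  refine ⟨c, hs, hr, le_liminf_of_eventually (b := I + 2 * δ) hr.1 ?_ (by linarith)⟩
  have hI0 : 0 ≤ I := Finset.sum_nonneg fun v _ =>
    mul_nonneg (hw.1 v) (renyiInfo_nonneg hα (hq v))
  have hmean : pairMean w q g ≤ I + δ := by
    -- One δ is lost in the choice of the reference laws and one in typicality; the third part of
    -- the gap keeps the inequality strict.
    calc pairMean w q g ≤ ∑ v, w v * (renyiInfo α W (q v) + δ) :=
          Finset.sum_le_sum fun v _ => mul_le_mul_of_nonneg_left (hg v) (hw.1 v)
      _ = I + δ := by simp only [mul_add, Finset.sum_add_distrib, ← Finset.sum_mul, hw.2, one_mul,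
          hIdef]
  filter_upwards [hc] with n hn
  refine le_renyiEquivocation hα (mul_nonneg (Nat.cast_nonneg n) (by linarith))
    (Measure.pi fun i : Fin n => (Q (u i) : Measure Y)) fun m => ?_
  obtain ⟨hpos, hsum⟩ := hn m
  calc renyiMoment α (channelPow W n ((c n).φ m) : Measure (Fin n → Y))
        (Measure.pi fun i : Fin n => (Q (u i) : Measure Y))
      = ∏ i : Fin n, renyiMoment α (W ((c n).φ m i) : Measure Y) (Q (u i)) :=
        renyiMoment_pi _ _ α hα fun i => (hQ (u i) _ (hpos i)).1
    _ = ∏ i : Fin n, ENNReal.ofReal (2 ^ ((α - 1) * g (u i) ((c n).φ m i))) :=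
        Finset.prod_congr rfl fun i _ => (hQ (u i) _ (hpos i)).2
    _ = ENNReal.ofReal (2 ^ ((α - 1) * ∑ i : Fin n, g (u i) ((c n).φ m i))) := by
        rw [← ENNReal.ofReal_prod_of_nonneg fun _ _ => by positivity, Finset.mul_sum,
          Real.rpow_sum_of_pos two_pos]
    _ ≤ _ := by
        refine ENNReal.ofReal_le_ofReal (Real.rpow_le_rpow_of_exponent_le one_le_two ?_)
        refine mul_le_mul_of_nonneg_left (hsum.trans ?_) (sub_pos.2 hα).le
        exact mul_le_mul_of_nonneg_left (by linarith) (Nat.cast_nonneg n)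

omit [Fintype X] in
lemma Secure.of_strong {G : Binding} {c : ∀ n : ℕ, ListCode (Fin n → X) (Fin n → Y)}
    (h : Secure .strong W c) : Secure G W c := by
  cases G with
  | strong => exact h
  | weak => exact h.weak

/-- The construction needs a strict bound on R₃, while 𝒞 allows equality; lowering R₃ slightly is
absorbed by the closure. -/
theorem regionC_subset_closure (hW : NonRedundant W) (G : Binding) :
    regionC W ⊆ closure (achievable G W) := by
  rintro ⟨R₁, R₂, R₃⟩ ⟨k, P, hP, ⟨h12, hI⟩, hR₃, hH, h1, h2, h3⟩
  simp only at h12 hI hR₃ hH h1 h2 h3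
  rw [Metric.mem_closure_iff]
  intro ε hε
  obtain ⟨δ, hδ, hδε, hδ3⟩ : ∃ δ, 0 < δ ∧ δ < ε ∧ δ < R₃ := by
    obtain ⟨δ, h, h'⟩ := exists_between (lt_min hε h3)
    exact ⟨δ, h, h'.trans_le (min_le_left _ _), h'.trans_le (min_le_right _ _)⟩
  obtain ⟨c, hs, hr, hE⟩ := exists_codes_equivocation (R₃ := R₃ - δ) hW hP h2 (by linarith) hI hH
    (by linarith)
  refine ⟨(R₁, R₂, R₃ - δ), ⟨⟨h1, h2, by simpa using hδ3⟩, c, hs.of_strong, hr, hE⟩, ?_⟩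
  simpa [Prod.dist_eq, abs_of_pos hδ, hε] using hδε

theorem regionCα_subset_achievableα (hW : NonRedundant W) (G : Binding) {α : ℝ} (hα : 1 < α) :
    regionCα α W ⊆ achievableα α G W := by
  rintro ⟨R₁, R₂, R₃⟩ ⟨k, P, hP, ⟨h12, hI⟩, hR₃, hH, hpos⟩
  simp only at h12 hI hR₃ hH
  obtain ⟨c, hs, hr, hE⟩ := exists_codes_renyiEquivocation hW hα hP hpos.2.1
    (sub_pos.1 h12) hI hH hR₃
  exact ⟨hpos, c, hs.of_strong, hr, hE⟩

end Achievability

end SecureListDecoding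

theorem mainTheorem2 {X Y : Type*} [Fintype X] [MeasurableSpace Y]
    (W : X → ProbabilityMeasure Y) (hW : SecureListDecoding.NonRedundant W)
    (G : SecureListDecoding.Binding) :
    closure (SecureListDecoding.achievable G W) = closure (SecureListDecoding.regionC W) ∧
      ∀ α : ℝ, 1 < α →
        SecureListDecoding.regionCα α W ⊆ SecureListDecoding.achievableα α G W :=
  ⟨(closure_minimal (SecureListDecoding.achievable_subset_closure hW G) isClosed_closure).antisymm
    (closure_minimal (SecureListDecoding.regionC_subset_closure hW G) isClosed_closure),
    fun _ hα => SecureListDecoding.regionCα_subset_achievableα hW G hα⟩
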